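/- **Lemma 5.3 (energy conservation).** Let $m>0$, let $\alpha_1,\alpha_2,\alpha_3,\beta$ be $4\times4$ Dirac matrices (Hermitian, with $\alpha_k^2=\beta^2=1$, $\alpha_k\alpha_l+\alpha_l\alpha_k=0$ for $k\ne l$, and $\alpha_k\beta+\beta\alpha_k=0$), and let $D_m=-i\alpha\cdot\nabla+m\beta$ on $\mathbb C^4$-valued tempered distributions on $\mathbb R^3$, with $D_m^{-1}:=D_m(-\Delta+m^2)^{-1}$. Let $g(x)=e^{-m|x|}/(4\pi|x|)$ be the Green function of $-\Delta+m^2$ and, for $\varepsilon>0$, $$(K_m^\varepsilon u)(x)=\frac1{(2\pi)^3}\int_{\mathbb R^3}\frac{e^{-i\xi\cdot x}\,\hat u(\xi)}{(|\xi|^2+m^2)^{\varepsilon}}\,d^3\xi,\qquad \hat u(\xi)=\int_{\mathbb R^3} e^{i\xi\cdot x}u(x)\,d^3x .$$ All function spaces below consist of $\mathbb C^4$-valued functions; $\|\cdot\|$ is the norm of $L^2(\mathbb R^3)\otimes\mathbb C^4$, and $u\in H^{\frac32-}$ means $u\in H^s(\mathbb R^3)$ for every $s<\frac32$. For $F=(F_1,\dots,F_4)$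 with $F_j:\mathbb C\to\mathbb C$ and $F(\zeta)=(F_j(\zeta_j))_{j}$, let $\mathcal D_F$ be the set of $\psi\in L^2(\mathbb R^3)$ of the form $\psi=\psi_{reg}+\zeta g$ with $\zeta\in\mathbb C^4$, $\psi_{reg}\in H^{\frac32-}$, such that $\lim_{\varepsilon\to0+}\lim_{x\to0}K_m^\varepsilon\psi_{reg}(x)$ exists and equals $F(\zeta)$. Let $a\in\mathbb R$, $b>0$, and let $U\in C^2(\mathbb C^4,\mathbb R)$ satisfy $U(\zeta)\ge b|\zeta|^2-a$ and $F_j(\zeta_j)=\partial_{\bar\zeta_j}U(\zeta)$, where $\partial_{\bar\zeta_j}=\frac12(\partial_{\mathrm{Re}\,\zeta_j}+i\,\partial_{\mathrm{Im}\,\zeta_j})$. Let $f\in H^2(\mathbb R^3)$, $\zeta_0\in\mathbb C^4$, $\psi_0=f+\zeta_0g$, $\mathcal H_F(\psi_0)=\|D_mf\|^2+U(\zeta_0)$ and $\Lambda=\sqrt{(\mathcal H_F(\psi_0)+a)/b}$. Let $\tilde U\in C^2(\mathbb C^4,\mathbb R)$ satisfy $\tilde U(\zeta)=U(\zeta)$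 for $|\zeta|\le\Lambda$, $\tilde U(\zeta)\ge b|\zeta|^2-a$ for all $\zeta$, and $\tilde F_j(\zeta_j)=\partial_{\bar\zeta_j}\tilde U(\zeta)$ with functions $\tilde F_j:\mathbb C\to\mathbb C$ that are Lipschitz continuous. Let $\tau>0$ and let $\psi\in C([0,\tau],L^2(\mathbb R^3))$, $\psi(t)=\psi_{reg}(t)+\zeta(t)g$ with $\zeta\in C([0,\tau],\mathbb C^4)$, be a solution on $[0,\tau]$ of the modified Cauchy problem: $\psi_{reg}(0)=f$ and $\zeta(0)=\zeta_0$, so that $\psi(0)=\psi_0$; for every $t\in(0,\tau]$, $\psi(t)\in\mathcal D_{\tilde F}$ with regular part $\psi_{reg}(t)$ and coefficient $\zeta(t)$, that is, $\psi_{reg}(t)\in H^{\frac32-}$ and $$\lim_{\varepsilon\to0+}\lim_{x\to0}K_m^\varepsilon\big(\psi(\cdot,t)-\zeta(t)g\big)(x)=\tilde F(\zeta(t));$$ and $$i\dot\psi(t)=D_m\psi(t)-D_m^{-1}\zeta(t)\delta(x),\qquad t\in(0,\tau),$$ in the sense of tempered distributions. Then $D_m\psi_{reg}(t)\in L^2(\mathbb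 R^3)$ for all $t\in[0,\tau]$, and $$\mathcal H_{\tilde F}(\psi(\cdot,t))=\|D_m\psi_{reg}(\cdot,t)\|^2+\tilde U(\zeta(t))=\mathrm{const},\qquad t\in[0,\tau].$$ -/

import Mathlib

open MeasureTheory Filter Topology
open scoped SchwartzMap FourierTransform LineDeriv

namespace DiracPoint

noncomputable section

/-- Physical space `ℝ³`. -/
abbrev Space := EuclideanSpace ℝ (Fin 3)

/-- The space of spinor values `ℂ⁴`, with its Hermitian norm. -/
abbrev Spinor := EuclideanSpace ℂ (Fin 4)

/-- `L²(ℝ³) ⊗ ℂ⁴`. -/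
abbrev L2 := Lp Spinor 2 (volume : Measure Space)

/-- `ℂ⁴`-valued tempered distributions on `ℝ³`. -/
abbrev Distr := 𝓢'(Space, Spinor)

/-- `α₁, α₂, α₃, β` are Dirac matrices: Hermitian `4 × 4` matrices with the Clifford relations. -/
structure IsDiracMatrices (α : Fin 3 → Matrix (Fin 4) (Fin 4) ℂ)
    (β : Matrix (Fin 4) (Fin 4) ℂ) : Prop where
  hermitian_alpha : ∀ k, (α k).IsHermitian
  hermitian_beta : β.IsHermitian
  sq_alpha : ∀ k, α k * α k = 1
  sq_beta : β * β = 1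
  anticomm_alpha : ∀ k l, k ≠ l → α k * α l + α l * α k = 0
  anticomm_beta : ∀ k, α k * β + β * α k = 0

/-- A constant matrix acting on the values of a distribution. -/
def matAct (A : Matrix (Fin 4) (Fin 4) ℂ) : Distr →L[ℂ] Distr :=
  PointwiseConvergenceCLM.postcomp 𝓢(Space, ℂ) (Matrix.toEuclideanCLM (n := Fin 4) (𝕜 := ℂ) A)

/-- The Dirac operator `D_m = -i α · ∇ + m β` on tempered distributions. -/
def dirac (m : ℝ) (α : Fin 3 → Matrix (Fin 4) (Fin 4) ℂ) (β : Matrix (Fin 4) (Fin 4) ℂ)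
    (u : Distr) : Distr :=
  (-Complex.I) • ∑ k : Fin 3, matAct (α k) (∂_{EuclideanSpace.single k (1 : ℝ)} u)
    + (m : ℂ) • matAct β u

/-- The symbol of `(-Δ + m²)^{-ε}`. Mathlib's Fourier transform has the kernel `e^{-2πi⟨x, ξ⟩}`,
hence the frequency is `2πξ`. -/
def smoothingSymbol (m ε : ℝ) (ξ : Space) : ℝ :=
  ((2 * Real.pi * ‖ξ‖) ^ 2 + m ^ 2) ^ (-ε)

/-- `D_m⁻² = (-Δ + m²)⁻¹` on tempered distributions. -/
def resolvent (m : ℝ) : Distr →L[ℂ] Distr :=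
  TemperedDistribution.fourierMultiplierCLM Spinor
    (fun ξ : Space => ((smoothingSymbol m 1 ξ : ℝ) : ℂ))

/-- `D_m⁻¹ = D_m D_m⁻²` on tempered distributions. -/
def diracInv (m : ℝ) (α : Fin 3 → Matrix (Fin 4) (Fin 4) ℂ) (β : Matrix (Fin 4) (Fin 4) ℂ)
    (u : Distr) : Distr :=
  dirac m α β (resolvent m u)

/-- The distribution `ζ δ(x)`. -/
def deltaSpinor (ζ : Spinor) : Distr :=
  PointwiseConvergenceCLM.postcomp 𝓢(Space, ℂ) (ContinuousLinearMap.toSpanSingleton ℂ ζ)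
    (TemperedDistribution.delta (0 : Space))

/-- The Green function `g(x) = e^{-m|x|} / (4π|x|)` of `-Δ + m²`. -/
def green (m : ℝ) (x : Space) : ℂ :=
  ((Real.exp (-m * ‖x‖) / (4 * Real.pi * ‖x‖) : ℝ) : ℂ)

/-- The value `(K_m^ε u)(x)` of the smoothing operator `K_m^ε = (-Δ + m²)^{-ε}`, given by the
inverse Fourier integral. -/
def smoothing (m ε : ℝ) (u : L2) (x : Space) : Spinor :=
  𝓕⁻ (fun ξ : Space => ((smoothingSymbol m ε ξ : ℝ) : ℂ) • (𝓕 u : L2) ξ) x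

/-- The iterated limit `lim_{ε → 0+} lim_{x → 0} (K_m^ε u)(x)` exists and equals `v`. -/
def HasRegularizedValue (m : ℝ) (u : L2) (v : Spinor) : Prop :=
  ∃ L : ℝ → Spinor,
    (∀ ε, 0 < ε → Tendsto (fun x => smoothing m ε u x) (𝓝[≠] 0) (𝓝 (L ε))) ∧
      Tendsto L (𝓝[>] 0) (𝓝 v)

/-- `ψ = u + ζ g`. -/
def Decomposes (m : ℝ) (ψ u : L2) (ζ : Spinor) : Prop :=
  ∀ᵐ x : Space, ψ x = u x + green m x • ζ

/-- The map `ζ ↦ (F₁(ζ₁), …, F₄(ζ₄))` of `ℂ⁴`. -/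
def nonlinearity (F : Fin 4 → ℂ → ℂ) (ζ : Spinor) : Spinor :=
  WithLp.toLp 2 fun j => F j (ζ j)

/-- `ψ` belongs to the domain `𝒟_F`, with regular part `u` and singular coefficient `ζ`. -/
structure InDomain (m : ℝ) (F : Fin 4 → ℂ → ℂ) (ψ u : L2) (ζ : Spinor) : Prop where
  decomp : Decomposes m ψ u ζ
  regular : ∀ s : ℝ, s < 3 / 2 → TemperedDistribution.MemSobolev s 2 (u : Distr)
  value : HasRegularizedValue m u (nonlinearity F ζ)

/-- `∂U/∂ζ̄ⱼ = ½ (∂U/∂(Re ζⱼ) + i ∂U/∂(Im ζⱼ))`. -/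
def dbar (U : Spinor → ℝ) (j : Fin 4) (ζ : Spinor) : ℂ :=
  (1 / 2 : ℂ) * ((fderiv ℝ U ζ (EuclideanSpace.single j 1) : ℂ)
    + Complex.I * (fderiv ℝ U ζ (EuclideanSpace.single j Complex.I) : ℂ))

/-- `U` is a `C²` potential of the nonlinearity `F`, that is `Fⱼ(ζⱼ) = ∂U/∂ζ̄ⱼ`, and it satisfies
`U(ζ) ≥ b|ζ|² - a`. -/
structure IsPotential (a b : ℝ) (U : Spinor → ℝ) (F : Fin 4 → ℂ → ℂ) : Prop where
  contDiff : ContDiff ℝ 2 U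
  grad : ∀ j ζ, F j (ζ j) = dbar U j ζ
  lower : ∀ ζ, b * ‖ζ‖ ^ 2 - a ≤ U ζ

/-- The Hamiltonian `‖D_m u‖² + U(ζ)` is defined (that is, `D_m u ∈ L²`) and has the value `h`. -/
def HasEnergy (m : ℝ) (α : Fin 3 → Matrix (Fin 4) (Fin 4) ℂ) (β : Matrix (Fin 4) (Fin 4) ℂ)
    (U : Spinor → ℝ) (u : L2) (ζ : Spinor) (h : ℝ) : Prop :=
  ∃ w : L2, (w : Distr) = dirac m α β (u : Distr) ∧ ‖w‖ ^ 2 + U ζ = h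

/-- `ψ`, with regular part `u` and singular coefficient `ζ`, is a solution on `[0, τ]` of
`i ψ' = D_m ψ - D_m⁻¹ ζ δ`, `lim_{ε → 0+} lim_{x → 0} K_m^ε (ψ - ζ g) = F(ζ)`,
`ψ(0) = f + ζ₀ g`. The equation holds in the sense of distributions. -/
structure IsSolution (m : ℝ) (α : Fin 3 → Matrix (Fin 4) (Fin 4) ℂ)
    (β : Matrix (Fin 4) (Fin 4) ℂ) (F : Fin 4 → ℂ → ℂ) (τ : ℝ) (f : L2) (ζ₀ : Spinor)
    (ψ u : ℝ → L2) (ζ : ℝ → Spinor) : Prop where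
  continuousOn_psi : ContinuousOn ψ (Set.Icc 0 τ)
  continuousOn_zeta : ContinuousOn ζ (Set.Icc 0 τ)
  initial : Decomposes m (ψ 0) f ζ₀
  initial_regular : u 0 = f
  initial_zeta : ζ 0 = ζ₀
  domain : ∀ t ∈ Set.Ioc 0 τ, InDomain m F (ψ t) (u t) (ζ t)
  equation : ∀ t ∈ Set.Ioo 0 τ, ∀ φ : 𝓢(Space, ℂ),
    ∃ v : Spinor, HasDerivAt (fun s => (ψ s : Distr) φ) v t ∧
      Complex.I • v =
        (dirac m α β (ψ t : Distr) - diracInv m α β (deltaSpinor (ζ t))) φ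

end

end DiracPoint

/-!
With Mathlib's normalization of the Fourier transform, put `ω(ξ) = √(|2πξ|² + m²)` and let
`D(ξ) = 2π α·ξ + mβ` be the symbol of the Dirac operator, so that `D² = ω²`. The Green function has
the transform `ω⁻²`, and the evolution equation for `ψ = u + ζ g` says that `∂ₜ ψ̂ = -i D û`
(`fourier_of_decomposes`, `hasDerivAt_fourier`). If `ζ` were known to be differentiable, this would
read `∂ₜ û = -i D û - ω⁻² ζ'`, hence `∂ₜ (ω² |û|²) = -2 Re ⟨û, ζ'⟩` because `D` is Hermitian.
Formally `∫ û` is the regularized value of `u` at the origin, which is `F(ζ)`, so that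
`‖D u‖²` changes at the rate `-2 Re ⟨F(ζ), ζ'⟩`, which is compensated by the rate of change of
`U(ζ)`. Three points have to be justified: that `ζ` is differentiable up to `t = 0`, that `∫ û` may
be replaced by its regularization, and that `ω² |û|²` is integrable.

**Modes.** Duhamel's formula (`duhamel`) needs only the continuity of `ζ`. It expresses `û(t, ξ)`,
for almost every `ξ`, through `f̂` and the increment `Z = ζ - ζ₀` (`mode`,
`IsSolution.fourier_ae_eq_mode`).

**Abel means.** The regularized value, the limit of `∫ ω^{-2ε} û` as `ε → 0+`, is an average of the
Abel means `∫ e^{-λω} û`, `λ → 0+` (`integral_rpow_omega_mul`). The weight `W = ω / 2π|ξ|` turns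
`d³ξ / ω²` into a multiple of `dω`, the odd part of `D` drops out by symmetry
(`integral_weight_smul_diracSymbol`), and `W - 1` is in `L²`, so that the insertion of `W` only adds
the continuous function `∫ (W - 1) û` of the time. The weighted Abel means are explicit integrals
(`weightedMean_eq`): apart from terms with a continuous limit they are a multiple of
`-∫₀ᵗ 2λr (λ² + r²)⁻² (Z(t) - Z(t - r)) dr`, an approximate identity applied to the left difference
quotients of `Z`.

**Regularity of `ζ`.** The existence of the regularized value does not give convergence of the Abel
means, but a one-sided bound for the Abel means is inherited by the regularized value
(`le_of_tendsto_integral_rpow_omega`). Together with the boundary condition this yields a continuous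
function `rate` of the time that bounds the left slopes of every real component of `Z`
(`apply_le_of_slope`). A Dini type argument then gives `Z(t) = ∫₀ᵗ rate` (`eq_integral_of_slope`,
`IsSolution.increment_eq_integral`).

**Energy.** Since `Z` is continuously differentiable, the Abel means `∫ e^{-λω} û(t)` are bounded
uniformly in `λ` and `t`, and converge to `F(ζ(t))` for `t > 0`. The pointwise identity for
`ω² |û|²` is integrated over time and, with the factor `e^{-λω}`, over the frequencies. As `λ → 0+`,
dominated convergence on the right and monotone convergence on the left show that `ω² |û(t)|²` is
integrable, with the integral `‖D f‖² - 2 ∫₀ᵗ Re ⟨F(ζ), ζ'⟩` (`integral_energy`). The chain rule for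
`U` (`IsPotential.sub_eq_integral`) completes the proof.
-/

namespace DiracPoint

/-! ### The Fourier transform of the Green function -/

/-- Subordination: the Yukawa potential is the superposition of heat kernels
`∫₀^∞ e^{-m²s} (4πs)^{-3/2} e^{-r²/4s} ds`. -/
theorem yukawa_subordination {m r : ℝ} (hm : 0 < m) (hr : 0 < r) :
    ∫ s in Set.Ioi (0 : ℝ), Real.exp (-m ^ 2 * s) * (4 * Real.pi * s) ^ (-(3 / 2) : ℝ) *
      Real.exp (-r ^ 2 / (4 * s)) = Real.exp (-m * r) / (4 * Real.pi * r) := by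
  -- the antiderivative is a combination of two error functions
  let Φ : ℝ → ℝ := fun y => ∫ u in (0 : ℝ)..y, Real.exp (-1 * u ^ 2)
  have hcont : Continuous fun u : ℝ => Real.exp (-1 * u ^ 2) := by fun_prop
  have hΦ : ∀ y, HasDerivAt Φ (Real.exp (-1 * y ^ 2)) y := fun y =>
    intervalIntegral.integral_hasDerivAt_right (hcont.intervalIntegrable _ _)
      (hcont.stronglyMeasurableAtFilter _ _) hcont.continuousAt
  have hint : Integrable fun u : ℝ => Real.exp (-1 * u ^ 2) := integrable_exp_neg_mul_sq one_pos
  have hΦtop : Tendsto Φ atTop (𝓝 (√Real.pi / 2)) := by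
    have := intervalIntegral_tendsto_integral_Ioi 0 hint.integrableOn
      (tendsto_id (α := ℝ) (x := atTop))
    rwa [integral_gaussian_Ioi, div_one] at this
  have hΦodd : ∀ y, Φ (-y) = -Φ y := by
    intro y
    have h1 := intervalIntegral.integral_comp_neg (a := 0) (b := y)
      (fun u : ℝ => Real.exp (-1 * u ^ 2))
    simp only [neg_sq, neg_zero] at h1
    simp only [Φ]
    rw [h1, intervalIntegral.integral_symm]
  have hΦbot : Tendsto Φ atBot (𝓝 (-(√Real.pi / 2))) := by
    have h1 : Tendsto (fun y => -Φ (-y)) atBot (𝓝 (-(√Real.pi / 2))) :=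
      (hΦtop.comp tendsto_neg_atBot_atTop).neg
    simpa [hΦodd] using h1
  let A : ℝ → ℝ := fun s => (Real.exp (-m * r) * Φ (m * √s - r / (2 * √s))
    + Real.exp (m * r) * Φ (-m * √s - r / (2 * √s))) * (1 / (4 * Real.pi ^ (3 / 2 : ℝ) * r))
  have hsq0 : Tendsto (fun s : ℝ => √s) (𝓝[>] 0) (𝓝[>] 0) := by
    refine tendsto_nhdsWithin_iff.2 ⟨?_, ?_⟩
    · have := Real.continuous_sqrt.tendsto 0
      rw [Real.sqrt_zero] at this
      exact this.mono_left nhdsWithin_le_nhds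
    · filter_upwards [self_mem_nhdsWithin] with s hs using Real.sqrt_pos.2 hs
  have hinv0 : Tendsto (fun s : ℝ => r / (2 * √s)) (𝓝[>] 0) atTop := by
    have h1 := (tendsto_inv_nhdsGT_zero.comp hsq0).const_mul_atTop (show 0 < r / 2 by positivity)
    refine h1.congr fun s => ?_
    simp only [Function.comp]
    rw [div_mul_eq_div_div, div_eq_mul_inv (r / 2)]
  have hlow : ∀ c : ℝ, Tendsto (fun s : ℝ => c * √s - r / (2 * √s)) (𝓝[>] 0) atBot := by
    intro c
    have h1 : Tendsto (fun s : ℝ => c * √s) (𝓝[>] 0) (𝓝 (c * 0)) :=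
      (hsq0.mono_right nhdsWithin_le_nhds).const_mul c
    have := h1.add_atBot (tendsto_neg_atTop_atBot.comp hinv0)
    simpa [sub_eq_add_neg, Function.comp_def] using this
  let a0 : ℝ := (Real.exp (-m * r) * (-(√Real.pi / 2)) + Real.exp (m * r) * (-(√Real.pi / 2)))
    * (1 / (4 * Real.pi ^ (3 / 2 : ℝ) * r))
  have hA0 : Tendsto A (𝓝[>] 0) (𝓝 a0) :=
    (((hΦbot.comp (hlow m)).const_mul _).add ((hΦbot.comp (hlow (-m))).const_mul _)).mul_const _
  have hsqt : Tendsto (fun s : ℝ => √s) atTop atTop := Real.tendsto_sqrt_atTop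
  have hinvt : Tendsto (fun s : ℝ => r / (2 * √s)) atTop (𝓝 0) :=
    (hsqt.const_mul_atTop two_pos).const_div_atTop r
  have hupp : Tendsto (fun s : ℝ => m * √s - r / (2 * √s)) atTop atTop := by
    have := (hsqt.const_mul_atTop hm).atTop_add hinvt.neg
    simpa [sub_eq_add_neg] using this
  have hupp' : Tendsto (fun s : ℝ => -m * √s - r / (2 * √s)) atTop atBot := by
    have := (tendsto_neg_atTop_atBot.comp (hsqt.const_mul_atTop hm)).atBot_add hinvt.neg
    simpa [sub_eq_add_neg, Function.comp_def] using this
  have hAt : Tendsto A atTop (𝓝 ((Real.exp (-m * r) * (√Real.pi / 2)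
      + Real.exp (m * r) * (-(√Real.pi / 2))) * (1 / (4 * Real.pi ^ (3 / 2 : ℝ) * r)))) :=
    (((hΦtop.comp hupp).const_mul _).add ((hΦbot.comp hupp').const_mul _)).mul_const _
  have hderiv : ∀ s ∈ Set.Ioi (0 : ℝ), HasDerivAt A (Real.exp (-m ^ 2 * s) *
      (4 * Real.pi * s) ^ (-(3 / 2) : ℝ) * Real.exp (-r ^ 2 / (4 * s))) s := by
    intro s hs
    have hs : 0 < s := hs
    have hsp : 0 < √s := Real.sqrt_pos.2 hs
    have hss : √s * √s = s := Real.mul_self_sqrt hs.le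
    have h1 : HasDerivAt (fun s : ℝ => √s) (1 / (2 * √s)) s := Real.hasDerivAt_sqrt hs.ne'
    have h2 : ∀ c : ℝ, HasDerivAt (fun s : ℝ => c * √s - r / (2 * √s))
        (c * (1 / (2 * √s)) + r / (4 * s * √s)) s := by
      intro c
      have h3 := (h1.const_mul c).sub ((hasDerivAt_const s r).div (h1.const_mul 2) (by positivity))
      refine h3.congr_deriv ?_
      field_simp
      rw [show √s ^ 2 = s by rw [sq, hss]]
      ring
    have h4 := ((((hΦ _).comp s (h2 m)).const_mul (Real.exp (-m * r))).add
      (((hΦ _).comp s (h2 (-m))).const_mul (Real.exp (m * r)))).mul_const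
        (1 / (4 * Real.pi ^ (3 / 2 : ℝ) * r))
    refine h4.congr_deriv ?_
    have e1 : Real.exp (-m * r) * Real.exp (-1 * (m * √s - r / (2 * √s)) ^ 2) =
        Real.exp (-m ^ 2 * s) * Real.exp (-r ^ 2 / (4 * s)) := by
      rw [← Real.exp_add, ← Real.exp_add]
      congr 1
      have : (m * √s - r / (2 * √s)) ^ 2 = m ^ 2 * s - m * r + r ^ 2 / (4 * s) := by
        field_simp
        rw [show √s ^ 2 = s by rw [sq, hss]]
        ring_nf
      rw [this]; ring
    have e2 : Real.exp (m * r) * Real.exp (-1 * (-m * √s - r / (2 * √s)) ^ 2) =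
        Real.exp (-m ^ 2 * s) * Real.exp (-r ^ 2 / (4 * s)) := by
      rw [← Real.exp_add, ← Real.exp_add]
      congr 1
      have : (-m * √s - r / (2 * √s)) ^ 2 = m ^ 2 * s + m * r + r ^ 2 / (4 * s) := by
        field_simp
        rw [show √s ^ 2 = s by rw [sq, hss]]
        ring_nf
      rw [this]; ring
    have e3 : (4 * Real.pi * s) ^ (-(3 / 2) : ℝ) = 1 / (8 * Real.pi ^ (3 / 2 : ℝ) * (s * √s)) := by
      rw [Real.rpow_neg (by positivity), Real.mul_rpow (by positivity) hs.le,
        Real.mul_rpow (by positivity) Real.pi_pos.le]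
      have e4 : (4 : ℝ) ^ (3 / 2 : ℝ) = 8 := by
        rw [show (4 : ℝ) = 2 ^ (2 : ℝ) by norm_num, ← Real.rpow_mul (by norm_num)]
        norm_num
      have e5 : s ^ (3 / 2 : ℝ) = s * √s := by
        rw [Real.sqrt_eq_rpow, show (3 / 2 : ℝ) = 1 + 1 / 2 by norm_num,
          Real.rpow_add hs, Real.rpow_one]
      rw [e4, e5, one_div]
    rw [e3, ← mul_assoc (Real.exp (-m * r)), ← mul_assoc (Real.exp (m * r)), e1, e2]
    have hpp : 0 < Real.pi ^ (3 / 2 : ℝ) := Real.rpow_pos_of_pos Real.pi_pos _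
    field_simp
    ring
  -- the value of the antiderivative at the singular endpoint is its limit
  let B : ℝ → ℝ := Function.update A 0 a0
  have hBA : ∀ s ∈ Set.Ioi (0 : ℝ), B =ᶠ[𝓝 s] A := by
    intro s hs
    filter_upwards [isOpen_Ioi.mem_nhds hs] with x hx
    exact Function.update_of_ne (ne_of_gt hx) _ _
  have hB := integral_Ioi_of_hasDerivAt_of_nonneg (g := B) (a := 0)
    (g' := fun s => Real.exp (-m ^ 2 * s) *
      (4 * Real.pi * s) ^ (-(3 / 2) : ℝ) * Real.exp (-r ^ 2 / (4 * s)))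
    (by
      rw [← continuousWithinAt_Ioi_iff_Ici]
      refine ContinuousWithinAt.congr_of_eventuallyEq (f := B) ?_ (EventuallyEq.refl _ _) rfl
      have : Tendsto B (𝓝[>] 0) (𝓝 a0) := hA0.congr' (by
        filter_upwards [self_mem_nhdsWithin] with x hx
        exact (Function.update_of_ne (ne_of_gt hx) _ _).symm)
      simpa [ContinuousWithinAt, B] using this)
    (fun s hs => (hderiv s hs).congr_of_eventuallyEq (hBA s hs))
    (fun s hs => by have : 0 < s := hs; positivity)
    (hAt.congr' (by
      filter_upwards [eventually_gt_atTop 0] with x hx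
      exact (Function.update_of_ne (ne_of_gt hx) _ _).symm))
  rw [hB]
  have hB0 : B 0 = a0 := Function.update_self _ _ _
  rw [hB0]
  simp only [a0]
  have e6 : Real.pi ^ (3 / 2 : ℝ) = Real.pi * √Real.pi := by
    rw [Real.sqrt_eq_rpow, show (3 / 2 : ℝ) = 1 + 1 / 2 by norm_num,
      Real.rpow_add Real.pi_pos, Real.rpow_one]
  rw [e6]
  have : 0 < √Real.pi := Real.sqrt_pos.2 Real.pi_pos
  field_simp
  ring

/-- The relativistic energy `ω(ξ) = √(|2πξ|² + m²)`; its square is the symbol of `-Δ + m²`. -/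
noncomputable def omega (m : ℝ) (ξ : Space) : ℝ := √((2 * Real.pi * ‖ξ‖) ^ 2 + m ^ 2)

theorem omega_sq (m : ℝ) (ξ : Space) : omega m ξ ^ 2 = (2 * Real.pi * ‖ξ‖) ^ 2 + m ^ 2 :=
  Real.sq_sqrt (by positivity)

theorem le_omega {m : ℝ} (ξ : Space) : m ≤ omega m ξ :=
  Real.le_sqrt_of_sq_le (by nlinarith [sq_nonneg (2 * Real.pi * ‖ξ‖)])

theorem omega_pos {m : ℝ} (hm : 0 < m) (ξ : Space) : 0 < omega m ξ := hm.trans_le (le_omega ξ)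

theorem continuous_omega (m : ℝ) : Continuous (omega m) := by
  unfold omega; fun_prop

@[fun_prop]
theorem measurable_omega (m : ℝ) : Measurable (omega m) := (continuous_omega m).measurable

theorem contDiff_omega {m : ℝ} (hm : 0 < m) : ContDiff ℝ (⊤ : ℕ∞) (omega m) := by
  unfold omega
  have h1 : ContDiff ℝ (⊤ : ℕ∞) fun ξ : Space => (2 * Real.pi * ‖ξ‖) ^ 2 + m ^ 2 := by
    simp_rw [mul_pow]
    exact (contDiff_const.mul (contDiff_norm_sq ℝ)).add contDiff_const
  exact h1.sqrt fun ξ => by positivity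

theorem smoothingSymbol_eq {m : ℝ} (hm : 0 < m) (ε : ℝ) (ξ : Space) :
    smoothingSymbol m ε ξ = omega m ξ ^ (-2 * ε) := by
  rw [smoothingSymbol, ← omega_sq, ← Real.rpow_natCast, ← Real.rpow_mul (omega_pos hm ξ).le]
  congr 1
  push_cast
  ring

theorem finrank_space : Module.finrank ℝ Space = 3 := by simp [Space]

/-- The heat kernel damped by the mass, as a function of time and space. -/
noncomputable def massiveHeat (m : ℝ) (p : ℝ × Space) : ℝ :=
  Real.exp (-m ^ 2 * p.1) * ((4 * Real.pi * p.1) ^ (-(3 / 2) : ℝ) *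
    Real.exp (-‖p.2‖ ^ 2 / (4 * p.1)))

theorem measurable_massiveHeat (m : ℝ) : Measurable (massiveHeat m) := by
  unfold massiveHeat; fun_prop

theorem integral_heat {s : ℝ} (hs : 0 < s) :
    ∫ x : Space, (4 * Real.pi * s) ^ (-(3 / 2) : ℝ) * Real.exp (-‖x‖ ^ 2 / (4 * s)) = 1 := by
  have h1 := GaussianFourier.integral_rexp_neg_mul_sq_norm (V := Space)
    (b := 1 / (4 * s)) (by positivity)
  rw [integral_const_mul]
  have h2 : (fun x : Space => Real.exp (-‖x‖ ^ 2 / (4 * s))) =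
      fun x : Space => Real.exp (-(1 / (4 * s)) * ‖x‖ ^ 2) := by
    ext x; congr 1; field_simp
  rw [h2, h1, finrank_space, show Real.pi / (1 / (4 * s)) = 4 * Real.pi * s by field_simp,
    ← Real.rpow_add (by positivity)]
  norm_num

theorem integrable_heat {s : ℝ} (hs : 0 < s) : Integrable fun x : Space =>
    (4 * Real.pi * s) ^ (-(3 / 2) : ℝ) * Real.exp (-‖x‖ ^ 2 / (4 * s)) :=
  Integrable.of_integral_ne_zero (by rw [integral_heat hs]; exact one_ne_zero)

theorem integrable_massiveHeat {m : ℝ} (hm : 0 < m) :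
    Integrable (massiveHeat m) ((volume.restrict (Set.Ioi 0)).prod (volume : Measure Space)) := by
  rw [integrable_prod_iff (measurable_massiveHeat m).aestronglyMeasurable]
  constructor
  · filter_upwards [ae_restrict_mem measurableSet_Ioi] with s hs
    exact (integrable_heat hs).const_mul (Real.exp (-m ^ 2 * s))
  · have h1 : IntegrableOn (fun s : ℝ => Real.exp (-m ^ 2 * s)) (Set.Ioi 0) :=
      integrableOn_exp_mul_Ioi (by nlinarith) 0
    refine h1.congr ?_
    filter_upwards [ae_restrict_mem measurableSet_Ioi] with s hs
    have hs : 0 < s := hs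
    have h2 : ∀ x : Space, ‖massiveHeat m (s, x)‖ = massiveHeat m (s, x) := fun x =>
      Real.norm_of_nonneg (by unfold massiveHeat; positivity)
    simp_rw [h2]
    simp only [massiveHeat]
    rw [integral_const_mul, integral_heat hs, mul_one]

theorem integral_massiveHeat {m : ℝ} (hm : 0 < m) {x : Space} (hx : x ≠ 0) :
    ((∫ s in Set.Ioi (0 : ℝ), massiveHeat m (s, x) : ℝ) : ℂ) = green m x := by
  rw [green, ← yukawa_subordination hm (norm_pos_iff.2 hx)]
  simp only [massiveHeat, mul_assoc]

theorem ae_ne_zero : ∀ᵐ x : Space, x ≠ 0 := by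
  simp [ae_iff]

theorem integrable_green {m : ℝ} (hm : 0 < m) : Integrable (green m) := by
  have h1 := (integrable_massiveHeat hm).integral_prod_right.ofReal (𝕜 := ℂ)
  refine h1.congr ?_
  filter_upwards [ae_ne_zero] with x hx using integral_massiveHeat hm hx

/-- The Fourier transform of the Green function is `ω⁻²`, tested against a Schwartz function. -/
theorem integral_green_mul {m : ℝ} (hm : 0 < m) (φ : 𝓢(Space, ℂ)) :
    ∫ x, green m x * φ x = ∫ ξ, ((1 / omega m ξ ^ 2 : ℝ) : ℂ) * (𝓕 φ) ξ := by
  have hφb : ∃ M, ∀ x, ‖φ x‖ ≤ M := by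
    obtain ⟨M, -, hM⟩ := φ.decay 0 0
    exact ⟨M, fun x => by simpa using hM x⟩
  have hφb' : ∃ M, ∀ x, ‖(𝓕 φ) x‖ ≤ M := by
    obtain ⟨M, -, hM⟩ := (𝓕 φ).decay 0 0
    exact ⟨M, fun x => by simpa using hM x⟩
  have hgauss : ∀ s ∈ Set.Ioi (0 : ℝ), ∫ x : Space, (massiveHeat m (s, x) : ℂ) * φ x =
      ∫ ξ, (Real.exp (-(omega m ξ ^ 2 * s)) : ℂ) * (𝓕 φ) ξ := by
    intro s hs
    have hs : 0 < s := hs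
    have hb : 0 < ((4 * Real.pi ^ 2 * s : ℝ) : ℂ).re := by
      rw [Complex.ofReal_re]; positivity
    have hJ : Integrable fun v : Space => Complex.exp
      (-((4 * Real.pi ^ 2 * s : ℝ) : ℂ) * ‖v‖ ^ 2) := by
      simpa using GaussianFourier.integrable_cexp_neg_mul_sq_norm_add hb 0 (0 : Space)
    have h1 := VectorFourier.integral_fourierIntegral_smul_eq_flip (L := innerₗ Space)
      (μ := volume) (ν := volume) Real.continuous_fourierChar continuous_inner hJ φ.integrable
    have h2 : ∀ x : Space, VectorFourier.fourierIntegral Real.fourierChar volume (innerₗ Space)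
        (fun v : Space => Complex.exp (-((4 * Real.pi ^ 2 * s : ℝ) : ℂ) * ‖v‖ ^ 2)) x =
        (((4 * Real.pi * s) ^ (-(3 / 2) : ℝ) * Real.exp (-‖x‖ ^ 2 / (4 * s)) : ℝ) : ℂ) := by
      intro x
      have h3 := fourier_gaussian_innerProductSpace hb x
      refine h3.trans ?_
      rw [finrank_space, Complex.ofReal_mul ((4 * Real.pi * s) ^ (-(3 / 2) : ℝ)),
        Complex.ofReal_exp]
      congr 1
      · rw [← Complex.ofReal_div, ← Complex.ofReal_natCast, ← Complex.ofReal_ofNat,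
          ← Complex.ofReal_div, ← Complex.ofReal_cpow (by positivity)]
        congr 1
        rw [Real.rpow_neg (by positivity), ← Real.inv_rpow (by positivity)]
        congr 1
        field_simp
      · congr 1
        push_cast
        field_simp
    have h4 : ∀ ξ : Space, VectorFourier.fourierIntegral Real.fourierChar volume (innerₗ Space).flip
        (φ : Space → ℂ) ξ = (𝓕 φ) ξ := by
      intro ξ
      rw [SchwartzMap.fourier_coe, flip_innerₗ]
      rfl
    simp only [h2, h4, smul_eq_mul] at h1
    have h5 : ∀ x : Space, (massiveHeat m (s, x) : ℂ) * φ x = (Real.exp (-m ^ 2 * s) : ℂ) *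
        ((((4 * Real.pi * s) ^ (-(3 / 2) : ℝ) * Real.exp (-‖x‖ ^ 2 / (4 * s)) : ℝ) : ℂ) * φ x) := by
      intro x
      simp only [massiveHeat]
      push_cast
      ring
    simp_rw [h5]
    rw [integral_const_mul, h1, ← integral_const_mul]
    refine integral_congr_ae (Eventually.of_forall fun ξ => ?_)
    simp only
    rw [← mul_assoc]
    congr 1
    rw [Complex.ofReal_exp, ← Complex.exp_add, Complex.ofReal_exp, omega_sq]
    congr 1
    push_cast
    ring
  obtain ⟨M, hM⟩ := hφb
  obtain ⟨M', hM'⟩ := hφb'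
  have hF1 : Integrable (fun p : ℝ × Space => (massiveHeat m p : ℂ) * φ p.2)
      ((volume.restrict (Set.Ioi 0)).prod volume) := by
    refine (integrable_massiveHeat hm).ofReal.mul_bdd
      (c := M) ?_ (Eventually.of_forall fun p => hM _)
    exact (φ.continuous.comp continuous_snd).aestronglyMeasurable
  have hF2 : Integrable (fun p : ℝ × Space => (Real.exp (-(omega m p.2 ^ 2 * p.1)) : ℂ) * (𝓕 φ) p.2)
      ((volume.restrict (Set.Ioi 0)).prod volume) := by
    have h1 : Integrable (fun p : ℝ × Space => Real.exp (-m ^ 2 * p.1) * ‖(𝓕 φ) p.2‖)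
        ((volume.restrict (Set.Ioi 0)).prod volume) :=
      Integrable.mul_prod (integrableOn_exp_mul_Ioi (by nlinarith) 0) (𝓕 φ).integrable.norm
    refine h1.mono' ?_ ?_
    · refine Continuous.aestronglyMeasurable ?_
      have := continuous_omega m
      have := (𝓕 φ).continuous
      fun_prop
    · have : ∀ᵐ p : ℝ × Space ∂((volume.restrict (Set.Ioi 0)).prod volume), 0 < p.1 := by
        have h2 := Measure.quasiMeasurePreserving_fst (μ := volume.restrict (Set.Ioi (0 : ℝ)))
          (ν := (volume : Measure Space))
        exact h2.ae (ae_restrict_mem measurableSet_Ioi)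
      filter_upwards [this] with p hp
      rw [norm_mul, Complex.norm_real, Real.norm_of_nonneg (Real.exp_pos _).le]
      gcongr
      have := omega_sq m p.2
      nlinarith [sq_nonneg (2 * Real.pi * ‖p.2‖), mul_nonneg (sq_nonneg
        (2 * Real.pi * ‖p.2‖)) hp.le]
  have hL : ∫ x, green m x * φ x = ∫ s in Set.Ioi (0 : ℝ), ∫ x, (massiveHeat m (s,
    x) : ℂ) * φ x := by
    rw [integral_integral_swap hF1]
    refine integral_congr_ae ?_
    filter_upwards [ae_ne_zero] with x hx
    rw [← integral_massiveHeat hm hx, integral_mul_const]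
    congr 1
    exact integral_ofReal.symm
  rw [hL, setIntegral_congr_fun measurableSet_Ioi hgauss, integral_integral_swap hF2]
  refine integral_congr_ae (Eventually.of_forall fun ξ => ?_)
  simp only
  rw [integral_mul_const]
  congr 1
  have h6 := integral_exp_mul_Ioi (a := -(omega m ξ ^ 2)) (by nlinarith [omega_pos hm ξ]) 0
  rw [show (fun s : ℝ => ((Real.exp (-(omega m ξ ^ 2 * s)) : ℝ) : ℂ)) =
    fun s : ℝ => ((Real.exp (-(omega m ξ ^ 2) * s) : ℝ) : ℂ) by ext s; ring_nf]
  rw [integral_complex_ofReal, h6]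
  simp

/-! ### The Dirac symbol -/

/-- The symbol `D(ξ) = 2π α·ξ + m β` of the Dirac operator. -/
noncomputable def diracSymbol (m : ℝ) (α : Fin 3 → Matrix (Fin 4) (Fin 4) ℂ)
    (β : Matrix (Fin 4) (Fin 4) ℂ) (ξ : Space) : Spinor →L[ℂ] Spinor :=
  ∑ k : Fin 3, ((2 * Real.pi * ξ k : ℝ) : ℂ) • Matrix.toEuclideanCLM (n := Fin 4) (𝕜 := ℂ) (α k)
    + (m : ℂ) • Matrix.toEuclideanCLM (n := Fin 4) (𝕜 := ℂ) β

variable {m : ℝ} {α : Fin 3 → Matrix (Fin 4) (Fin 4) ℂ} {β : Matrix (Fin 4) (Fin 4) ℂ}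

@[fun_prop]
theorem continuous_diracSymbol : Continuous (diracSymbol m α β) := by
  unfold diracSymbol; fun_prop

theorem diracSymbol_mul_self (hαβ : IsDiracMatrices α β) (ξ : Space) :
    diracSymbol m α β ξ * diracSymbol m α β ξ = ((omega m ξ ^ 2 : ℝ) : ℂ) • 1 := by
  have key : ∀ (c0 c1 c2 d : ℂ),
      (c0 • α 0 + c1 • α 1 + c2 • α 2 + d • β) * (c0 • α 0 + c1 • α 1 + c2 • α 2 + d • β) =
      (c0 ^ 2 + c1 ^ 2 + c2 ^ 2 + d ^ 2) • (1 : Matrix (Fin 4) (Fin 4) ℂ) := by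
    intro c0 c1 c2 d
    have h01 := eq_neg_of_add_eq_zero_right (hαβ.anticomm_alpha 0 1 (by decide))
    have h02 := eq_neg_of_add_eq_zero_right (hαβ.anticomm_alpha 0 2 (by decide))
    have h12 := eq_neg_of_add_eq_zero_right (hαβ.anticomm_alpha 1 2 (by decide))
    have h0 := eq_neg_of_add_eq_zero_right (hαβ.anticomm_beta 0)
    have h1 := eq_neg_of_add_eq_zero_right (hαβ.anticomm_beta 1)
    have h2 := eq_neg_of_add_eq_zero_right (hαβ.anticomm_beta 2)
    simp only [add_mul, mul_add, smul_mul_assoc, mul_smul_comm, hαβ.sq_alpha, hαβ.sq_beta,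
      h01, h02, h12, h0, h1, h2]
    module
  have e : diracSymbol m α β ξ = Matrix.toEuclideanCLM (n := Fin 4) (𝕜 := ℂ)
      (((2 * Real.pi * ξ 0 : ℝ) : ℂ) • α 0 + ((2 * Real.pi * ξ 1 : ℝ) : ℂ) • α 1 +
        ((2 * Real.pi * ξ 2 : ℝ) : ℂ) • α 2 + (m : ℂ) • β) := by
    simp only [diracSymbol, Fin.sum_univ_three, map_add, map_smul]
  rw [e, ← map_mul, key, map_smul, map_one]
  congr 1
  rw [omega_sq, mul_pow, EuclideanSpace.norm_sq_eq, Fin.sum_univ_three]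
  simp only [Real.norm_eq_abs, sq_abs]
  push_cast
  ring

theorem diracSymbol_diracSymbol (hαβ : IsDiracMatrices α β) (ξ : Space) (v : Spinor) :
    diracSymbol m α β ξ (diracSymbol m α β ξ v) = ((omega m ξ ^ 2 : ℝ) : ℂ) • v := by
  have := congrArg (fun T : Spinor →L[ℂ] Spinor => T v) (diracSymbol_mul_self (m := m) hαβ ξ)
  simpa using this

theorem isSelfAdjoint_toEuclideanCLM {A : Matrix (Fin 4) (Fin 4) ℂ} (hA : A.IsHermitian) :
    IsSelfAdjoint (Matrix.toEuclideanCLM (n := Fin 4) (𝕜 := ℂ) A) := by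
  rw [IsSelfAdjoint, ← map_star]
  congr 1

theorem inner_diracSymbol (hαβ : IsDiracMatrices α β) (ξ : Space) (v w : Spinor) :
    inner ℂ (diracSymbol m α β ξ v) w = inner ℂ v (diracSymbol m α β ξ w) := by
  have h (k : Fin 3) (v w : Spinor) := (isSelfAdjoint_toEuclideanCLM
    (hαβ.hermitian_alpha k)).isSymmetric v w
  have h' (v w : Spinor) := (isSelfAdjoint_toEuclideanCLM hαβ.hermitian_beta).isSymmetric v w
  simp only [ContinuousLinearMap.coe_coe] at h h'
  simp only [diracSymbol, _root_.add_apply, _root_.sum_apply, _root_.smul_apply, inner_add_left,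
    inner_add_right, sum_inner, inner_sum, inner_smul_left, inner_smul_right, Complex.conj_ofReal,
    h, h']

theorem norm_diracSymbol (hm : 0 < m) (hαβ : IsDiracMatrices α β) (ξ : Space) (v : Spinor) :
    ‖diracSymbol m α β ξ v‖ = omega m ξ * ‖v‖ := by
  have h1 : ‖diracSymbol m α β ξ v‖ ^ 2 = (omega m ξ * ‖v‖) ^ 2 := by
    rw [← inner_self_eq_norm_sq (𝕜 := ℂ), inner_diracSymbol hαβ, diracSymbol_diracSymbol hαβ,
      inner_smul_right, mul_pow, ← inner_self_eq_norm_sq (𝕜 := ℂ) v]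
    simp only [RCLike.re_to_complex, Complex.re_ofReal_mul]
  exact (pow_left_inj₀ (norm_nonneg _) (mul_nonneg (omega_pos hm ξ).le (norm_nonneg _))
    two_ne_zero).1 h1

/-! ### The problem in the Fourier representation -/

theorem omega_sq_ge (hm : 0 < m) : ∃ c > 0, ∀ ξ : Space, c * (1 + ‖ξ‖ ^ 2) ≤ omega m ξ ^ 2 := by
  refine ⟨min (m ^ 2) (4 * Real.pi ^ 2), by positivity, fun ξ => ?_⟩
  rw [omega_sq]
  have h1 := min_le_left (m ^ 2) (4 * Real.pi ^ 2)
  have h2 := min_le_right (m ^ 2) (4 * Real.pi ^ 2)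
  nlinarith [mul_le_mul_of_nonneg_right h2 (sq_nonneg ‖ξ‖)]

theorem memLp_rpow_one_add_norm_sq {r : ℝ} (hr : 3 < 2 * r) :
    MemLp (fun ξ : Space => (1 + ‖ξ‖ ^ 2) ^ (-r / 2)) 2 := by
  have hc : Continuous fun ξ : Space => (1 + ‖ξ‖ ^ 2) ^ (-r / 2) :=
    Continuous.rpow_const (by fun_prop) fun ξ => Or.inl (by positivity)
  rw [memLp_two_iff_integrable_sq hc.aestronglyMeasurable]
  have h1 : Integrable fun ξ : Space => (1 + ‖ξ‖ ^ 2) ^ (-(2 * r) / 2) :=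
    integrable_rpow_neg_one_add_norm_sq (by rw [finrank_space]; exact_mod_cast hr)
  refine h1.congr (Eventually.of_forall fun ξ => ?_)
  simp only
  rw [← Real.rpow_natCast (_ ^ (-r / 2)), ← Real.rpow_mul (by positivity)]
  congr 1
  push_cast
  ring

theorem memLp_inv_omega_sq (hm : 0 < m) :
    MemLp (fun ξ : Space => ((1 / omega m ξ ^ 2 : ℝ) : ℂ)) 2 := by
  obtain ⟨c, hc, h⟩ := omega_sq_ge hm
  refine MemLp.of_le_mul (c := c⁻¹) (memLp_rpow_one_add_norm_sq (r := 2) (by norm_num)) ?_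
    (Eventually.of_forall fun ξ => ?_)
  · exact (Complex.measurable_ofReal.comp (by fun_prop)).aestronglyMeasurable
  · rw [Complex.norm_real, Real.norm_of_nonneg (by positivity), Real.norm_of_nonneg (by positivity),
      show (-2 / 2 : ℝ) = -1 by norm_num, Real.rpow_neg_one, ← mul_inv, one_div]
    exact inv_anti₀ (by positivity) (h ξ)

theorem integrable_schwartz_smul (η : 𝓢(Space, ℂ)) {v : Space → Spinor} (hv : MemLp v 2) :
    Integrable fun ξ => η ξ • v ξ :=
  memLp_one_iff_integrable.1 (hv.smul (η.memLp 2))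

theorem fourier_apply_coe (u : L2) (φ : 𝓢(Space, ℂ)) :
    (u : Distr) (𝓕 φ) = ∫ ξ, φ ξ • (𝓕 u : L2) ξ := by
  have h := congrArg (fun T : Distr => T φ) (Lp.fourier_toTemperedDistribution_eq u)
  simpa using h

/-- Two locally integrable functions which agree as distributions are equal almost everywhere. -/
theorem ae_eq_of_integral_schwartz {v w : Space → Spinor} (hv : LocallyIntegrable v)
    (hw : LocallyIntegrable w)
    (h : ∀ φ : 𝓢(Space, ℂ), ∫ x, φ x • v x = ∫ x, φ x • w x) : ∀ᵐ x, v x = w x := by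
  refine ae_eq_of_integral_contDiff_smul_eq hv hw fun g hg hgc => ?_
  have hg₁ : HasCompactSupport (Complex.ofRealCLM ∘ g) := hgc.comp_left rfl
  have hg₂ : ContDiff ℝ (⊤ : ℕ∞) (Complex.ofRealCLM ∘ g) := by fun_prop
  have := h (hg₁.toSchwartzMap hg₂)
  simpa using this

/-- The `L²` function `ω⁻² ζ`, the Fourier transform of `ζ g`. -/
noncomputable def greenHat (hm : 0 < m) (ζ : Spinor) : L2 :=
  MemLp.toLp (fun ξ => ((1 / omega m ξ ^ 2 : ℝ) : ℂ) • ζ)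
    ((ContinuousLinearMap.toSpanSingleton ℂ ζ).comp_memLp' (memLp_inv_omega_sq hm))

theorem coeFn_greenHat (hm : 0 < m) (ζ : Spinor) :
    ∀ᵐ ξ, greenHat hm ζ ξ = ((1 / omega m ξ ^ 2 : ℝ) : ℂ) • ζ :=
  MemLp.coeFn_toLp _

/-- The Fourier transform of `ψ = u + ζ g`. Both `g` and the inverse transform of `ω⁻²` are locally
integrable, and they agree as distributions. -/
theorem fourier_of_decomposes (hm : 0 < m) {ψ u : L2} {ζ : Spinor} (h : Decomposes m ψ u ζ) :
    (𝓕 ψ : L2) = 𝓕 u + greenHat hm ζ := by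
  set v : L2 := 𝓕⁻ (greenHat hm ζ) with hv
  have hvg : ∀ᵐ x, v x = green m x • ζ := by
    refine ae_eq_of_integral_schwartz ((Lp.memLp v).locallyIntegrable one_le_two)
      ((integrable_green hm).smul_const ζ).locallyIntegrable fun φ => ?_
    have h1 : ∫ x, φ x • v x = ∫ ξ, (𝓕⁻ φ) ξ • greenHat hm ζ ξ := by
      have h := congrArg (fun T : Distr => T φ)
        (Lp.fourierInv_toTemperedDistribution_eq (greenHat hm ζ))
      simpa using h.symm
    rw [h1]
    have h2 : ∫ ξ, (𝓕⁻ φ) ξ • greenHat hm ζ ξ =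
        (∫ ξ, ((1 / omega m ξ ^ 2 : ℝ) : ℂ) * (𝓕⁻ φ) ξ) • ζ := by
      rw [← integral_smul_const]
      refine integral_congr_ae ?_
      filter_upwards [coeFn_greenHat hm ζ] with ξ hξ
      rw [hξ, smul_smul, mul_comm]
    have h3 : ∫ ξ, ((1 / omega m ξ ^ 2 : ℝ) : ℂ) * (𝓕⁻ φ) ξ =
        ∫ ξ, ((1 / omega m ξ ^ 2 : ℝ) : ℂ) * (𝓕 φ) ξ := by
      rw [← integral_neg_eq_self]
      refine integral_congr_ae (Eventually.of_forall fun ξ => ?_)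
      simp only [omega, norm_neg]
      rw [SchwartzMap.fourierInv_coe, SchwartzMap.fourier_coe, Real.fourierInv_eq_fourier_neg,
        neg_neg]
    rw [h2, h3, ← integral_green_mul hm, ← integral_smul_const]
    refine integral_congr_ae (Eventually.of_forall fun x => ?_)
    simp only [smul_smul, mul_comm]
  have h1 : ψ = u + v := by
    apply Lp.ext
    filter_upwards [h, hvg, Lp.coeFn_add u v] with x h1 h2 h3
    rw [h1, h3, Pi.add_apply, h2]
  rw [h1, FourierTransform.fourier_add, hv, FourierTransform.fourier_fourierInv_eq]

/-- The action of the Dirac operator on a tempered distribution, in the Fourier representation. -/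
theorem dirac_apply_fourier (u : Distr) (χ : 𝓢(Space, ℂ)) :
    dirac m α β u (𝓕 χ) = ∑ k : Fin 3, Matrix.toEuclideanCLM (n := Fin 4) (𝕜 := ℂ) (α k)
      (u (𝓕 (SchwartzMap.smulLeftCLM ℂ (fun ξ : Space => ((2 * Real.pi * ξ k : ℝ) : ℂ)) χ)))
      + (m : ℂ) • Matrix.toEuclideanCLM (n := Fin 4) (𝕜 := ℂ) β (u (𝓕 χ)) := by
  have h1 : ∀ k : Fin 3, (∂_{EuclideanSpace.single k (1 : ℝ)} u) (𝓕 χ) =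
      Complex.I • u (𝓕 (SchwartzMap.smulLeftCLM ℂ (fun ξ : Space =>
        ((2 * Real.pi * ξ k : ℝ) : ℂ)) χ)) := by
    intro k
    rw [TemperedDistribution.lineDerivOp_apply_apply, SchwartzMap.lineDerivOp_fourier_eq]
    refine Eq.trans ?_ (u.map_smul Complex.I _)
    rw [← FourierTransform.fourier_smul, ← FourierTransform.fourier_neg]
    refine congrArg (fun χ' : 𝓢(Space, ℂ) => u (𝓕 χ')) ?_
    ext ξ
    have h2 : (fun ξ : Space =>
      inner ℝ ξ (EuclideanSpace.single k (1 : ℝ))).HasTemperateGrowth := by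
      fun_prop
    have h3 : (fun ξ : Space => ((2 * Real.pi * ξ k : ℝ) : ℂ)).HasTemperateGrowth := by
      have h4 : (fun ξ : Space =>
        ((2 * Real.pi * inner ℝ ξ (EuclideanSpace.single k (1 : ℝ)) : ℝ) : ℂ)).HasTemperateGrowth := by
        fun_prop
      simpa [EuclideanSpace.inner_single_right] using h4
    change -(-(2 * Real.pi * Complex.I) * (SchwartzMap.smulLeftCLM ℂ (fun ξ : Space =>
      inner ℝ ξ (EuclideanSpace.single k (1 : ℝ))) χ ξ)) = Complex.I * (SchwartzMap.smulLeftCLM ℂ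
        (fun ξ : Space => ((2 * Real.pi * ξ k : ℝ) : ℂ)) χ ξ)
    rw [SchwartzMap.smulLeftCLM_apply_apply h2, SchwartzMap.smulLeftCLM_apply_apply h3,
      EuclideanSpace.inner_single_right]
    simp
    ring
  have h5 : ∀ (A : Matrix (Fin 4) (Fin 4) ℂ) (w : Distr) (φ : 𝓢(Space, ℂ)),
      matAct A w φ = Matrix.toEuclideanCLM (n := Fin 4) (𝕜 := ℂ) A (w φ) := fun A w φ => rfl
  unfold dirac
  change (-Complex.I) • (∑ k : Fin 3, matAct (α k) (∂_{EuclideanSpace.single k (1 : ℝ)} u)) (𝓕 χ)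
    + (m : ℂ) • (matAct β u) (𝓕 χ) = _
  rw [h5]
  congr 1
  rw [_root_.sum_apply, Finset.smul_sum]
  refine Finset.sum_congr rfl fun k _ => ?_
  rw [h5, h1, map_smul, smul_smul]
  simp

theorem hasTemperateGrowth_coord (k : Fin 3) :
    (fun ξ : Space => ((2 * Real.pi * ξ k : ℝ) : ℂ)).HasTemperateGrowth := by
  have h4 : (fun ξ : Space => ((2 * Real.pi *
      inner ℝ ξ (EuclideanSpace.single k (1 : ℝ)) : ℝ) : ℂ)).HasTemperateGrowth := by
    fun_prop
  simpa [EuclideanSpace.inner_single_right] using h4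

theorem schwartz_smul_diracSymbol (χ : 𝓢(Space, ℂ)) (v : Space → Spinor) (ξ : Space) :
    χ ξ • diracSymbol m α β ξ (v ξ) =
      ∑ k : Fin 3, Matrix.toEuclideanCLM (n := Fin 4) (𝕜 := ℂ) (α k)
        (SchwartzMap.smulLeftCLM ℂ (fun ξ : Space => ((2 * Real.pi * ξ k : ℝ) : ℂ)) χ ξ • v ξ) +
      (m : ℂ) • Matrix.toEuclideanCLM (n := Fin 4) (𝕜 := ℂ) β (χ ξ • v ξ) := by
  have h1 (k : Fin 3) : SchwartzMap.smulLeftCLM ℂ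
      (fun ξ : Space => ((2 * Real.pi * ξ k : ℝ) : ℂ)) χ ξ = χ ξ *
        ((2 * Real.pi * ξ k : ℝ) : ℂ) := by
    rw [SchwartzMap.smulLeftCLM_apply_apply (hasTemperateGrowth_coord _), smul_eq_mul, mul_comm]
  simp only [diracSymbol, _root_.add_apply, _root_.sum_apply, _root_.smul_apply, smul_add,
    Finset.smul_sum, h1, map_smul, smul_smul, mul_comm (m : ℂ)]

theorem integrable_toEuclideanCLM_schwartz (A : Matrix (Fin 4) (Fin 4) ℂ) (η : 𝓢(Space, ℂ))
    {v : Space → Spinor} (hv : ∀ η : 𝓢(Space, ℂ), Integrable fun ξ => η ξ • v ξ) :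
    Integrable fun ξ => Matrix.toEuclideanCLM (n := Fin 4) (𝕜 := ℂ) A (η ξ • v ξ) :=
  (Matrix.toEuclideanCLM (n := Fin 4) (𝕜 := ℂ) A).integrable_comp (hv η)

theorem integrable_schwartz_smul_diracSymbol (χ : 𝓢(Space, ℂ)) {v : Space → Spinor}
    (hv : ∀ η : 𝓢(Space, ℂ), Integrable fun ξ => η ξ • v ξ) : Integrable fun ξ =>
      χ ξ • diracSymbol m α β ξ (v ξ) := by
  simp_rw [schwartz_smul_diracSymbol]
  exact (integrable_finsetSum _ fun k _ => integrable_toEuclideanCLM_schwartz _ _ hv).add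
    ((integrable_toEuclideanCLM_schwartz _ _ hv).smul (m : ℂ))

theorem integral_schwartz_smul_diracSymbol (χ : 𝓢(Space, ℂ)) {v : Space → Spinor}
    (hv : ∀ η : 𝓢(Space, ℂ), Integrable fun ξ => η ξ • v ξ) : ∫ ξ, χ ξ • diracSymbol m α β ξ (v ξ) =
      ∑ k : Fin 3, Matrix.toEuclideanCLM (n := Fin 4) (𝕜 := ℂ) (α k)
        (∫ ξ, SchwartzMap.smulLeftCLM ℂ (fun ξ : Space =>
          ((2 * Real.pi * ξ k : ℝ) : ℂ)) χ ξ • v ξ) +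
      (m : ℂ) • Matrix.toEuclideanCLM (n := Fin 4) (𝕜 := ℂ) β (∫ ξ, χ ξ • v ξ) := by
  simp_rw [schwartz_smul_diracSymbol]
  have h1 := fun A η => integrable_toEuclideanCLM_schwartz A η hv
  refine (integral_add (integrable_finsetSum _ fun k _ => h1 _ _) ((h1 _ _).smul (m : ℂ))).trans ?_
  simp only [Pi.smul_apply]
  rw [integral_finsetSum _ (fun k _ => h1 _ _), integral_smul]
  congr 1
  · exact Finset.sum_congr rfl fun k _ =>
      ContinuousLinearMap.integral_comp_comm _ (hv _)
  · congr 1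
    exact ContinuousLinearMap.integral_comp_comm _ (hv _)

theorem dirac_apply_fourier_coe (u : L2) (χ : 𝓢(Space, ℂ)) :
    dirac m α β (u : Distr) (𝓕 χ) = ∫ ξ, χ ξ • diracSymbol m α β ξ ((𝓕 u : L2) ξ) := by
  rw [dirac_apply_fourier, integral_schwartz_smul_diracSymbol _ fun η =>
    integrable_schwartz_smul η (Lp.memLp _)]
  simp only [fourier_apply_coe]

theorem hasTemperateGrowth_smoothingSymbol_one (hm : 0 < m) :
    (fun ξ : Space => ((smoothingSymbol m 1 ξ : ℝ) : ℂ)).HasTemperateGrowth := by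
  have h0 : (fun ξ : Space => ((1 + ‖ξ‖ ^ 2) ^ (-1 : ℝ) : ℝ)).HasTemperateGrowth := by fun_prop
  -- rescaling the frequency by `2π/m` reduces to the Japanese bracket
  let L : Space →L[ℝ] Space := (2 * Real.pi / m) • ContinuousLinearMap.id ℝ Space
  have h1 : (fun ξ : Space => ((m ^ 2) ^ (-1 : ℝ) *
    (1 + ‖L ξ‖ ^ 2) ^ (-1 : ℝ) : ℝ)).HasTemperateGrowth :=
    (Function.HasTemperateGrowth.const _).mul (h0.comp L.hasTemperateGrowth)
  have h2 : (fun ξ : Space => smoothingSymbol m 1 ξ) =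
      fun ξ : Space => ((m ^ 2) ^ (-1 : ℝ) * (1 + ‖L ξ‖ ^ 2) ^ (-1 : ℝ) : ℝ) := by
    ext ξ
    rw [← Real.mul_rpow (by positivity) (by positivity), smoothingSymbol]
    congr 1
    have : ‖L ξ‖ = 2 * Real.pi / m * ‖ξ‖ := by
      simp only [L, _root_.smul_apply, ContinuousLinearMap.id_apply, norm_smul]
      rw [Real.norm_of_nonneg (by positivity)]
    rw [this]
    field_simp
    ring
  rw [← h2] at h1
  fun_prop

/-- `(-Δ + m²)⁻¹ ζ δ` has the Fourier transform `ω⁻² ζ`. -/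
theorem resolvent_deltaSpinor_apply (hm : 0 < m) (ζ : Spinor) (χ : 𝓢(Space, ℂ)) :
    resolvent m (deltaSpinor ζ) (𝓕 χ) = ∫ ξ, χ ξ • greenHat hm ζ ξ := by
  have h1 : resolvent m (deltaSpinor ζ) (𝓕 χ) = (𝓕 (SchwartzMap.smulLeftCLM ℂ
      (fun ξ : Space => ((smoothingSymbol m 1 ξ : ℝ) : ℂ)) χ)) 0 • ζ := by
    rw [resolvent, TemperedDistribution.fourierMultiplierCLM_apply_apply,
      FourierTransform.fourierInv_fourier_eq]
    rfl
  rw [h1, SchwartzMap.fourier_coe, Real.fourier_eq, ← integral_smul_const]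
  refine integral_congr_ae ?_
  filter_upwards [coeFn_greenHat hm ζ] with ξ hξ
  rw [hξ, SchwartzMap.smulLeftCLM_apply_apply (hasTemperateGrowth_smoothingSymbol_one hm),
    smoothingSymbol_eq hm]
  have h2 : omega m ξ ^ (-2 * (1 : ℝ)) = 1 / omega m ξ ^ 2 := by
    rw [mul_one, Real.rpow_neg (omega_pos hm ξ).le, one_div]
    norm_num
  rw [h2]
  simp [smul_smul, mul_comm]

/-- The evolution equation in the Fourier representation: `∂ₜ ψ̂ = -i D û` where `û` is the Fourier
transform of the regular part. -/
theorem hasDerivAt_fourier (hm : 0 < m) {ψ : ℝ → L2} {t : ℝ} {u : L2} {ζ : Spinor}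
    (hd : Decomposes m (ψ t) u ζ)
    (he : ∀ φ : 𝓢(Space, ℂ), ∃ v : Spinor, HasDerivAt (fun s => (ψ s : Distr) φ) v t ∧
      Complex.I • v = (dirac m α β (ψ t : Distr) - diracInv m α β (deltaSpinor ζ)) φ)
    (χ : 𝓢(Space, ℂ)) :
    HasDerivAt (fun s => ∫ ξ, χ ξ • (𝓕 (ψ s) : L2) ξ)
      (-Complex.I • ∫ ξ, χ ξ • diracSymbol m α β ξ ((𝓕 u : L2) ξ)) t := by
  obtain ⟨v, hv, hv'⟩ := he (𝓕 χ)
  simp only [fourier_apply_coe] at hv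
  convert! hv using 1
  have h1 : (dirac m α β (ψ t : Distr) - diracInv m α β (deltaSpinor ζ)) (𝓕 χ) =
      ∫ ξ, χ ξ • diracSymbol m α β ξ ((𝓕 u : L2) ξ) := by
    change dirac m α β (ψ t : Distr) (𝓕 χ) - diracInv m α β (deltaSpinor ζ) (𝓕 χ) = _
    have h2 : diracInv m α β (deltaSpinor ζ) (𝓕 χ) =
        ∫ ξ, χ ξ • diracSymbol m α β ξ (greenHat hm ζ ξ) := by
      rw [diracInv, dirac_apply_fourier, integral_schwartz_smul_diracSymbol _ fun η =>
        integrable_schwartz_smul η (Lp.memLp _)]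
      simp only [resolvent_deltaSpinor_apply hm]
    rw [h2, dirac_apply_fourier_coe, ← integral_sub
      (integrable_schwartz_smul_diracSymbol _ fun η => integrable_schwartz_smul η (Lp.memLp _))
      (integrable_schwartz_smul_diracSymbol _ fun η => integrable_schwartz_smul η (Lp.memLp _)),
        fourier_of_decomposes hm hd]
    refine integral_congr_ae ?_
    filter_upwards [Lp.coeFn_add (𝓕 u : L2) (greenHat hm ζ)] with ξ hξ
    rw [hξ, Pi.add_apply, map_add, smul_add, add_sub_cancel_right]
  rw [← h1, ← hv', smul_smul]
  simp

theorem memLp_of_memSobolev {s : ℝ} {u : L2}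
    (hu : TemperedDistribution.MemSobolev s 2 (u : Distr)) :
    MemLp (fun ξ => ((1 + ‖ξ‖ ^ 2) ^ (s / 2) : ℝ) • (𝓕 u : L2) ξ) 2 := by
  obtain ⟨w, hw⟩ := TemperedDistribution.memSobolev_iff_exists_smulLeftCLM_fourier.1 hu
  have hg : (fun ξ : Space => (((1 + ‖ξ‖ ^ 2) ^ (s / 2) : ℝ) : ℂ)).HasTemperateGrowth := by fun_prop
  have hgc : Continuous fun ξ : Space => (1 + ‖ξ‖ ^ 2) ^ (s / 2) :=
    Continuous.rpow_const (by fun_prop) fun ξ => Or.inl (by positivity)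
  have h1 : ∀ᵐ ξ, w ξ = ((1 + ‖ξ‖ ^ 2) ^ (s / 2) : ℝ) • (𝓕 u : L2) ξ := by
    refine ae_eq_of_integral_schwartz ((Lp.memLp w).locallyIntegrable one_le_two)
      (((Lp.memLp _).locallyIntegrable one_le_two).continuous_smul hgc) fun φ => ?_
    have h2 := congrArg (fun T : Distr => T φ) hw
    simp only [TemperedDistribution.smulLeftCLM_apply_apply,
      Lp.fourier_toTemperedDistribution_eq, Lp.toTemperedDistribution_apply] at h2
    rw [← h2]
    refine integral_congr_ae (Eventually.of_forall fun ξ => ?_)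
    simp only [SchwartzMap.smulLeftCLM_apply_apply hg, ← Complex.coe_smul, smul_smul, smul_eq_mul,
      mul_comm]
  exact (memLp_congr_ae h1).1 (Lp.memLp w)

/-- The Fourier transform of a function in `H^s` is integrable against weights which grow slower
than `⟨ξ⟩^{s - 3/2}`. -/
theorem integrable_of_memSobolev {s r : ℝ} (hsr : 3 < 2 * (s - r)) {u : L2}
    (hu : TemperedDistribution.MemSobolev s 2 (u : Distr)) :
    Integrable (fun ξ => ((1 + ‖ξ‖ ^ 2) ^ (r / 2) : ℝ) • (𝓕 u : L2) ξ) := by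
  have h : MemLp ((fun ξ : Space => (1 + ‖ξ‖ ^ 2) ^ (-(s - r) / 2)) •
      fun ξ => ((1 + ‖ξ‖ ^ 2) ^ (s / 2) : ℝ) • (𝓕 u : L2) ξ) 1 :=
    (memLp_of_memSobolev hu).smul (memLp_rpow_one_add_norm_sq hsr)
  refine (memLp_one_iff_integrable.1 h).congr (Eventually.of_forall fun ξ => ?_)
  simp only [Pi.smul_apply', smul_smul]
  rw [← Real.rpow_add (by positivity)]
  congr 2
  ring

/-- Regularity below `H^{3/2}` makes the regularized integrals absolutely convergent, for every
`ε > 0`. -/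
theorem integrable_smoothing (hm : 0 < m) {u : L2}
    (hu : ∀ s : ℝ, s < 3 / 2 → TemperedDistribution.MemSobolev s 2 (u : Distr))
    {ε : ℝ} (hε : 0 < ε) :
    Integrable fun ξ => omega m ξ ^ (-2 * ε) • (𝓕 u : L2) ξ := by
  obtain ⟨c, hc, h⟩ := omega_sq_ge hm
  have h1 := integrable_of_memSobolev (s := 3 / 2 - ε) (r := -2 * ε) (by linarith)
    (hu _ (by linarith))
  refine (h1.norm.const_mul (c ^ (-ε))).mono' ?_ (Eventually.of_forall fun ξ => ?_)
  · exact ((measurable_omega m).pow_const _).aestronglyMeasurable.smul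
      (Lp.aestronglyMeasurable (𝓕 u : L2))
  · rw [norm_smul, norm_smul, ← mul_assoc, Real.norm_of_nonneg
      (Real.rpow_nonneg (omega_pos hm ξ).le _), Real.norm_of_nonneg (by positivity)]
    gcongr
    rw [show -2 * ε = 2 * -ε by ring, Real.rpow_mul (omega_pos hm ξ).le, Real.rpow_two,
      show 2 * -ε / 2 = -ε by ring, ← Real.mul_rpow hc.le (by positivity)]
    exact Real.rpow_le_rpow_of_nonpos (by positivity) (h ξ) (by linarith)

/-- The inner limit in the regularized value is the integral of the Fourier transform. -/
theorem tendsto_of_hasRegularizedValue (hm : 0 < m) {u : L2} {v : Spinor}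
    (hu : ∀ s : ℝ, s < 3 / 2 → TemperedDistribution.MemSobolev s 2 (u : Distr))
    (h : HasRegularizedValue m u v) :
    Tendsto (fun ε : ℝ => ∫ ξ, omega m ξ ^ (-2 * ε) • (𝓕 u : L2) ξ) (𝓝[>] 0) (𝓝 v) := by
  obtain ⟨L, hL, hLv⟩ := h
  refine hLv.congr' ?_
  filter_upwards [self_mem_nhdsWithin] with ε hε
  have hε : 0 < ε := hε
  refine tendsto_nhds_unique (hL ε hε) ?_
  set G : Space → Spinor := fun ξ => ((smoothingSymbol m ε ξ : ℝ) : ℂ) • (𝓕 u : L2) ξ with hG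
  have hGe : G = fun ξ => omega m ξ ^ (-2 * ε) • (𝓕 u : L2) ξ := by
    ext1 ξ
    rw [hG]
    simp only [smoothingSymbol_eq hm, Complex.coe_smul]
  have hGi : Integrable G := by rw [hGe]; exact integrable_smoothing hm hu hε
  have hc : Continuous (𝓕⁻ G) := by
    have h1 : Continuous (𝓕 G) := VectorFourier.fourierIntegral_continuous
      Real.continuous_fourierChar continuous_inner hGi
    have h2 : 𝓕⁻ G = fun x => 𝓕 G (-x) := by
      ext1 x; exact Real.fourierInv_eq_fourier_neg G x
    rw [h2]
    exact h1.comp continuous_neg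
  have h0 : 𝓕⁻ G 0 = ∫ ξ, omega m ξ ^ (-2 * ε) • (𝓕 u : L2) ξ := by
    rw [Real.fourierInv_eq, hGe]
    simp
  rw [← h0]
  exact (hc.tendsto 0).mono_left nhdsWithin_le_nhds

theorem norm_sq_eq_integral (v : L2) : ‖v‖ ^ 2 = ∫ ξ, ‖v ξ‖ ^ 2 := by
  have h5 := inner_self_eq_norm_sq (𝕜 := ℂ) v
  have h6 : ∀ ξ, inner ℂ (v ξ) (v ξ) = ((‖v ξ‖ ^ 2 : ℝ) : ℂ) := fun ξ => by
    rw [inner_self_eq_norm_sq_to_K (𝕜 := ℂ)]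
    norm_cast
  rw [← h5, L2.inner_def]
  simp_rw [h6]
  rw [integral_complex_ofReal, RCLike.re_to_complex, Complex.ofReal_re]

/-- By Plancherel's theorem, the energy may be computed from the Fourier transform. -/
theorem hasEnergy_of_memLp {u : L2} {ζ : Spinor} {U : Spinor → ℝ} {h : ℝ}
    (hu : MemLp (fun ξ => diracSymbol m α β ξ ((𝓕 u : L2) ξ)) 2)
    (hh : (∫ ξ, ‖diracSymbol m α β ξ ((𝓕 u : L2) ξ)‖ ^ 2) + U ζ = h) :
    HasEnergy m α β U u ζ h := by
  set w : L2 := hu.toLp _ with hw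
  refine ⟨𝓕⁻ w, ?_, ?_⟩
  · ext1 φ
    have h1 := fourier_apply_coe (𝓕⁻ w) (𝓕⁻ φ)
    have h2 := dirac_apply_fourier_coe (m := m) (α := α) (β := β) u (𝓕⁻ φ)
    rw [FourierTransform.fourier_fourierInv_eq] at h1 h2
    rw [h1, h2, FourierTransform.fourier_fourierInv_eq]
    refine integral_congr_ae ?_
    filter_upwards [hu.coeFn_toLp] with ξ hξ
    rw [hξ]
  · rw [← hh, ← Lp.norm_fourier_eq, FourierTransform.fourier_fourierInv_eq]
    congr 1
    rw [norm_sq_eq_integral]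
    refine integral_congr_ae ?_
    filter_upwards [hu.coeFn_toLp] with ξ hξ
    rw [hξ]

/-! ### The free propagator -/

/-- The free Dirac propagator `e^{-itD(ξ)} = cos(ωt) - i ω⁻¹ sin(ωt) D(ξ)`. -/
noncomputable def freeProp (m : ℝ) (α : Fin 3 → Matrix (Fin 4) (Fin 4) ℂ)
    (β : Matrix (Fin 4) (Fin 4) ℂ) (t : ℝ) (ξ : Space) : Spinor →L[ℂ] Spinor :=
  ((Real.cos (omega m ξ * t) : ℝ) : ℂ) • 1
    - (Complex.I * ((Real.sin (omega m ξ * t) / omega m ξ : ℝ) : ℂ)) • diracSymbol m α β ξ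

theorem freeProp_zero (ξ : Space) : freeProp m α β 0 ξ = 1 := by
  ext1 v
  change ((Real.cos (omega m ξ * 0) : ℝ) : ℂ) • v
    - (Complex.I * ((Real.sin (omega m ξ * 0) / omega m ξ : ℝ) : ℂ)) • diracSymbol m α β ξ v = v
  simp

theorem freeProp_apply (t : ℝ) (ξ : Space) (v : Spinor) :
    freeProp m α β t ξ v = ((Real.cos (omega m ξ * t) : ℝ) : ℂ) • v
      - (Complex.I * ((Real.sin (omega m ξ * t) / omega m ξ : ℝ) : ℂ)) • diracSymbol m α β ξ v :=
  rfl

theorem freeProp_mul_neg (hm : 0 < m) (hαβ : IsDiracMatrices α β) (t s : ℝ) (ξ : Space) :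
    freeProp m α β t ξ * freeProp m α β (-s) ξ = freeProp m α β (t - s) ξ := by
  have hω : (omega m ξ : ℂ) ≠ 0 := Complex.ofReal_ne_zero.2 (omega_pos hm ξ).ne'
  simp only [freeProp, sub_mul, mul_sub, smul_mul_assoc, mul_smul_comm, one_mul, mul_one,
    diracSymbol_mul_self hαβ, smul_smul, mul_neg, Real.cos_neg, Real.sin_neg,
    sub_eq_add_neg t s, mul_add, Real.cos_add, Real.sin_add]
  push_cast
  match_scalars
  · field_simp
    ring_nf
    simp only [Complex.I_sq]
    ring
  · field_simp
    ring

theorem freeProp_freeProp_neg (hm : 0 < m) (hαβ : IsDiracMatrices α β) (t s : ℝ) (ξ : Space)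
    (v : Spinor) : freeProp m α β t ξ (freeProp m α β (-s) ξ v) = freeProp m α β (t - s) ξ v := by
  rw [← freeProp_mul_neg hm hαβ]; rfl

theorem freeProp_diracSymbol (t : ℝ) (ξ : Space) (v : Spinor) :
    freeProp m α β t ξ (diracSymbol m α β ξ v) = diracSymbol m α β ξ (freeProp m α β t ξ v) := by
  simp only [freeProp_apply, map_sub, map_smul]

theorem hasDerivAt_freeProp_apply (hm : 0 < m) (hαβ : IsDiracMatrices α β) (t : ℝ) (ξ : Space)
    {v : ℝ → Spinor} {v' : Spinor} (hv : HasDerivAt v v' t) :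
    HasDerivAt (fun t => freeProp m α β t ξ (v t))
      (-Complex.I • diracSymbol m α β ξ (freeProp m α β t ξ (v t)) + freeProp m α β t ξ v') t := by
  have hω : (omega m ξ : ℂ) ≠ 0 := Complex.ofReal_ne_zero.2 (omega_pos hm ξ).ne'
  have h1 : HasDerivAt (fun t : ℝ => omega m ξ * t) (omega m ξ) t := by
    simpa using (hasDerivAt_id t).const_mul (omega m ξ)
  have hD : HasDerivAt (fun t => diracSymbol m α β ξ (v t)) (diracSymbol m α β ξ v') t :=
    ((diracSymbol m α β ξ).restrictScalars ℝ).hasFDerivAt.comp_hasDerivAt t hv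
  have hc := (h1.cos.ofReal_comp).smul hv
  have hs := ((h1.sin.div_const (omega m ξ)).ofReal_comp.const_mul Complex.I).smul hD
  refine (hc.sub hs).congr_deriv ?_
  simp only [freeProp_apply, map_sub, map_smul, diracSymbol_diracSymbol hαβ, smul_smul, smul_sub]
  push_cast
  match_scalars
  · field_simp
  · field_simp
    rw [Complex.I_sq]
    ring
  · field_simp
  · field_simp

theorem hasDerivAt_freeProp (hm : 0 < m) (hαβ : IsDiracMatrices α β) (t : ℝ) (ξ : Space)
    (v : Spinor) : HasDerivAt (fun t => freeProp m α β t ξ v)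
      (-Complex.I • diracSymbol m α β ξ (freeProp m α β t ξ v)) t := by
  simpa using hasDerivAt_freeProp_apply hm hαβ t ξ (hasDerivAt_const t v)

theorem norm_freeProp_le (hm : 0 < m) (hαβ : IsDiracMatrices α β) (t : ℝ) (ξ : Space)
    (v : Spinor) : ‖freeProp m α β t ξ v‖ ≤ 2 * ‖v‖ := by
  have hω := omega_pos hm ξ
  rw [freeProp_apply]
  refine (norm_sub_le _ _).trans ?_
  rw [norm_smul, norm_smul, norm_mul, Complex.norm_I, one_mul, Complex.norm_real,
    Complex.norm_real, norm_diracSymbol hm hαβ, norm_div, Real.norm_of_nonneg hω.le, two_mul]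
  have h1 : ‖Real.cos (omega m ξ * t)‖ ≤ 1 := Real.abs_cos_le_one _
  have h2 : ‖Real.sin (omega m ξ * t)‖ ≤ 1 := Real.abs_sin_le_one _
  refine add_le_add (mul_le_of_le_one_left (norm_nonneg _) h1) ?_
  rw [← mul_assoc, div_mul_cancel₀ _ hω.ne']
  exact mul_le_of_le_one_left (norm_nonneg _) h2

theorem norm_freeProp_sub_le (hm : 0 < m) (hαβ : IsDiracMatrices α β) (s t : ℝ) (ξ : Space)
    (v : Spinor) :
    ‖freeProp m α β s ξ v - freeProp m α β t ξ v‖ ≤ 2 * omega m ξ * ‖v‖ * |s - t| := by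
  refine Convex.norm_image_sub_le_of_norm_hasDerivWithin_le (s := Set.univ)
    (f := fun x => freeProp m α β x ξ v)
    (f' := fun x => -Complex.I • diracSymbol m α β ξ (freeProp m α β x ξ v))
    (fun x _ => (hasDerivAt_freeProp hm hαβ x ξ v).hasDerivWithinAt) (fun x _ => ?_)
    convex_univ (Set.mem_univ t) (Set.mem_univ s)
  rw [norm_smul, norm_neg, Complex.norm_I, one_mul, norm_diracSymbol hm hαβ]
  have := norm_freeProp_le hm hαβ x ξ v
  have := omega_pos hm ξ
  nlinarith

/-- Second order Taylor estimate of the propagator. -/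
theorem norm_freeProp_taylor_le (hm : 0 < m) (hαβ : IsDiracMatrices α β) (s t : ℝ) (ξ : Space)
    (v : Spinor) :
    ‖freeProp m α β s ξ v - freeProp m α β t ξ v
      - (s - t) • (-Complex.I • diracSymbol m α β ξ (freeProp m α β t ξ v))‖ ≤
      2 * omega m ξ ^ 2 * ‖v‖ * |s - t| ^ 2 := by
  have hω := omega_pos hm ξ
  set w := -Complex.I • diracSymbol m α β ξ (freeProp m α β t ξ v) with hw
  have hd : ∀ x, HasDerivAt (fun x => freeProp m α β x ξ v - x • w)
      (-Complex.I • diracSymbol m α β ξ (freeProp m α β x ξ v) - w) x := fun x => by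
    have h1 : HasDerivAt (fun x : ℝ => x • w) w x := by
      simpa using (hasDerivAt_id x).smul_const w
    exact (hasDerivAt_freeProp hm hαβ x ξ v).sub h1
  have h := Convex.norm_image_sub_le_of_norm_hasDerivWithin_le (s := Set.uIcc t s)
    (f := fun x => freeProp m α β x ξ v - x • w)
    (f' := fun x => -Complex.I • diracSymbol m α β ξ (freeProp m α β x ξ v) - w)
    (C := 2 * omega m ξ ^ 2 * ‖v‖ * |s - t|)
    (fun x _ => (hd x).hasDerivWithinAt) (fun x hx => ?_)
    (convex_uIcc t s) Set.left_mem_uIcc Set.right_mem_uIcc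
  · refine le_of_eq_of_le ?_ (h.trans (le_of_eq ?_))
    · congr 1; module
    · rw [Real.norm_eq_abs]; ring
  · rw [hw, ← smul_sub, ← map_sub, norm_smul, norm_neg, Complex.norm_I, one_mul,
      norm_diracSymbol hm hαβ]
    have h1 := norm_freeProp_sub_le hm hαβ x t ξ v
    have h2 : |x - t| ≤ |s - t| := Set.abs_sub_left_of_mem_uIcc hx
    calc omega m ξ * ‖freeProp m α β x ξ v - freeProp m α β t ξ v‖
        ≤ omega m ξ * (2 * omega m ξ * ‖v‖ * |s - t|) := by gcongr; exact h1.trans (by gcongr)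
      _ = _ := by ring

theorem continuous_freeProp (hm : 0 < m) : Continuous fun p : ℝ × Space =>
    freeProp m α β p.1 p.2 := by
  have h1 : Continuous fun p : ℝ × Space => omega m p.2 := (continuous_omega m).comp continuous_snd
  have h2 : Continuous fun p : ℝ × Space => Real.sin (omega m p.2 * p.1) / omega m p.2 :=
    (Real.continuous_sin.comp (h1.mul continuous_fst)).div h1 fun p => (omega_pos hm p.2).ne'
  unfold freeProp
  fun_prop

/-! ### The Duhamel formula -/

/-- The coefficients of `g e^{isD}` in terms of `1` and `D` are Schwartz functions, so that `g
e^{isD}`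
is admissible as a test function. -/
theorem exists_schwartz_cos_sin (hm : 0 < m) {g : Space → ℝ} (hg : ContDiff ℝ (⊤ : ℕ∞) g)
    (hgc : HasCompactSupport g) (t : ℝ) : ∃ c d : 𝓢(Space, ℂ), ∀ ξ,
      c ξ = ((g ξ * Real.cos (omega m ξ * t) : ℝ) : ℂ) ∧
      d ξ = Complex.I * ((g ξ * (Real.sin (omega m ξ * t) / omega m ξ) : ℝ) : ℂ) := by
  have hω := contDiff_omega hm
  have h1 : ContDiff ℝ (⊤ : ℕ∞) fun ξ => g ξ * Real.cos (omega m ξ * t) :=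
    hg.mul (Real.contDiff_cos.comp (hω.mul contDiff_const))
  have h2 : ContDiff ℝ (⊤ : ℕ∞) fun ξ => g ξ * (Real.sin (omega m ξ * t) / omega m ξ) :=
    hg.mul ((Real.contDiff_sin.comp (hω.mul contDiff_const)).div hω
      fun ξ => (omega_pos hm ξ).ne')
  have h3 : ContDiff ℝ (⊤ : ℕ∞) fun ξ => ((g ξ * Real.cos (omega m ξ * t) : ℝ) : ℂ) :=
    Complex.ofRealCLM.contDiff.comp h1
  have h4 : ContDiff ℝ (⊤ : ℕ∞) fun ξ =>
      Complex.I * ((g ξ * (Real.sin (omega m ξ * t) / omega m ξ) : ℝ) : ℂ) :=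
    contDiff_const.mul (Complex.ofRealCLM.contDiff.comp h2)
  have h5 : HasCompactSupport fun ξ => ((g ξ * Real.cos (omega m ξ * t) : ℝ) : ℂ) :=
    hgc.mono' (fun ξ hξ => subset_tsupport _ fun h => hξ (by simp [h]))
  have h6 : HasCompactSupport fun ξ =>
      Complex.I * ((g ξ * (Real.sin (omega m ξ * t) / omega m ξ) : ℝ) : ℂ) :=
    hgc.mono' (fun ξ hξ => subset_tsupport _ fun h => hξ (by simp [h]))
  exact ⟨h5.toSchwartzMap h3, h6.toSchwartzMap h4, fun ξ => ⟨rfl, rfl⟩⟩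

theorem integrable_compactSupport_smul {g : Space → ℝ} (hg : Continuous g)
    (hgc : HasCompactSupport g) {v : Space → Spinor} (hv : MemLp v 2) :
    Integrable fun ξ => g ξ • v ξ :=
  memLp_one_iff_integrable.1 (hv.smul (hg.memLp_of_hasCompactSupport hgc (p := 2)))

theorem smul_freeProp_neg_eq {g : Space → ℝ} {t : ℝ} {c d : 𝓢(Space, ℂ)} (h : ∀ ξ,
      c ξ = ((g ξ * Real.cos (omega m ξ * t) : ℝ) : ℂ) ∧
      d ξ = Complex.I * ((g ξ * (Real.sin (omega m ξ * t) / omega m ξ) : ℝ) : ℂ))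
    (ξ : Space) (v : Spinor) :
    g ξ • freeProp m α β (-t) ξ v = c ξ • v + d ξ • diracSymbol m α β ξ v := by
  rw [(h ξ).1, (h ξ).2, freeProp_apply, ← Complex.coe_smul]
  simp only [mul_neg, Real.cos_neg, Real.sin_neg]
  push_cast
  match_scalars
  · ring
  · ring

theorem continuous_integral_schwartz_smul (c : 𝓢(Space, ℂ)) :
    Continuous fun v : L2 => ∫ ξ, c ξ • v ξ := by
  have h1 : Continuous fun v : L2 =>
      (Lp.toTemperedDistributionCLM Spinor (volume : Measure Space) 2 v : Distr) c :=
    (PointwiseConvergenceCLM.evalCLM (RingHom.id ℂ) Spinor c).continuous.comp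
      (Lp.toTemperedDistributionCLM Spinor (volume : Measure Space) 2).continuous
  simpa using h1

/-- The functional `v ↦ ∫ g e^{isD} v` on `L²`. -/
theorem integral_freeProp_eq {g : Space → ℝ} {t : ℝ} {c d : 𝓢(Space, ℂ)} (h : ∀ ξ,
      c ξ = ((g ξ * Real.cos (omega m ξ * t) : ℝ) : ℂ) ∧
      d ξ = Complex.I * ((g ξ * (Real.sin (omega m ξ * t) / omega m ξ) : ℝ) : ℂ))
    {v : Space → Spinor} (hv : ∀ η : 𝓢(Space, ℂ), Integrable fun ξ => η ξ • v ξ) :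
    ∫ ξ, g ξ • freeProp m α β (-t) ξ (v ξ) = (∫ ξ, c ξ • v ξ) +
      (∑ k : Fin 3, Matrix.toEuclideanCLM (n := Fin 4) (𝕜 := ℂ) (α k)
        (∫ ξ, SchwartzMap.smulLeftCLM ℂ (fun ξ : Space =>
          ((2 * Real.pi * ξ k : ℝ) : ℂ)) d ξ • v ξ) +
      (m : ℂ) • Matrix.toEuclideanCLM (n := Fin 4) (𝕜 := ℂ) β (∫ ξ, d ξ • v ξ)) := by
  simp_rw [smul_freeProp_neg_eq h]
  rw [integral_add (hv c) (integrable_schwartz_smul_diracSymbol d hv),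
    integral_schwartz_smul_diracSymbol d hv]

theorem continuous_integral_freeProp (hm : 0 < m) {g : Space → ℝ} (hg : ContDiff ℝ (⊤ : ℕ∞) g)
    (hgc : HasCompactSupport g) (t : ℝ) :
    Continuous fun v : L2 => ∫ ξ, g ξ • freeProp m α β (-t) ξ (v ξ) := by
  obtain ⟨c, d, h⟩ := exists_schwartz_cos_sin hm hg hgc t
  simp_rw [integral_freeProp_eq h fun η => integrable_schwartz_smul η (Lp.memLp _)]
  refine (continuous_integral_schwartz_smul c).add ((continuous_finsetSum _ fun k _ => ?_).add ?_)
  · exact (Matrix.toEuclideanCLM (n := Fin 4) (𝕜 := ℂ) (α k)).continuous.comp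
      (continuous_integral_schwartz_smul _)
  · exact ((Matrix.toEuclideanCLM (n := Fin 4) (𝕜 := ℂ) β).continuous.comp
      (continuous_integral_schwartz_smul _)).const_smul (m : ℂ)

/-- Weak solutions of `∂ₛ Y = -i D û` may be tested with `g e^{itD}`. -/
theorem hasDerivAt_integral_freeProp (hm : 0 < m) {g : Space → ℝ} (hg : ContDiff ℝ (⊤ : ℕ∞) g)
    (hgc : HasCompactSupport g) (t : ℝ) {Y : ℝ → L2} {u : L2} {s : ℝ}
    (hY : ∀ χ : 𝓢(Space, ℂ), HasDerivAt (fun s => ∫ ξ, χ ξ • Y s ξ)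
      (-Complex.I • ∫ ξ, χ ξ • diracSymbol m α β ξ (u ξ)) s) :
    HasDerivAt (fun s => ∫ ξ, g ξ • freeProp m α β (-t) ξ (Y s ξ))
      (-Complex.I • ∫ ξ, g ξ • freeProp m α β (-t) ξ (diracSymbol m α β ξ (u ξ))) s := by
  obtain ⟨c, d, h⟩ := exists_schwartz_cos_sin hm hg hgc t
  have hu : ∀ η : 𝓢(Space, ℂ), Integrable fun ξ => η ξ • u ξ := fun η =>
    integrable_schwartz_smul η (Lp.memLp _)
  simp_rw [integral_freeProp_eq h fun η => integrable_schwartz_smul η (Lp.memLp _)]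
  rw [integral_freeProp_eq h fun η => integrable_schwartz_smul_diracSymbol η hu, smul_add, smul_add,
    Finset.smul_sum]
  have hA : ∀ (A : Matrix (Fin 4) (Fin 4) ℂ) (χ : 𝓢(Space, ℂ)),
      HasDerivAt (fun s => Matrix.toEuclideanCLM (n := Fin 4) (𝕜 := ℂ) A (∫ ξ, χ ξ • Y s ξ))
      (-Complex.I • Matrix.toEuclideanCLM (n := Fin 4) (𝕜 := ℂ) A
        (∫ ξ, χ ξ • diracSymbol m α β ξ (u ξ))) s := by
    intro A χ
    rw [← map_smul]
    exact ((Matrix.toEuclideanCLM (n := Fin 4)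
      (𝕜 := ℂ) A).restrictScalars ℝ).hasFDerivAt.comp_hasDerivAt
      s (hY χ)
  refine (hY c).add ((HasDerivAt.fun_sum fun k _ => hA _ _).add ?_)
  rw [smul_comm]
  exact (hA β d).const_smul (m : ℂ)

theorem norm_integral_smul_le {g : Space → ℝ} (hg : Continuous g) (hgc : HasCompactSupport g)
    {v w : Space → Spinor} (hv : MemLp v 2) {C : ℝ}
    (h : ∀ ξ, ‖w ξ‖ ≤ C * ‖v ξ‖ * ‖g ξ‖) :
    ‖∫ ξ, w ξ‖ ≤ C * ∫ ξ, ‖g ξ • v ξ‖ := by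
  rw [← integral_const_mul]
  refine norm_integral_le_of_norm_le
    ((integrable_compactSupport_smul hg hgc hv).norm.const_mul C) (Eventually.of_forall fun ξ => ?_)
  rw [norm_smul, mul_comm ‖g ξ‖, ← mul_assoc]
  exact h ξ

theorem exists_integral_norm_smul_le {g : Space → ℝ} (hg : MemLp g 2) :
    ∃ M, 0 ≤ M ∧ ∀ v : L2, ∫ ξ, ‖g ξ • v ξ‖ ≤ M * ‖v‖ := by
  refine ⟨(∫ ξ, ‖g ξ‖ ^ (2 : ℝ)) ^ (1 / 2 : ℝ), by positivity, fun v => ?_⟩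
  have h1 := integral_mul_norm_le_Lp_mul_Lq (μ := (volume : Measure Space))
    (f := fun ξ => ‖g ξ‖) (g := fun ξ => ‖v ξ‖) Real.HolderConjugate.two_two
    (by simpa using hg.norm) (by simpa using (Lp.memLp v).norm)
  simp only [norm_norm] at h1
  simp_rw [norm_smul]
  refine h1.trans_eq ?_
  congr 1
  simp_rw [Real.rpow_two]
  rw [← norm_sq_eq_integral, ← Real.sqrt_eq_rpow, Real.sqrt_sq (norm_nonneg _)]

theorem aestronglyMeasurable_clm_apply {X : Type*} [MeasurableSpace X] {μ : Measure X}
    {T : X → Spinor →L[ℂ] Spinor} {v : X → Spinor} (hT : AEStronglyMeasurable T μ)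
    (hv : AEStronglyMeasurable v μ) : AEStronglyMeasurable (fun x => T x (v x)) μ :=
  (isBoundedBilinearMap_apply (𝕜 := ℂ)).continuous.comp_aestronglyMeasurable (hT.prodMk hv)

theorem aestronglyMeasurable_freeProp (hm : 0 < m) (t : ℝ) {v : Space → Spinor}
    (hv : AEStronglyMeasurable v) : AEStronglyMeasurable fun ξ => freeProp m α β t ξ (v ξ) :=
  aestronglyMeasurable_clm_apply
    ((continuous_freeProp hm).comp (Continuous.prodMk_right t)).aestronglyMeasurable hv

theorem aestronglyMeasurable_diracSymbol {v : Space → Spinor}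
    (hv : AEStronglyMeasurable v) : AEStronglyMeasurable fun ξ => diracSymbol m α β ξ (v ξ) :=
  aestronglyMeasurable_clm_apply continuous_diracSymbol.aestronglyMeasurable hv

theorem integrable_freeProp_smul (hm : 0 < m) (hαβ : IsDiracMatrices α β) {g : Space → ℝ}
    (hg : Continuous g) (hgc : HasCompactSupport g) (t : ℝ) {v : Space → Spinor} (hv : MemLp v 2) :
    Integrable fun ξ => g ξ • freeProp m α β t ξ (v ξ) := by
  refine ((integrable_compactSupport_smul hg hgc hv).norm.const_mul 2).mono'
    (hg.aestronglyMeasurable.smul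
      (aestronglyMeasurable_freeProp hm t hv.1)) (Eventually.of_forall fun ξ => ?_)
  rw [norm_smul, norm_smul]
  have := norm_freeProp_le hm hαβ t ξ (v ξ)
  nlinarith [norm_nonneg (g ξ)]

/-- Lipschitz estimate in the time argument of the propagator only. -/
theorem norm_integral_freeProp_sub_le (hm : 0 < m) (hαβ : IsDiracMatrices α β) {g : Space → ℝ}
    (hg : Continuous g) (hgc : HasCompactSupport g) :
    ∃ K, 0 ≤ K ∧ ∀ (s t : ℝ) (v : L2), ‖(∫ ξ, g ξ • freeProp m α β s ξ (v ξ)) -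
      ∫ ξ, g ξ • freeProp m α β t ξ (v ξ)‖ ≤ K * |s - t| * ‖v‖ := by
  have hg1 : Continuous fun ξ => g ξ * omega m ξ := hg.mul (continuous_omega m)
  have hgc1 : HasCompactSupport fun ξ => g ξ * omega m ξ := hgc.mul_right
  obtain ⟨M, hM0, hM⟩ := exists_integral_norm_smul_le (hg1.memLp_of_hasCompactSupport hgc1)
  refine ⟨2 * M, by positivity, fun s t v => ?_⟩
  rw [← integral_sub (integrable_freeProp_smul hm hαβ hg hgc _ (Lp.memLp v))
    (integrable_freeProp_smul hm hαβ hg hgc _ (Lp.memLp v))]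
  refine (norm_integral_smul_le hg1 hgc1 (Lp.memLp v) (C := 2 * |s - t|) fun ξ => ?_).trans ?_
  · rw [← smul_sub, norm_smul, norm_mul, Real.norm_of_nonneg (omega_pos hm ξ).le]
    have := norm_freeProp_sub_le hm hαβ s t ξ (v ξ)
    calc ‖g ξ‖ * _ ≤ ‖g ξ‖ * (2 * omega m ξ * ‖v ξ‖ * |s - t|) := by gcongr
      _ = _ := by ring
  · calc _ ≤ 2 * |s - t| * (M * ‖v‖) := by gcongr; exact hM v
      _ = _ := by ring

theorem norm_dirac_freeProp_smul_le (hm : 0 < m) (hαβ : IsDiracMatrices α β) (g : Space → ℝ)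
    (t : ℝ) (ξ : Space) (v : Spinor) :
    ‖g ξ • (-Complex.I • diracSymbol m α β ξ (freeProp m α β t ξ v))‖ ≤
      2 * ‖v‖ * ‖g ξ * omega m ξ‖ := by
  rw [norm_smul, norm_smul, norm_neg, Complex.norm_I, one_mul, norm_diracSymbol hm hαβ, norm_mul,
    Real.norm_of_nonneg (omega_pos hm ξ).le]
  have := norm_freeProp_le hm hαβ t ξ v
  have := omega_pos hm ξ
  calc ‖g ξ‖ * (omega m ξ * ‖freeProp m α β t ξ v‖)
      ≤ ‖g ξ‖ * (omega m ξ * (2 * ‖v‖)) := by gcongr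
    _ = _ := by ring

theorem integrable_dirac_freeProp_smul (hm : 0 < m) (hαβ : IsDiracMatrices α β) {g : Space → ℝ}
    (hg : Continuous g) (hgc : HasCompactSupport g) (t : ℝ) {v : Space → Spinor} (hv : MemLp v 2) :
    Integrable fun ξ => g ξ • (-Complex.I • diracSymbol m α β ξ (freeProp m α β t ξ (v ξ))) := by
  have hg1 : Continuous fun ξ => g ξ * omega m ξ := hg.mul (continuous_omega m)
  have hgc1 : HasCompactSupport fun ξ => g ξ * omega m ξ := hgc.mul_right
  refine ((integrable_compactSupport_smul hg1 hgc1 hv).norm.const_mul 2).mono' ?_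
    (Eventually.of_forall fun ξ => ?_)
  · exact hg.aestronglyMeasurable.smul ((aestronglyMeasurable_diracSymbol
      (aestronglyMeasurable_freeProp hm t hv.1)).const_smul (-Complex.I))
  · refine (norm_dirac_freeProp_smul_le hm hαβ g t ξ (v ξ)).trans_eq ?_
    rw [norm_smul]
    ring

theorem continuous_integral_dirac_freeProp (hm : 0 < m) (hαβ : IsDiracMatrices α β)
    {g : Space → ℝ} (hg : Continuous g) (hgc : HasCompactSupport g) (t : ℝ) :
    Continuous fun v : L2 =>
      ∫ ξ, g ξ • (-Complex.I • diracSymbol m α β ξ (freeProp m α β t ξ (v ξ))) := by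
  have hg1 : Continuous fun ξ => g ξ * omega m ξ := hg.mul (continuous_omega m)
  have hgc1 : HasCompactSupport fun ξ => g ξ * omega m ξ := hgc.mul_right
  obtain ⟨M, hM0, hM⟩ := exists_integral_norm_smul_le (hg1.memLp_of_hasCompactSupport hgc1)
  refine LipschitzWith.continuous (K := ⟨2 * M, by positivity⟩) (LipschitzWith.of_dist_le_mul ?_)
  intro v w
  rw [dist_eq_norm, dist_eq_norm, ← integral_sub
    (integrable_dirac_freeProp_smul hm hαβ hg hgc t (Lp.memLp v))
    (integrable_dirac_freeProp_smul hm hαβ hg hgc t (Lp.memLp w))]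
  have h1 : ∫ ξ, (g ξ • (-Complex.I • diracSymbol m α β ξ (freeProp m α β t ξ (v ξ))) -
      g ξ • (-Complex.I • diracSymbol m α β ξ (freeProp m α β t ξ (w ξ)))) =
      ∫ ξ, g ξ • (-Complex.I • diracSymbol m α β ξ (freeProp m α β t ξ ((v - w) ξ))) := by
    refine integral_congr_ae ?_
    filter_upwards [Lp.coeFn_sub v w] with ξ hξ
    rw [hξ, Pi.sub_apply]
    simp only [map_sub, smul_sub]
  rw [h1]
  refine (norm_integral_smul_le hg1 hgc1 (Lp.memLp (v - w)) (C := 2) fun ξ =>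
    norm_dirac_freeProp_smul_le hm hαβ g t ξ _).trans ?_
  have := hM (v - w)
  change _ ≤ 2 * M * _
  linarith

/-- First order Taylor estimate in the time argument of the propagator only. -/
theorem norm_integral_freeProp_taylor_le (hm : 0 < m) (hαβ : IsDiracMatrices α β) {g : Space → ℝ}
    (hg : Continuous g) (hgc : HasCompactSupport g) :
    ∃ K, 0 ≤ K ∧ ∀ (s t : ℝ) (v : L2), ‖(∫ ξ, g ξ • freeProp m α β s ξ (v ξ)) -
      (∫ ξ, g ξ • freeProp m α β t ξ (v ξ)) - (s - t) •
        ∫ ξ, g ξ • (-Complex.I • diracSymbol m α β ξ (freeProp m α β t ξ (v ξ)))‖ ≤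
          K * |s - t| ^ 2 * ‖v‖ := by
  have hg1 : Continuous fun ξ => g ξ * omega m ξ := hg.mul (continuous_omega m)
  have hgc1 : HasCompactSupport fun ξ => g ξ * omega m ξ := hgc.mul_right
  have hg2 : Continuous fun ξ => g ξ * omega m ξ ^ 2 := hg.mul ((continuous_omega m).pow 2)
  have hgc2 : HasCompactSupport fun ξ => g ξ * omega m ξ ^ 2 := hgc.mul_right
  obtain ⟨M, hM0, hM⟩ := exists_integral_norm_smul_le (hg2.memLp_of_hasCompactSupport hgc2)
  refine ⟨2 * M, by positivity, fun s t v => ?_⟩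
  have hi := integrable_dirac_freeProp_smul hm hαβ hg hgc t (Lp.memLp v)
  have hs := integrable_freeProp_smul hm hαβ hg hgc s (Lp.memLp v)
  have ht := integrable_freeProp_smul hm hαβ hg hgc t (Lp.memLp v)
  have e := integral_sub (hs.sub ht) (hi.smul (s - t))
  simp only [Pi.sub_apply, Pi.smul_apply] at e
  rw [integral_sub hs ht, integral_smul] at e
  rw [← e]
  refine (norm_integral_smul_le hg2 hgc2 (Lp.memLp v) (C := 2 * |s - t| ^ 2) fun ξ => ?_).trans ?_
  · rw [smul_comm (s - t) (g ξ), ← smul_sub, ← smul_sub, norm_smul, norm_mul, norm_pow,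
      Real.norm_of_nonneg (omega_pos hm ξ).le]
    have := norm_freeProp_taylor_le hm hαβ s t ξ (v ξ)
    calc ‖g ξ‖ * _ ≤ ‖g ξ‖ * (2 * omega m ξ ^ 2 * ‖v ξ‖ * |s - t| ^ 2) := by gcongr
      _ = _ := by ring
  · calc _ ≤ 2 * |s - t| ^ 2 * (M * ‖v‖) := by gcongr; exact hM v
      _ = _ := by ring

/-- Pairing of an `L²`-continuous weak solution with `g e^{isD}`: product rule. -/
theorem hasDerivAt_integral_freeProp_moving (hm : 0 < m) (hαβ : IsDiracMatrices α β)
    {g : Space → ℝ} (hg : ContDiff ℝ (⊤ : ℕ∞) g) (hgc : HasCompactSupport g)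
    {Y : ℝ → L2} {u : L2} {t : ℝ} {z : Spinor} (hYc : ContinuousAt Y t)
    (hY : ∀ χ : 𝓢(Space, ℂ), HasDerivAt (fun s => ∫ ξ, χ ξ • Y s ξ)
      (-Complex.I • ∫ ξ, χ ξ • diracSymbol m α β ξ (u ξ)) t)
    (hu : Y t = u + greenHat hm z) :
    HasDerivAt (fun s => ∫ ξ, g ξ • freeProp m α β (-s) ξ (Y s ξ))
      (∫ ξ, g ξ • freeProp m α β (-t) ξ
        (Complex.I • diracSymbol m α β ξ (((1 / omega m ξ ^ 2 : ℝ) : ℂ) • z))) t := by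
  obtain ⟨K, hK0, hK⟩ := norm_integral_freeProp_taylor_le hm hαβ hg.continuous hgc
  set Q : L2 → Spinor := fun v =>
    ∫ ξ, g ξ • (-Complex.I • diracSymbol m α β ξ (freeProp m α β (-t) ξ (v ξ))) with hQ
  have hQc : ContinuousAt (fun s => Q (Y s)) t :=
    (continuous_integral_dirac_freeProp hm hαβ hg.continuous hgc (-t)).continuousAt.comp hYc
  have h1 := hasDerivAt_integral_freeProp hm hg hgc t hY
  have h2 : HasDerivAt (fun s => (∫ ξ, g ξ • freeProp m α β (-s) ξ (Y s ξ)) -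
      ∫ ξ, g ξ • freeProp m α β (-t) ξ (Y s ξ)) (-Q (Y t)) t := by
    rw [hasDerivAt_iff_tendsto]
    have h3 : Tendsto (fun s => K * |s - t| * ‖Y s‖ + ‖Q (Y s) - Q (Y t)‖) (𝓝 t) (𝓝 0) := by
      have e1 : Tendsto (fun s => K * |s - t| * ‖Y s‖) (𝓝 t) (𝓝 (K * |t - t| * ‖Y t‖)) :=
        Tendsto.mul ((by fun_prop : Continuous fun s => K * |s - t|).tendsto t) hYc.norm
      have e2 : Tendsto (fun s => ‖Q (Y s) - Q (Y t)‖) (𝓝 t) (𝓝 ‖Q (Y t) - Q (Y t)‖) :=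
        (hQc.sub continuousAt_const).norm
      simpa using e1.add e2
    refine squeeze_zero (fun s => by positivity) (fun s => ?_) h3
    rw [sub_self, sub_zero]
    rcases eq_or_ne s t with rfl | hst
    · simp only [sub_self, norm_zero, inv_zero, zero_mul]
      positivity
    have hpos : 0 < ‖s - t‖ := norm_pos_iff.2 (sub_ne_zero.2 hst)
    rw [inv_mul_le_iff₀ hpos]
    have h4 := hK (-s) (-t) (Y s)
    rw [show -s - -t = -(s - t) by ring, abs_neg] at h4
    have h5 : (∫ ξ, g ξ • freeProp m α β (-s) ξ (Y s ξ)) -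
        (∫ ξ, g ξ • freeProp m α β (-t) ξ (Y s ξ)) - (s - t) • -Q (Y t) =
        ((∫ ξ, g ξ • freeProp m α β (-s) ξ (Y s ξ)) -
        (∫ ξ, g ξ • freeProp m α β (-t) ξ (Y s ξ)) - (-(s - t)) • Q (Y s)) -
        (s - t) • (Q (Y s) - Q (Y t)) := by module
    rw [h5]
    refine (norm_sub_le _ _).trans ((add_le_add h4 (norm_smul_le _ _)).trans_eq ?_)
    rw [Real.norm_eq_abs]
    ring
  have h6 := h2.add h1
  simp only [Pi.add_def, sub_add_cancel] at h6
  convert! h6 using 1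
  have hui : Integrable fun ξ => g ξ • freeProp m α β (-t) ξ (diracSymbol m α β ξ (u ξ)) := by
    refine (integrable_dirac_freeProp_smul hm hαβ hg.continuous hgc (-t)
      (Lp.memLp u)).smul Complex.I |>.congr (Eventually.of_forall fun ξ => ?_)
    simp only [Pi.smul_apply]
    rw [freeProp_diracSymbol, smul_comm, smul_smul]
    simp
  have e := integral_add
    (integrable_dirac_freeProp_smul hm hαβ hg.continuous hgc (-t) (Lp.memLp (Y t))).neg
    (hui.smul (-Complex.I))
  simp only [Pi.neg_apply, Pi.smul_apply] at e
  rw [integral_neg, integral_smul] at e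
  rw [hQ, ← e]
  refine integral_congr_ae ?_
  rw [hu]
  filter_upwards [Lp.coeFn_add u (greenHat hm z), coeFn_greenHat hm z] with ξ h7 h8
  rw [h7, Pi.add_apply, h8]
  simp only [map_add, map_smul, freeProp_diracSymbol, smul_add]
  module

/-- The source `e^{isD} i D⁻¹ Z(s)` of the interaction picture, where `D⁻¹ = ω⁻² D`. -/
noncomputable def source (m : ℝ) (α : Fin 3 → Matrix (Fin 4) (Fin 4) ℂ)
    (β : Matrix (Fin 4) (Fin 4) ℂ) (Z : ℝ → Spinor) (s : ℝ) (ξ : Space) : Spinor :=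
  freeProp m α β (-s) ξ (Complex.I • diracSymbol m α β ξ (((1 / omega m ξ ^ 2 : ℝ) : ℂ) • Z s))

theorem continuous_source (hm : 0 < m) {Z : ℝ → Spinor} (hZ : Continuous Z) :
    Continuous fun p : ℝ × Space => source m α β Z p.1 p.2 := by
  have h0 : Continuous fun ξ : Space => 1 / omega m ξ ^ 2 :=
    continuous_const.div ((continuous_omega m).pow 2) fun ξ => (pow_pos (omega_pos hm ξ) 2).ne'
  have h1 : Continuous fun p : ℝ × Space => 1 / omega m p.2 ^ 2 := h0.comp continuous_snd
  have h2' : Continuous fun p : ℝ × Space => ((-p.1, p.2) : ℝ × Space) :=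
    continuous_fst.neg.prodMk continuous_snd
  have h2 := (continuous_freeProp (α := α) (β := β) hm).comp' h2'
  have h3 : Continuous fun p : ℝ × Space => diracSymbol m α β p.2 :=
    continuous_diracSymbol.comp continuous_snd
  have h4 : Continuous fun p : ℝ × Space => ((1 / omega m p.2 ^ 2 : ℝ) : ℂ) • Z p.1 :=
    (Complex.continuous_ofReal.comp h1).smul (hZ.comp continuous_fst)
  have h5 : Continuous fun p : ℝ × Space => Complex.I •
      diracSymbol m α β p.2 (((1 / omega m p.2 ^ 2 : ℝ) : ℂ) • Z p.1) :=
    (isBoundedBilinearMap_apply.continuous.comp (h3.prodMk h4)).const_smul Complex.I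
  exact isBoundedBilinearMap_apply.continuous.comp (h2.prodMk h5)

theorem continuous_integral_source (hm : 0 < m) {Z : ℝ → Spinor} (hZ : Continuous Z) (t : ℝ) :
    Continuous fun ξ => ∫ s in (0 : ℝ)..t, source m α β Z s ξ := by
  have hc := (continuous_source (α := α) (β := β) hm hZ).comp' (continuous_swap (X := Space)
    (Y := ℝ))
  exact intervalIntegral.continuous_parametric_intervalIntegral_of_continuous' hc 0 t

theorem memLp_freeProp (hm : 0 < m) (hαβ : IsDiracMatrices α β) (t : ℝ) {v : Space → Spinor}
    (hv : MemLp v 2) : MemLp (fun ξ => freeProp m α β t ξ (v ξ)) 2 :=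
  hv.of_le_mul (aestronglyMeasurable_freeProp hm t hv.1)
    (Eventually.of_forall fun ξ => norm_freeProp_le hm hαβ t ξ (v ξ))

/-- **Duhamel's formula.** An `L²`-continuous weak solution of `∂ₜ Y = -i D (Y - ω⁻² Z)` is given,
for almost every frequency, by the solution of the ordinary differential equation. -/
theorem duhamel (hm : 0 < m) (hαβ : IsDiracMatrices α β) {τ : ℝ} {Y u : ℝ → L2} {Z : ℝ → Spinor}
    (hYc : ContinuousOn Y (Set.Icc 0 τ)) (hZ : Continuous Z)
    (hY : ∀ t ∈ Set.Ioo 0 τ, ∀ χ : 𝓢(Space, ℂ), HasDerivAt (fun s => ∫ ξ, χ ξ • Y s ξ)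
      (-Complex.I • ∫ ξ, χ ξ • diracSymbol m α β ξ (u t ξ)) t)
    (hu : ∀ t ∈ Set.Ioo 0 τ, Y t = u t + greenHat hm (Z t)) {t : ℝ} (ht : t ∈ Set.Icc 0 τ) :
    ∀ᵐ ξ, Y t ξ = freeProp m α β t ξ (Y 0 ξ + ∫ s in (0 : ℝ)..t, source m α β Z s ξ) := by
  have h0 : (0 : ℝ) ∈ Set.Icc 0 τ := ⟨le_rfl, ht.1.trans ht.2⟩
  have hsub : Set.Icc 0 t ⊆ Set.Icc 0 τ := Set.Icc_subset_Icc_right ht.2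
  suffices h : ∀ᵐ ξ, freeProp m α β (-t) ξ (Y t ξ) =
      Y 0 ξ + ∫ s in (0 : ℝ)..t, source m α β Z s ξ by
    filter_upwards [h] with ξ hξ
    rw [← hξ, freeProp_freeProp_neg hm hαβ, sub_self, freeProp_zero]
    rfl
  refine ae_eq_of_integral_contDiff_smul_eq
    ((memLp_freeProp hm hαβ (-t) (Lp.memLp (Y t))).locallyIntegrable one_le_two)
    (((Lp.memLp (Y 0)).locallyIntegrable one_le_two).add
      (continuous_integral_source hm hZ t).locallyIntegrable) fun g hg hgc => ?_
  obtain ⟨K, hK0, hK⟩ := norm_integral_freeProp_sub_le hm hαβ hg.continuous hgc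
  -- in the interaction picture, the pairing with a test function has the source as its derivative
  set B : ℝ → Spinor := fun s => ∫ ξ, g ξ • freeProp m α β (-s) ξ (Y s ξ) with hB
  have hBc : ContinuousOn B (Set.Icc 0 t) := by
    intro s hs
    have hYs : ContinuousWithinAt Y (Set.Icc 0 t) s := (hYc s (hsub hs)).mono hsub
    have h1 : Tendsto (fun r => ∫ ξ, g ξ • freeProp m α β (-s) ξ (Y r ξ)) (𝓝[Set.Icc 0 t] s)
        (𝓝 (B s)) :=
      ((continuous_integral_freeProp hm hg hgc s).tendsto (Y s)).comp hYs
    have h2 : Tendsto (fun r => B r - ∫ ξ, g ξ • freeProp m α β (-s) ξ (Y r ξ))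
        (𝓝[Set.Icc 0 t] s) (𝓝 0) := by
      have h3 : Tendsto (fun r => K * |(-r) - (-s)| * ‖Y r‖) (𝓝[Set.Icc 0 t] s)
          (𝓝 (K * |(-s) - (-s)| * ‖Y s‖)) :=
        Tendsto.mul (((by fun_prop : Continuous fun r : ℝ => K * |(-r) - (-s)|).tendsto s).mono_left
          nhdsWithin_le_nhds) hYs.norm
      rw [sub_self, abs_zero, mul_zero, zero_mul] at h3
      exact squeeze_zero_norm (fun r => hK _ _ _) h3
    have h4 := h2.add h1
    simpa [ContinuousWithinAt] using h4
  have hBd : ∀ s ∈ Set.Ioo 0 t, HasDerivAt B (∫ ξ, g ξ • source m α β Z s ξ) s := by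
    intro s hs
    have hs' : s ∈ Set.Ioo 0 τ := ⟨hs.1, hs.2.trans_le ht.2⟩
    exact hasDerivAt_integral_freeProp_moving hm hαβ hg hgc
      (hYc.continuousAt (Icc_mem_nhds hs'.1 hs'.2)) (hY s hs') (hu s hs')
  have hF : Integrable (Function.uncurry fun s ξ => g ξ • source m α β Z s ξ)
      ((volume.restrict (Set.uIoc 0 t)).prod volume) := by
    have hc : Continuous (Function.uncurry fun s ξ => g ξ • source m α β Z s ξ) :=
      (hg.continuous.comp continuous_snd).smul (continuous_source hm hZ)
    have h1 : IntegrableOn (Function.uncurry fun s ξ => g ξ • source m α β Z s ξ)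
        (Set.uIcc 0 t ×ˢ tsupport g) (volume.prod volume) :=
      hc.continuousOn.integrableOn_compact (isCompact_uIcc.prod hgc)
    have h2 : IntegrableOn (Function.uncurry fun s ξ => g ξ • source m α β Z s ξ)
        (Set.uIcc 0 t ×ˢ Set.univ) (volume.prod volume) := by
      refine h1.of_forall_sdiff_eq_zero (measurableSet_uIcc.prod MeasurableSet.univ) fun p hp => ?_
      have : p.2 ∉ tsupport g := fun h => hp.2 ⟨hp.1.1, h⟩
      simp [Function.uncurry, image_eq_zero_of_notMem_tsupport this]
    have h3 : (volume.restrict (Set.uIoc 0 t)).prod (volume : Measure Space) =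
        (volume.prod volume).restrict (Set.uIoc 0 t ×ˢ Set.univ) := by
      rw [← Measure.prod_restrict, Measure.restrict_univ]
    rw [h3]
    exact h2.mono_set (Set.prod_mono Set.uIoc_subset_uIcc le_rfl)
  have hFTC := intervalIntegral.integral_eq_sub_of_hasDerivAt_of_le ht.1 hBc hBd
    (by
      rw [intervalIntegrable_iff]
      exact hF.integral_prod_left)
  rw [intervalIntegral_integral_swap hF] at hFTC
  have hB0 : B 0 = ∫ ξ, g ξ • Y 0 ξ := by
    simp only [hB, neg_zero, freeProp_zero]
    rfl
  have hi0 := integrable_compactSupport_smul hg.continuous hgc (Lp.memLp (Y 0))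
  have hi1 : Integrable fun ξ => g ξ • ∫ s in (0 : ℝ)..t, source m α β Z s ξ := by
    refine (hg.continuous.smul
      (continuous_integral_source hm hZ t)).integrable_of_hasCompactSupport ?_
    exact hgc.smul_right
  simp_rw [smul_add]
  rw [integral_add hi0 hi1, ← hB0]
  simp_rw [intervalIntegral.integral_smul] at hFTC
  rw [hFTC]
  simp [hB]

/-! ### Laplace transforms and approximate identities -/

theorem integrableOn_mul_exp_neg {l : ℝ} (hl : 0 < l) :
    IntegrableOn (fun w : ℝ => w * Real.exp (-l * w)) (Set.Ioi 0) := by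
  have h := integrableOn_rpow_mul_exp_neg_mul_rpow (s := 1) (p := 1) (by norm_num) zero_lt_one hl
  simpa only [Real.rpow_one] using h

theorem integrableOn_exp_neg {l : ℝ} (hl : 0 < l) (a : ℝ) :
    IntegrableOn (fun w : ℝ => Real.exp (-l * w)) (Set.Ioi a) := exp_neg_integrableOn_Ioi a hl

theorem tendsto_mul_exp_neg {l : ℝ} (hl : 0 < l) :
    Tendsto (fun w : ℝ => w * Real.exp (-l * w)) atTop (𝓝 0) := by
  have h := tendsto_rpow_mul_exp_neg_mul_atTop_nhds_zero 1 l hl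
  simpa only [Real.rpow_one] using h

theorem tendsto_exp_neg_mul {l : ℝ} (hl : 0 < l) :
    Tendsto (fun w : ℝ => Real.exp (-l * w)) atTop (𝓝 0) := by
  have h := tendsto_rpow_mul_exp_neg_mul_atTop_nhds_zero 0 l hl
  simpa only [Real.rpow_zero, one_mul] using h

theorem norm_cexp_neg (l r w : ℝ) :
    ‖Complex.exp (-((l : ℂ) - Complex.I * r) * w)‖ = Real.exp (-l * w) := by
  rw [Complex.norm_exp]; simp

theorem cexp_neg_re (l r w : ℝ) : (Complex.exp (-((l : ℂ) - Complex.I * r) * w)).re =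
    Real.exp (-l * w) * Real.cos (w * r) := by
  rw [Complex.exp_re]; simp [mul_comm]

theorem cexp_neg_im (l r w : ℝ) : (Complex.exp (-((l : ℂ) - Complex.I * r) * w)).im =
    Real.exp (-l * w) * Real.sin (w * r) := by
  rw [Complex.exp_im]; simp [mul_comm]

theorem sub_I_mul_ne_zero {l : ℝ} (hl : 0 < l) (r : ℝ) : (l : ℂ) - Complex.I * r ≠ 0 := by
  intro h
  have := congrArg Complex.re h
  simp at this
  exact hl.ne' this

theorem hasDerivAt_cexp_neg (a : ℂ) (w : ℝ) :
    HasDerivAt (fun w : ℝ => Complex.exp (-a * w)) (-a * Complex.exp (-a * w)) w := by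
  have h1 : HasDerivAt (fun w : ℝ => -a * (w : ℂ)) (-a) w := by
    simpa using (Complex.ofRealCLM.hasDerivAt (x := w)).const_mul (-a)
  simpa [mul_comm] using h1.cexp

theorem integral_exp_neg_mul_cos {l : ℝ} (hl : 0 < l) (r : ℝ) :
    ∫ w in Set.Ioi (0 : ℝ), Real.exp (-l * w) * Real.cos (w * r) = l / (l ^ 2 + r ^ 2) := by
  set a : ℂ := (l : ℂ) - Complex.I * r with ha
  have ha0 : a ≠ 0 := sub_I_mul_ne_zero hl r
  have hi : IntegrableOn (fun w : ℝ => Complex.exp (-a * w)) (Set.Ioi 0) := by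
    refine (integrableOn_exp_neg hl 0).mono' (by fun_prop) (Eventually.of_forall fun w => ?_)
    rw [ha, norm_cexp_neg]
  have h := integral_Ioi_of_hasDerivAt_of_tendsto (a := (0 : ℝ)) (m := 0)
    (f := fun w : ℝ => -a⁻¹ * Complex.exp (-a * w)) (f' := fun w : ℝ => Complex.exp (-a * w))
    (by fun_prop)
    (fun w _ => ((hasDerivAt_cexp_neg a w).const_mul (-a⁻¹)).congr_deriv (by field_simp)) hi
    (by
      rw [tendsto_zero_iff_norm_tendsto_zero]
      simp only [norm_mul, ha, norm_cexp_neg]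
      simpa using (tendsto_exp_neg_mul hl).const_mul ‖-((l : ℂ) - Complex.I * r)⁻¹‖)
  have h' := congrArg Complex.re h
  rw [← RCLike.re_eq_complex_re, ← integral_re hi] at h'
  simp only [RCLike.re_eq_complex_re, ha, cexp_neg_re] at h'
  rw [h']
  simp [Complex.inv_re, Complex.normSq_apply]
  ring

theorem integral_exp_neg_mul_sin {l : ℝ} (hl : 0 < l) (r : ℝ) :
    ∫ w in Set.Ioi (0 : ℝ), Real.exp (-l * w) * (w * Real.sin (w * r)) =
      2 * l * r / (l ^ 2 + r ^ 2) ^ 2 := by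
  set a : ℂ := (l : ℂ) - Complex.I * r with ha
  have ha0 : a ≠ 0 := sub_I_mul_ne_zero hl r
  have hi : IntegrableOn (fun w : ℝ => w * Complex.exp (-a * w)) (Set.Ioi 0) := by
    refine (integrableOn_mul_exp_neg hl).mono' (by fun_prop) ?_
    filter_upwards [self_mem_ae_restrict measurableSet_Ioi] with w hw
    rw [norm_mul, ha, norm_cexp_neg, Complex.norm_real, Real.norm_of_nonneg (le_of_lt hw)]
  have h := integral_Ioi_of_hasDerivAt_of_tendsto (a := (0 : ℝ)) (m := 0)
    (f := fun w : ℝ => -(a⁻¹ * w + (a⁻¹) ^ 2) * Complex.exp (-a * w))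
    (f' := fun w : ℝ => w * Complex.exp (-a * w))
    (by fun_prop)
    (fun w _ => by
      have h1 : HasDerivAt (fun w : ℝ => -(a⁻¹ * (w : ℂ) + (a⁻¹) ^ 2)) (-a⁻¹) w := by
        simpa using
          (((Complex.ofRealCLM.hasDerivAt (x := w)).const_mul a⁻¹).add_const ((a⁻¹) ^ 2)).fun_neg
      refine (h1.mul (hasDerivAt_cexp_neg a w)).congr_deriv ?_
      field_simp
      ring) hi
    (by
      refine squeeze_zero_norm' (a := fun w => ‖a⁻¹‖ * (w * Real.exp (-l * w))
        + ‖a⁻¹‖ ^ 2 * Real.exp (-l * w)) ?_ ?_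
      · filter_upwards [eventually_ge_atTop 0] with w hw
        rw [norm_mul, norm_neg]
        have e : ‖Complex.exp (-a * w)‖ = Real.exp (-l * w) := norm_cexp_neg l r w
        rw [e]
        calc _ ≤ (‖a⁻¹ * (w : ℂ)‖ + ‖a⁻¹ ^ 2‖) * Real.exp (-l * w) := by
              gcongr; exact norm_add_le _ _
          _ = _ := by
              rw [norm_mul, norm_pow, Complex.norm_real, Real.norm_of_nonneg hw]; ring
      · have h3 := ((tendsto_mul_exp_neg hl).const_mul ‖a⁻¹‖).add
          ((tendsto_exp_neg_mul hl).const_mul (‖a⁻¹‖ ^ 2))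
        rwa [mul_zero, mul_zero, add_zero] at h3)
  have h' := congrArg Complex.im h
  rw [← RCLike.im_eq_complex_im, ← integral_im hi] at h'
  simp only [RCLike.im_eq_complex_im, Complex.im_ofReal_mul, ha,
    cexp_neg_im] at h'
  simp_rw [mul_left_comm]
  rw [h', ← sub_eq_zero]
  have hn : l ^ 2 + r ^ 2 ≠ 0 := by positivity
  simp [Complex.inv_re, Complex.inv_im, Complex.normSq_apply, pow_two]
  field_simp
  ring

/-- Integrating against the rescaled kernels `λ⁻¹ κ(r / λ)`, `λ → 0+`, picks the limit of the
integrand at `0+`. -/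
theorem tendsto_integral_kernel {E : Type*} [NormedAddCommGroup E] [NormedSpace ℝ E]
    [CompleteSpace E]
    {κ : ℝ → ℝ} (hκ : IntegrableOn κ (Set.Ioi 0)) {k : ℝ → E} {k₀ : E} {K t : ℝ} (ht : 0 < t)
    (hk : AEStronglyMeasurable k (volume.restrict (Set.Ioc 0 t))) (hkK : ∀ r ∈ Set.Ioc 0 t,
      ‖k r‖ ≤ K)
    (hk₀ : Tendsto k (𝓝[>] 0) (𝓝 k₀)) :
    Tendsto (fun l : ℝ => ∫ r in (0 : ℝ)..t, (l⁻¹ * κ (r / l)) • k r) (𝓝[>] 0)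
      (𝓝 ((∫ x in Set.Ioi 0, κ x) • k₀)) := by
  set k' : ℝ → E := Set.indicator (Set.Ioc 0 t) k with hk'
  have hK0 : 0 ≤ K := (norm_nonneg _).trans (hkK t ⟨ht, le_rfl⟩)
  have hk'm : AEStronglyMeasurable k' volume :=
    (aestronglyMeasurable_indicator_iff measurableSet_Ioc).2 hk
  have hk'K : ∀ r, ‖k' r‖ ≤ K := fun r => by
    by_cases h : r ∈ Set.Ioc 0 t
    · simpa [hk', h] using hkK r h
    · simpa [hk', h] using hK0
  have hk'0 : Tendsto k' (𝓝[>] 0) (𝓝 k₀) := by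
    refine hk₀.congr' ?_
    filter_upwards [Ioc_mem_nhdsGT ht] with r hr
    simp [hk', hr]
  have key : ∀ l : ℝ, 0 < l → ∫ x in Set.Ioi (0 : ℝ), κ x • k' (l * x) =
      ∫ r in (0 : ℝ)..t, (l⁻¹ * κ (r / l)) • k r := by
    intro l hl
    have h := integral_comp_mul_left_Ioi (fun r => (l⁻¹ * κ (r / l)) • k' r) 0 hl
    have h2 : ∫ r in (0 : ℝ)..t, (l⁻¹ * κ (r / l)) • k r =
        ∫ r in Set.Ioi (0 : ℝ), (l⁻¹ * κ (r / l)) • k' r := by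
      rw [intervalIntegral.integral_of_le ht.le, ← integral_indicator measurableSet_Ioc,
        ← integral_indicator measurableSet_Ioi]
      congr 1 with r
      by_cases h : r ∈ Set.Ioc 0 t
      · simp [hk', h, h.1]
      · simp [hk', h, Set.indicator]
    rw [h2, mul_zero] at *
    rw [← smul_right_injective E (inv_ne_zero hl.ne') |>.eq_iff]
    rw [← h, ← integral_smul]
    refine setIntegral_congr_fun measurableSet_Ioi fun x _ => ?_
    rw [mul_div_cancel_left₀ _ hl.ne', smul_smul]
  have hev : (fun l : ℝ => ∫ x in Set.Ioi (0 : ℝ), κ x • k' (l * x)) =ᶠ[𝓝[>] 0]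
      fun l : ℝ => ∫ r in (0 : ℝ)..t, (l⁻¹ * κ (r / l)) • k r := by
    filter_upwards [self_mem_nhdsWithin] with l hl using key l hl
  refine Tendsto.congr' hev ?_
  rw [← integral_smul_const]
  refine tendsto_integral_filter_of_dominated_convergence (fun x => |κ x| * K) ?_ ?_
    (hκ.abs.mul_const K) ?_
  · filter_upwards [self_mem_nhdsWithin] with l hl
    refine hκ.1.smul (AEStronglyMeasurable.restrict ?_)
    exact hk'm.comp_quasiMeasurePreserving
      (Measure.quasiMeasurePreserving_smul (volume : Measure ℝ) (ne_of_gt hl))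
  · refine Eventually.of_forall fun l => Eventually.of_forall fun x => ?_
    rw [norm_smul, Real.norm_eq_abs]
    gcongr
    exact hk'K _
  · filter_upwards [self_mem_ae_restrict measurableSet_Ioi] with x hx
    refine Tendsto.const_smul (hk'0.comp ?_) _
    refine tendsto_nhdsWithin_iff.2 ⟨?_, ?_⟩
    · have : Tendsto (fun l : ℝ => l * x) (𝓝 0) (𝓝 (0 * x)) := by
        exact (continuous_id.mul continuous_const).tendsto 0
      rw [zero_mul] at this
      exact this.mono_left nhdsWithin_le_nhds
    · filter_upwards [self_mem_nhdsWithin] with l hl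
      exact mul_pos (Set.mem_Ioi.1 hl) (Set.mem_Ioi.1 hx)

theorem integrableOn_kernel_sq : IntegrableOn (fun x : ℝ => 2 * x ^ 2 / (1 + x ^ 2) ^ 2)
    (Set.Ioi 0) := by
  refine (integrable_inv_one_add_sq.const_mul 2).integrableOn.mono' (Measurable.aestronglyMeasurable
    (by fun_prop))
    (Eventually.of_forall fun x => ?_)
  rw [Real.norm_of_nonneg (by positivity), div_le_iff₀ (by positivity)]
  have : 2 * (1 + x ^ 2)⁻¹ * (1 + x ^ 2) ^ 2 = 2 * (1 + x ^ 2) := by field_simp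
  rw [this]; linarith

theorem integral_kernel_sq : ∫ x in Set.Ioi (0 : ℝ), 2 * x ^ 2 / (1 + x ^ 2) ^ 2 = Real.pi / 2 := by
  have h := integral_Ioi_of_hasDerivAt_of_tendsto (a := (0 : ℝ)) (m := Real.pi / 2)
    (f := fun x : ℝ => Real.arctan x - x / (1 + x ^ 2))
    (f' := fun x : ℝ => 2 * x ^ 2 / (1 + x ^ 2) ^ 2) ?_ ?_ integrableOn_kernel_sq ?_
  · simpa using h
  · have : Continuous fun x : ℝ => Real.arctan x - x / (1 + x ^ 2) :=
      Real.continuous_arctan.sub (continuous_id.div (by fun_prop) fun x => by positivity)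
    exact this.continuousWithinAt
  · intro x _
    have h1 : HasDerivAt (fun x : ℝ => 1 + x ^ 2) (2 * x) x := by
      simpa using (hasDerivAt_pow 2 x).const_add 1
    have h2 : (1 + x ^ 2) ≠ 0 := by positivity
    refine ((Real.hasDerivAt_arctan x).sub ((hasDerivAt_id x).div h1 h2)).congr_deriv ?_
    simp only [id]
    field_simp
    ring
  · have h1 : Tendsto (fun x : ℝ => x / (1 + x ^ 2)) atTop (𝓝 0) := by
      refine squeeze_zero' (g := fun x : ℝ => x⁻¹) ?_ ?_ tendsto_inv_atTop_zero
      · filter_upwards [eventually_ge_atTop 0] with x hx using by positivity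
      · filter_upwards [eventually_gt_atTop 0] with x hx
        rw [div_le_iff₀ (by positivity)]
        field_simp
        nlinarith
    simpa using (Real.tendsto_arctan_atTop.mono_right nhdsWithin_le_nhds).sub h1

/-! ### Comparison of two regularizations -/

/-- The Laplace representation `Γ(s) ∫ ω⁻ˢ h = ∫₀^∞ λ^{s-1} (∫ e^{-λω} h) dλ`. -/
theorem integral_rpow_omega_mul (hm : 0 < m) {h : Space → ℝ} {s : ℝ} (hs : 0 < s)
    (hi : Integrable fun ξ => omega m ξ ^ (-s) * h ξ) :
    IntegrableOn (fun l : ℝ => l ^ (s - 1) * ∫ ξ, Real.exp (-l * omega m ξ) * h ξ) (Set.Ioi 0) ∧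
      ∫ l in Set.Ioi (0 : ℝ), l ^ (s - 1) * ∫ ξ, Real.exp (-l * omega m ξ) * h ξ =
        Real.Gamma s * ∫ ξ, omega m ξ ^ (-s) * h ξ := by
  have hω := omega_pos hm
  have hhm : AEStronglyMeasurable h := by
    have h1 : AEStronglyMeasurable (fun ξ => omega m ξ ^ s * (omega m ξ ^ (-s) * h ξ)) :=
      ((measurable_omega m).pow_const s).aestronglyMeasurable.mul hi.1
    refine h1.congr (Eventually.of_forall fun ξ => ?_)
    simp only
    rw [← mul_assoc, ← Real.rpow_add (hω ξ), add_neg_cancel, Real.rpow_zero, one_mul]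
  have hg : ∀ ξ, ∫ l in Set.Ioi (0 : ℝ), l ^ (s - 1) * Real.exp (-l * omega m ξ) =
      Real.Gamma s * omega m ξ ^ (-s) := fun ξ => by
    have := Real.integral_rpow_mul_exp_neg_mul_Ioi hs (hω ξ)
    rw [one_div, Real.inv_rpow (hω ξ).le, ← Real.rpow_neg (hω ξ).le] at this
    rw [mul_comm (Real.Gamma s), ← this]
    simp only [neg_mul, mul_comm (omega m ξ)]
  have hgi : ∀ ξ, IntegrableOn (fun l : ℝ => l ^ (s - 1) * Real.exp (-l * omega m ξ))
      (Set.Ioi 0) := fun ξ => by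
    have := integrableOn_rpow_mul_exp_neg_mul_rpow (s := s - 1) (p := 1) (by linarith) zero_lt_one
      (hω ξ)
    simpa only [Real.rpow_one, neg_mul, mul_comm (omega m ξ)] using this
  have hF : Integrable (Function.uncurry fun (l : ℝ) (ξ : Space) =>
      l ^ (s - 1) * (Real.exp (-l * omega m ξ) * h ξ))
      ((volume.restrict (Set.Ioi 0)).prod volume) := by
    refine (integrable_prod_iff' ?_).2 ⟨Eventually.of_forall fun ξ => ?_, ?_⟩
    · have h1 : Measurable fun p : ℝ × Space => p.1 ^ (s - 1) :=
        measurable_fst.pow_const _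
      have h2 : Measurable fun p : ℝ × Space => Real.exp (-p.1 * omega m p.2) :=
        (measurable_fst.neg.mul ((measurable_omega m).comp measurable_snd)).exp
      exact h1.aestronglyMeasurable.mul (h2.aestronglyMeasurable.mul hhm.comp_snd)
    · simp only [Function.uncurry]
      simp_rw [← mul_assoc]
      exact (hgi ξ).mul_const (h ξ)
    · have e : ∀ ξ, ∫ l in Set.Ioi (0 : ℝ), ‖Function.uncurry (fun (l : ℝ) (ξ : Space) =>
          l ^ (s - 1) * (Real.exp (-l * omega m ξ) * h ξ)) (l, ξ)‖ =
          Real.Gamma s * ‖omega m ξ ^ (-s) * h ξ‖ := fun ξ => by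
        rw [norm_mul, ← mul_assoc, Real.norm_of_nonneg (Real.rpow_nonneg (hω ξ).le _), ← hg,
          ← integral_mul_const]
        refine setIntegral_congr_fun measurableSet_Ioi fun l hl => ?_
        simp only [Function.uncurry, norm_mul]
        rw [Real.norm_of_nonneg (Real.rpow_nonneg (le_of_lt hl) _),
          Real.norm_of_nonneg (Real.exp_pos _).le, mul_assoc]
      simp_rw [e]
      exact hi.norm.const_mul _
  have h1 := hF.integral_prod_left
  simp only [Function.uncurry] at h1
  simp_rw [integral_const_mul] at h1
  refine ⟨h1, ?_⟩
  simp_rw [← integral_const_mul]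
  rw [integral_integral_swap hF]
  congr 1 with ξ
  simp_rw [← mul_assoc]
  rw [integral_mul_const, hg]

/-- An upper bound for the means `∫ e^{-λω} h`, `λ → 0+`, is inherited by the limit of
`∫ ω^{-2ε} h`, `ε → 0+`. -/
theorem le_of_tendsto_integral_rpow_omega (hm : 0 < m) {h : Space → ℝ}
    (hi : ∀ ε : ℝ, 0 < ε → Integrable fun ξ => omega m ξ ^ (-2 * ε) * h ξ) {A δ L : ℝ} (hδ : 0 < δ)
    (hp : ∀ l ∈ Set.Ioc 0 δ, ∫ ξ, Real.exp (-l * omega m ξ) * h ξ ≤ A)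
    (hL : Tendsto (fun ε : ℝ => ∫ ξ, omega m ξ ^ (-2 * ε) * h ξ) (𝓝[>] 0) (𝓝 L)) : L ≤ A := by
  set p : ℝ → ℝ := fun l => ∫ ξ, Real.exp (-l * omega m ξ) * h ξ with hpdef
  have hrep : ∀ ε : ℝ, 0 < ε → IntegrableOn (fun l : ℝ => l ^ (2 * ε - 1) * p l) (Set.Ioi 0) ∧
      ∫ l in Set.Ioi (0 : ℝ), l ^ (2 * ε - 1) * p l =
        Real.Gamma (2 * ε) * ∫ ξ, omega m ξ ^ (-2 * ε) * h ξ := fun ε hε => by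
    have := integral_rpow_omega_mul hm (h := h) (s := 2 * ε) (by positivity)
      (by simpa only [neg_mul] using hi ε hε)
    rwa [← neg_mul] at this
  have hp1 : IntegrableOn p (Set.Ioi 0) := by
    have := (hrep (1 / 2) (by norm_num)).1
    norm_num at this
    exact this
  set M : ℝ := ∫ l in Set.Ioi δ, |p l| with hM
  have hbound : ∀ ε : ℝ, 0 < ε → ε ≤ 1 / 2 → Real.Gamma (2 * ε + 1) *
      ∫ ξ, omega m ξ ^ (-2 * ε) * h ξ ≤ A * δ ^ (2 * ε) + 2 * ε * (δ ^ (2 * ε - 1) * M) := by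
    intro ε hε hε'
    obtain ⟨hI, hE⟩ := hrep ε hε
    have hs : 0 < 2 * ε := by positivity
    rw [Real.Gamma_add_one hs.ne', mul_assoc, ← hE]
    have hsplit : ∫ l in Set.Ioi (0 : ℝ), l ^ (2 * ε - 1) * p l =
        (∫ l in Set.Ioc 0 δ, l ^ (2 * ε - 1) * p l) + ∫ l in Set.Ioi δ, l ^ (2 * ε - 1) * p l := by
      rw [← Set.Ioc_union_Ioi_eq_Ioi hδ.le]
      exact setIntegral_union Set.Ioc_disjoint_Ioi_same measurableSet_Ioi
        (hI.mono_set Set.Ioc_subset_Ioi_self) (hI.mono_set (Set.Ioi_subset_Ioi hδ.le))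
    have hr : IntegrableOn (fun l : ℝ => l ^ (2 * ε - 1)) (Set.Ioc 0 δ) := by
      have := intervalIntegral.intervalIntegrable_rpow' (a := 0) (b := δ) (r := 2 * ε - 1)
        (by linarith)
      exact (intervalIntegrable_iff_integrableOn_Ioc_of_le hδ.le).1 this
    have h1 : ∫ l in Set.Ioc 0 δ, l ^ (2 * ε - 1) * p l ≤ A * (δ ^ (2 * ε) / (2 * ε)) := by
      calc _ ≤ ∫ l in Set.Ioc 0 δ, l ^ (2 * ε - 1) * A := by
            refine setIntegral_mono_on (hI.mono_set Set.Ioc_subset_Ioi_self) (hr.mul_const A)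
              measurableSet_Ioc fun l hl => ?_
            exact mul_le_mul_of_nonneg_left (hp l hl) (Real.rpow_nonneg hl.1.le _)
        _ = _ := by
            rw [integral_mul_const, ← intervalIntegral.integral_of_le hδ.le,
              integral_rpow (Or.inl (by linarith)), sub_add_cancel, Real.zero_rpow hs.ne', sub_zero,
              mul_comm]
    have h2 : ∫ l in Set.Ioi δ, l ^ (2 * ε - 1) * p l ≤ δ ^ (2 * ε - 1) * M := by
      rw [hM, ← integral_const_mul]
      refine setIntegral_mono_on (hI.mono_set (Set.Ioi_subset_Ioi hδ.le))
        ((hp1.mono_set (Set.Ioi_subset_Ioi hδ.le)).abs.const_mul _) measurableSet_Ioi fun l hl => ?_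
      have hl0 : 0 < l := hδ.trans hl
      calc l ^ (2 * ε - 1) * p l ≤ l ^ (2 * ε - 1) * |p l| :=
            mul_le_mul_of_nonneg_left (le_abs_self _) (Real.rpow_nonneg hl0.le _)
        _ ≤ _ := mul_le_mul_of_nonneg_right
            (Real.rpow_le_rpow_of_nonpos hδ (le_of_lt hl) (by linarith)) (abs_nonneg _)
    rw [hsplit]
    calc _ ≤ 2 * ε * (A * (δ ^ (2 * ε) / (2 * ε)) + δ ^ (2 * ε - 1) * M) := by gcongr
      _ = _ := by field_simp
  have hε2 : Tendsto (fun ε : ℝ => 2 * ε) (𝓝[>] 0) (𝓝 0) := by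
    have : Tendsto (fun ε : ℝ => 2 * ε) (𝓝 0) (𝓝 (2 * 0)) :=
      (continuous_const.mul continuous_id).tendsto 0
    rw [mul_zero] at this
    exact this.mono_left nhdsWithin_le_nhds
  have hl : Tendsto (fun ε : ℝ => Real.Gamma (2 * ε + 1) * ∫ ξ, omega m ξ ^ (-2 * ε) * h ξ) (𝓝[>] 0)
      (𝓝 (1 * L)) := by
    refine Tendsto.mul ?_ hL
    have h1 : ContinuousAt Real.Gamma (0 + 1) :=
      (Real.differentiableAt_Gamma fun n => by
        have : (0 : ℝ) ≤ n := n.cast_nonneg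
        linarith).continuousAt
    have h2 := h1.tendsto.comp (hε2.add_const 1)
    simpa [Real.Gamma_one, Function.comp_def] using h2
  have hr : Tendsto (fun ε : ℝ => A * δ ^ (2 * ε) + 2 * ε * (δ ^ (2 * ε - 1) * M)) (𝓝[>] 0)
      (𝓝 (A * δ ^ (0 : ℝ) + 0 * (δ ^ ((0 : ℝ) - 1) * M))) := by
    have hc : Continuous fun x : ℝ => δ ^ x := Real.continuous_const_rpow hδ.ne'
    refine (((hc.tendsto 0).comp hε2).const_mul A).add (hε2.mul (Tendsto.mul_const M ?_))
    exact (hc.tendsto _).comp (hε2.sub_const 1)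
  rw [one_mul] at hl
  rw [Real.rpow_zero, mul_one, zero_mul, add_zero] at hr
  refine le_of_tendsto_of_tendsto hl hr ?_
  filter_upwards [Ioc_mem_nhdsGT (show (0 : ℝ) < 1 / 2 by norm_num)] with ε hε
  exact hbound ε hε.1 hε.2

/-! ### The frequency weight -/

/-- The weight `W(ξ) = ω(ξ) / 2π|ξ|`, which turns `d³ξ / ω²` into a multiple of `dω`. -/
noncomputable def weight (m : ℝ) (ξ : Space) : ℝ := omega m ξ / (2 * Real.pi * ‖ξ‖)

/-- The constant `C` of the change of variables `W d³ξ / ω² = C dω`. -/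
noncomputable def shellConst : ℝ :=
  3 * volume.real (Metric.ball (0 : Space) 1) / (2 * Real.pi) ^ 3

theorem shellConst_pos : 0 < shellConst := by
  have h : 0 < volume.real (Metric.ball (0 : Space) 1) := by
    rw [measureReal_def]
    exact ENNReal.toReal_pos (Metric.measure_ball_pos volume 0 one_pos).ne' measure_ball_lt_top.ne
  unfold shellConst
  positivity

theorem measurable_weight (m : ℝ) : Measurable (weight m) :=
  (measurable_omega m).div (measurable_norm.const_mul _)

theorem weight_neg (ξ : Space) : weight m (-ξ) = weight m ξ := by simp [weight, omega]

theorem omega_neg (ξ : Space) : omega m (-ξ) = omega m ξ := by simp [omega]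

theorem hasDerivAt_dispersion (hm : 0 < m) (y : ℝ) :
    HasDerivAt (fun y : ℝ => √((2 * Real.pi * y) ^ 2 + m ^ 2))
      ((2 * Real.pi) ^ 2 * y / √((2 * Real.pi * y) ^ 2 + m ^ 2)) y := by
  have h1 : HasDerivAt (fun y : ℝ => (2 * Real.pi * y) ^ 2 + m ^ 2) (2 *
    ((2 * Real.pi) ^ 2 * y)) y := by
    have h2 : HasDerivAt (fun y : ℝ => 2 * Real.pi * y) (2 * Real.pi) y := by
      simpa using (hasDerivAt_id y).const_mul (2 * Real.pi)
    refine ((h2.pow 2).add_const (m ^ 2)).congr_deriv ?_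
    push_cast
    ring
  refine (h1.sqrt (by positivity)).congr_deriv ?_
  field_simp

theorem image_dispersion (hm : 0 < m) :
    (fun y : ℝ => √((2 * Real.pi * y) ^ 2 + m ^ 2)) '' Set.Ioi 0 = Set.Ioi m := by
  ext w
  simp only [Set.mem_image, Set.mem_Ioi]
  constructor
  · rintro ⟨y, hy, rfl⟩
    refine Real.lt_sqrt_of_sq_lt ?_
    have : 0 < (2 * Real.pi * y) ^ 2 := by positivity
    linarith
  · intro hw
    have h1 : 0 < w ^ 2 - m ^ 2 := by nlinarith
    refine ⟨√(w ^ 2 - m ^ 2) / (2 * Real.pi), by positivity, ?_⟩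
    rw [mul_div_cancel₀ _ (by positivity), Real.sq_sqrt h1.le, sub_add_cancel,
      Real.sqrt_sq (hm.trans hw).le]

theorem injOn_dispersion :
    Set.InjOn (fun y : ℝ => √((2 * Real.pi * y) ^ 2 + m ^ 2)) (Set.Ioi 0) := by
  intro x hx y hy h
  simp only at h
  rw [Real.sqrt_inj (by positivity) (by positivity)] at h
  have h2 : (2 * Real.pi * x) ^ 2 = (2 * Real.pi * y) ^ 2 := by linarith
  have hx' : 0 < x := hx
  have hy' : 0 < y := hy
  have h3 := (pow_left_inj₀ (by positivity) (by positivity) two_ne_zero).1 h2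
  exact mul_left_cancel₀ (by positivity) h3

/-- Integration over frequency shells. -/
theorem integral_weight_smul (hm : 0 < m) (φ : ℝ → Spinor) :
    ∫ ξ, (weight m ξ / omega m ξ ^ 2) • φ (omega m ξ) =
      shellConst • ∫ w in Set.Ioi m, φ w := by
  have h1 := integral_fun_norm_addHaar (volume : Measure Space) (fun y : ℝ =>
    (√((2 * Real.pi * y) ^ 2 + m ^ 2) / (2 * Real.pi * y) / √((2 * Real.pi * y) ^ 2 + m ^ 2) ^ 2) •
      φ √((2 * Real.pi * y) ^ 2 + m ^ 2))
  have h2 := integral_image_eq_integral_abs_deriv_smul measurableSet_Ioi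
    (fun y _ => (hasDerivAt_dispersion hm y).hasDerivWithinAt) injOn_dispersion φ
  rw [image_dispersion hm] at h2
  change ∫ ξ : Space, (weight m ξ / omega m ξ ^ 2) • φ (omega m ξ) = _ at h1
  rw [h1, h2, finrank_space, ← Nat.cast_smul_eq_nsmul ℝ, smul_smul, ← integral_smul,
    ← integral_smul]
  refine setIntegral_congr_fun measurableSet_Ioi fun y hy => ?_
  have hy' : 0 < y := hy
  have hr : 0 < √((2 * Real.pi * y) ^ 2 + m ^ 2) := by positivity
  simp only [smul_smul]
  congr 1
  rw [abs_of_nonneg (by positivity), shellConst]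
  field_simp
  push_cast
  ring

theorem diracSymbol_neg_apply (ξ : Space) (v : Spinor) :
    diracSymbol m α β (-ξ) v = (2 * m : ℂ) • Matrix.toEuclideanCLM (n := Fin 4) (𝕜 := ℂ) β v
      - diracSymbol m α β ξ v := by
  simp only [diracSymbol, _root_.add_apply, _root_.sum_apply, _root_.smul_apply, PiLp.neg_apply,
    mul_neg, Complex.ofReal_neg, neg_smul, Finset.sum_neg_distrib]
  module

/-- Integration over frequency shells of a spinor field that contains the Dirac symbol: its odd
part does not contribute. -/
theorem integral_weight_smul_diracSymbol (hm : 0 < m) {A B : ℝ → Spinor}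
    (hi : Integrable fun ξ => (weight m ξ / omega m ξ ^ 2) •
      (A (omega m ξ) + Complex.I • diracSymbol m α β ξ (B (omega m ξ)))) :
    ∫ ξ, (weight m ξ / omega m ξ ^ 2) •
      (A (omega m ξ) + Complex.I • diracSymbol m α β ξ (B (omega m ξ))) =
    shellConst • ∫ w in Set.Ioi m,
      (A w + (Complex.I * m) • Matrix.toEuclideanCLM (n := Fin 4) (𝕜 := ℂ) β (B w)) := by
  rw [← integral_weight_smul hm]
  set Φ : Space → Spinor := fun ξ => (weight m ξ / omega m ξ ^ 2) •
      (A (omega m ξ) + Complex.I • diracSymbol m α β ξ (B (omega m ξ))) with hΦ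
  have h1 : ∫ ξ, Φ (-ξ) = ∫ ξ, Φ ξ := integral_neg_eq_self Φ volume
  have h2 := integral_add hi hi.comp_neg
  have h3 : (2 : ℝ) • ∫ ξ, Φ ξ = ∫ ξ, (Φ ξ + Φ (-ξ)) := by
    rw [two_smul, h2, h1]
  have h4 : ∀ v w : Spinor, (2 : ℝ) • v = (2 : ℝ) • w → v = w := fun v w h =>
    smul_right_injective Spinor (two_ne_zero (α := ℝ)) h
  apply h4
  rw [h3, ← integral_smul]
  congr 1
  funext ξ
  simp only [hΦ, weight_neg, omega_neg, diracSymbol_neg_apply, ← smul_add]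
  rw [smul_comm (2 : ℝ)]
  congr 1
  rw [← Complex.coe_smul (2 : ℝ)]
  push_cast
  module

/-- `W - 1` is of the order `1 / |ξ|` near the origin and `1 / |ξ|²` at infinity. -/
theorem memLp_weight_sub_one (hm : 0 < m) : MemLp (fun ξ => weight m ξ - 1) 2 := by
  rw [memLp_two_iff_integrable_sq ((measurable_weight m).sub_const 1).aestronglyMeasurable]
  have h := (integrable_fun_norm_addHaar (volume : Measure Space) (f := fun y : ℝ =>
    (√((2 * Real.pi * y) ^ 2 + m ^ 2) / (2 * Real.pi * y) - 1) ^ 2)).2 ?_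
  · exact h
  rw [finrank_space]
  set c : ℝ := min (m ^ 2) 1 with hc
  have hc0 : 0 < c := by positivity
  refine ((integrable_inv_one_add_sq.const_mul (m ^ 4 / c)).integrableOn).mono'
    (Measurable.aestronglyMeasurable (by fun_prop)) ?_
  filter_upwards [self_mem_ae_restrict measurableSet_Ioi] with y hy
  have hy' : 0 < y := hy
  set R : ℝ := √((2 * Real.pi * y) ^ 2 + m ^ 2) with hR
  have hR0 : 0 < R := by positivity
  have hR2 : R ^ 2 = (2 * Real.pi * y) ^ 2 + m ^ 2 := Real.sq_sqrt (by positivity)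
  rw [Real.norm_of_nonneg (smul_nonneg (by positivity) (sq_nonneg _)), smul_eq_mul]
  -- the Jacobian `y²` of polar coordinates compensates the singularity of the weight at the origin
  have e : y ^ (3 - 1) * (R / (2 * Real.pi * y) - 1) ^ 2 =
      (m ^ 2 / (2 * Real.pi * (R + 2 * Real.pi * y))) ^ 2 := by
    rw [show 3 - 1 = 2 from rfl, ← mul_pow]
    congr 1
    field_simp
    nlinarith
  rw [e, div_pow, ← pow_mul, div_mul_eq_mul_div, ← div_eq_mul_inv, div_div]
  norm_num only
  have hpi : 1 ≤ 2 * Real.pi := by linarith [Real.pi_gt_three]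
  gcongr
  have h1 : (1 + y ^ 2) * c ≤ R ^ 2 := by
    have a1 : c ≤ m ^ 2 := min_le_left _ _
    have a2 : c ≤ 1 := min_le_right _ _
    have a3 : y ^ 2 ≤ (2 * Real.pi * y) ^ 2 := by
      gcongr
      nlinarith
    nlinarith [sq_nonneg y]
  refine h1.trans ?_
  gcongr
  nlinarith [mul_nonneg (sub_nonneg.2 hpi) hR0.le,
    mul_pos (mul_pos Real.two_pi_pos Real.two_pi_pos) hy']

/-! ### The Fourier modes of the regular part -/

/-- The Fourier transform of the regular part: `e^{-itD} (v + ∫₀ᵗ e^{isD} i D⁻¹ Z(s) ds) - ω⁻²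
Z(t)`.
The initial value is `v` when `Z(0) = 0`. -/
noncomputable def mode (m : ℝ) (α : Fin 3 → Matrix (Fin 4) (Fin 4) ℂ)
    (β : Matrix (Fin 4) (Fin 4) ℂ) (v : Space → Spinor) (Z : ℝ → Spinor) (t : ℝ) (ξ : Space) :
    Spinor :=
  freeProp m α β t ξ (v ξ + ∫ s in (0 : ℝ)..t, source m α β Z s ξ)
    - ((1 / omega m ξ ^ 2 : ℝ) : ℂ) • Z t

/-- The convolution `∫₀ᵗ sin(wr) Z(t - r) dr`. -/
noncomputable def sinConv (Z : ℝ → Spinor) (t w : ℝ) : Spinor :=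
  ∫ r in (0 : ℝ)..t, Real.sin (w * r) • Z (t - r)

/-- The convolution `∫₀ᵗ cos(wr) Z(t - r) dr`. -/
noncomputable def cosConv (Z : ℝ → Spinor) (t w : ℝ) : Spinor :=
  ∫ r in (0 : ℝ)..t, Real.cos (w * r) • Z (t - r)

/-- The spherical average of `ω² (mode - e^{-itD} v)` on the shell `ω = w`. -/
noncomputable def amplitude (m : ℝ) (β : Matrix (Fin 4) (Fin 4) ℂ) (Z : ℝ → Spinor) (t w : ℝ) :
    Spinor :=
  (w • sinConv Z t w - Z t)
    + (Complex.I * m) • Matrix.toEuclideanCLM (n := Fin 4) (𝕜 := ℂ) β (cosConv Z t w)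

/-- The integrand of Duhamel's formula; it is trigonometric in `ω (t - s)`. -/
theorem freeProp_source (hm : 0 < m) (hαβ : IsDiracMatrices α β) (Z : ℝ → Spinor) (t s : ℝ)
    (ξ : Space) : freeProp m α β t ξ (source m α β Z s ξ) = (1 / omega m ξ ^ 2) •
      (omega m ξ • Real.sin (omega m ξ * (t - s)) • Z s
        + Complex.I • diracSymbol m α β ξ (Real.cos (omega m ξ * (t - s)) • Z s)) := by
  have hω : (omega m ξ : ℂ) ≠ 0 := Complex.ofReal_ne_zero.2 (omega_pos hm ξ).ne'
  rw [source, freeProp_freeProp_neg hm hαβ]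
  simp only [freeProp_apply, map_smul, diracSymbol_diracSymbol hαβ, smul_smul, smul_sub,
    ← Complex.coe_smul]
  push_cast
  match_scalars
  · field_simp
  · field_simp
    rw [Complex.I_sq]
    ring

theorem mode_eq (hm : 0 < m) (hαβ : IsDiracMatrices α β) (v : Space → Spinor) {Z : ℝ → Spinor}
    (hZ : Continuous Z) (t : ℝ) (ξ : Space) : mode m α β v Z t ξ = freeProp m α β t ξ (v ξ) +
      (1 / omega m ξ ^ 2) • ((omega m ξ • sinConv Z t (omega m ξ) - Z t)
        + Complex.I • diracSymbol m α β ξ (cosConv Z t (omega m ξ))) := by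
  have hs := (continuous_source (α := α) (β := β) hm hZ).comp' (Continuous.prodMk_left ξ)
  have hS : Continuous fun r => Real.sin (omega m ξ * r) • Z (t - r) := by fun_prop
  have hC : Continuous fun r => Real.cos (omega m ξ * r) • Z (t - r) := by fun_prop
  have h1 : freeProp m α β t ξ (∫ s in (0 : ℝ)..t, source m α β Z s ξ) =
      (1 / omega m ξ ^ 2) • (omega m ξ • sinConv Z t (omega m ξ)
        + Complex.I • diracSymbol m α β ξ (cosConv Z t (omega m ξ))) := by
    rw [← ContinuousLinearMap.intervalIntegral_comp_comm _ (hs.intervalIntegrable 0 t)]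
    obtain ⟨φ, hφ⟩ : ∃ φ : ℝ → Spinor, ∀ r, φ r = (1 / omega m ξ ^ 2) •
      (omega m ξ • Real.sin (omega m ξ * r) • Z (t - r)
        + Complex.I • diracSymbol m α β ξ (Real.cos (omega m ξ * r) • Z (t - r))) :=
      ⟨_, fun _ => rfl⟩
    have h2 : ∀ s, freeProp m α β t ξ (source m α β Z s ξ) = φ (t - s) := fun s => by
      simp only [freeProp_source hm hαβ, hφ, sub_sub_cancel]
    simp_rw [h2]
    rw [intervalIntegral.integral_comp_sub_left φ t, sub_self, sub_zero]
    simp_rw [hφ]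
    rw [intervalIntegral.integral_smul,
      intervalIntegral.integral_add, intervalIntegral.integral_smul, intervalIntegral.integral_smul,
      ContinuousLinearMap.intervalIntegral_comp_comm _ (hC.intervalIntegrable 0 t)]
    · rfl
    · exact (hS.const_smul (omega m ξ)).intervalIntegrable 0 t
    · exact (((diracSymbol m α β ξ).continuous.comp hC).const_smul Complex.I).intervalIntegrable 0 t
  rw [mode, map_add, h1, Complex.coe_smul, smul_add, smul_add, smul_sub]
  abel

theorem continuous_sinConv {Z : ℝ → Spinor} (hZ : Continuous Z) :
    Continuous fun p : ℝ × ℝ => sinConv Z p.1 p.2 := by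
  have h : Continuous (Function.uncurry fun (p : ℝ × ℝ) (r : ℝ) =>
      Real.sin (p.2 * r) • Z (p.1 - r)) := by
    unfold Function.uncurry; fun_prop
  exact intervalIntegral.continuous_parametric_intervalIntegral_of_continuous (a₀ := 0) h
    continuous_fst

theorem continuous_cosConv {Z : ℝ → Spinor} (hZ : Continuous Z) :
    Continuous fun p : ℝ × ℝ => cosConv Z p.1 p.2 := by
  have h : Continuous (Function.uncurry fun (p : ℝ × ℝ) (r : ℝ) =>
      Real.cos (p.2 * r) • Z (p.1 - r)) := by
    unfold Function.uncurry; fun_prop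
  exact intervalIntegral.continuous_parametric_intervalIntegral_of_continuous (a₀ := 0) h
    continuous_fst

theorem continuous_amplitude {Z : ℝ → Spinor} (hZ : Continuous Z) :
    Continuous fun p : ℝ × ℝ => amplitude m β Z p.1 p.2 := by
  have h1 := continuous_sinConv hZ
  have h2 := continuous_cosConv hZ
  have h3 : Continuous fun p : ℝ × ℝ =>
      Matrix.toEuclideanCLM (n := Fin 4) (𝕜 := ℂ) β (cosConv Z p.1 p.2) :=
    (Matrix.toEuclideanCLM (n := Fin 4) (𝕜 := ℂ) β).continuous.comp h2
  unfold amplitude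
  exact ((continuous_snd.smul h1).sub (hZ.comp continuous_fst)).add (h3.const_smul
    (Complex.I * m : ℂ))

theorem memLp_exp_neg_omega (hm : 0 < m) {l : ℝ} (hl : 0 < l) :
    MemLp (fun ξ => Real.exp (-l * omega m ξ)) 2 := by
  refine (memLp_inv_omega_sq hm).of_le_mul (c := 2 / l ^ 2) ?_ (Eventually.of_forall fun ξ => ?_)
  · exact ((measurable_omega m).const_mul _).exp.aestronglyMeasurable
  · have hω := omega_pos hm ξ
    rw [Complex.norm_real, Real.norm_of_nonneg (by positivity), Real.norm_of_nonneg (by positivity),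
      neg_mul, Real.exp_neg, div_mul_div_comm, mul_one, inv_le_comm₀ (by positivity)
        (by positivity),
      inv_div]
    have := Real.quadratic_le_exp_of_nonneg (x := l * omega m ξ) (by positivity)
    have h2 : 0 < l * omega m ξ := by positivity
    rw [div_le_iff₀ two_pos]
    nlinarith

theorem exp_neg_mul_omega_le_one (hm : 0 < m) {l : ℝ} (hl : 0 < l) (ξ : Space) :
    Real.exp (-l * omega m ξ) ≤ 1 :=
  Real.exp_le_one_iff.2 (by nlinarith [omega_pos hm ξ])

theorem memLp_weight_mul_exp (hm : 0 < m) {l : ℝ} (hl : 0 < l) :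
    MemLp (fun ξ => weight m ξ * Real.exp (-l * omega m ξ)) 2 := by
  have hM : AEStronglyMeasurable (fun ξ => Real.exp (-l * omega m ξ)) (volume : Measure Space) :=
    ((measurable_omega m).const_mul _).exp.aestronglyMeasurable
  have h1 : MemLp (fun ξ => (weight m ξ - 1) * Real.exp (-l * omega m ξ)) 2 := by
    refine (memLp_weight_sub_one hm).of_le ((memLp_weight_sub_one hm).1.mul hM)
      (Eventually.of_forall fun ξ => ?_)
    rw [norm_mul, Real.norm_of_nonneg (Real.exp_pos _).le]
    exact mul_le_of_le_one_right (norm_nonneg _) (exp_neg_mul_omega_le_one hm hl ξ)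
  refine (h1.add (memLp_exp_neg_omega hm hl)).ae_eq (Eventually.of_forall fun ξ => ?_)
  simp only [Pi.add_apply]
  ring

theorem integrable_memLp_smul {g : Space → ℝ} (hg : MemLp g 2) {v : Space → Spinor}
    (hv : MemLp v 2) : Integrable fun ξ => g ξ • v ξ := by
  rw [← memLp_one_iff_integrable]
  exact hv.smul hg

/-- The weighted Abel means of the modes, in terms of the spherical averages. -/
theorem integral_weight_exp_mode (hm : 0 < m) (hαβ : IsDiracMatrices α β) {v : Space → Spinor}
    (hv : MemLp v 2) {Z : ℝ → Spinor} (hZ : Continuous Z) {t : ℝ}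
    (hmode : MemLp (mode m α β v Z t) 2) {l : ℝ} (hl : 0 < l) :
    ∫ ξ, (weight m ξ * Real.exp (-l * omega m ξ)) • mode m α β v Z t ξ =
      (∫ ξ, (weight m ξ * Real.exp (-l * omega m ξ)) • freeProp m α β t ξ (v ξ)) +
        shellConst • ∫ w in Set.Ioi m, Real.exp (-l * w) • amplitude m β Z t w := by
  have h1 := integrable_memLp_smul (memLp_weight_mul_exp hm hl) hmode
  have h2 := integrable_memLp_smul (memLp_weight_mul_exp hm hl) (memLp_freeProp hm hαβ t hv)
  have e : ∀ ξ, (weight m ξ / omega m ξ ^ 2) •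
      (Real.exp (-l * omega m ξ) • (omega m ξ • sinConv Z t (omega m ξ) - Z t)
        + Complex.I • diracSymbol m α β ξ
          (Real.exp (-l * omega m ξ) • cosConv Z t (omega m ξ))) =
      (weight m ξ * Real.exp (-l * omega m ξ)) • mode m α β v Z t ξ -
      (weight m ξ * Real.exp (-l * omega m ξ)) • freeProp m α β t ξ (v ξ) := fun ξ => by
    rw [← smul_sub, mode_eq hm hαβ v hZ, add_sub_cancel_left, smul_smul,
      ← Complex.coe_smul (Real.exp (-l * omega m ξ)) (cosConv _ _ _), map_smul, smul_comm Complex.I,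
      Complex.coe_smul, ← smul_add, smul_smul]
    congr 1
    ring
  have h3 := integral_weight_smul_diracSymbol (α := α) (β := β) hm
    (A := fun w => Real.exp (-l * w) • (w • sinConv Z t w - Z t))
    (B := fun w => Real.exp (-l * w) • cosConv Z t w)
    ((h1.sub h2).congr (Eventually.of_forall fun ξ => (e ξ).symm))
  simp_rw [e] at h3
  rw [integral_sub h1 h2, sub_eq_iff_eq_add'] at h3
  rw [h3]
  congr 2
  refine setIntegral_congr_fun measurableSet_Ioi fun w _ => ?_
  simp only [amplitude, smul_add]
  congr 1
  rw [← Complex.coe_smul (Real.exp (-l * w)) (cosConv _ _ _), map_smul, smul_comm,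
    Complex.coe_smul]

/-- The Poisson kernel of the half-line. -/
noncomputable def poisson (l r : ℝ) : ℝ := l / (l ^ 2 + r ^ 2)

/-- Minus the derivative of the Poisson kernel. -/
noncomputable def poissonDeriv (l r : ℝ) : ℝ := 2 * l * r / (l ^ 2 + r ^ 2) ^ 2

theorem continuous_poisson {l : ℝ} (hl : 0 < l) : Continuous (poisson l) :=
  continuous_const.div (by fun_prop) fun r => by positivity

theorem continuous_poissonDeriv {l : ℝ} (hl : 0 < l) : Continuous (poissonDeriv l) :=
  Continuous.div (by fun_prop) (by fun_prop) fun r => by positivity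

theorem hasDerivAt_poisson {l : ℝ} (hl : 0 < l) (r : ℝ) :
    HasDerivAt (poisson l) (-poissonDeriv l r) r := by
  have h1 : HasDerivAt (fun r : ℝ => l ^ 2 + r ^ 2) (2 * r) r := by
    simpa using (hasDerivAt_pow 2 r).const_add (l ^ 2)
  refine ((hasDerivAt_const r l).div h1 (by positivity)).congr_deriv ?_
  rw [poissonDeriv]
  ring

theorem integral_poissonDeriv {l : ℝ} (hl : 0 < l) (t : ℝ) :
    ∫ r in (0 : ℝ)..t, poissonDeriv l r = l⁻¹ - poisson l t := by
  have h := intervalIntegral.integral_eq_sub_of_hasDerivAt (a := 0) (b := t)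
    (f := fun r => -poisson l r) (f' := poissonDeriv l)
    (fun r _ => by simpa using (hasDerivAt_poisson hl r).fun_neg)
    ((continuous_poissonDeriv hl).intervalIntegrable 0 t)
  rw [h]
  have : poisson l 0 = l⁻¹ := by
    rw [poisson]; field_simp; simp
  rw [this]; ring

theorem integral_Ioi_intervalIntegral {k : ℝ → ℝ → ℝ} (hk : Continuous (Function.uncurry k))
    {g : ℝ → ℝ} (hg : IntegrableOn g (Set.Ioi 0)) (hkg : ∀ w ∈ Set.Ioi (0 : ℝ), ∀ r, |k w r| ≤ g w)
    {y : ℝ → Spinor} (hy : Continuous y) {t : ℝ} (ht : 0 ≤ t) :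
    IntegrableOn (fun w => ∫ r in (0 : ℝ)..t, k w r • y r) (Set.Ioi 0) ∧
    ∫ w in Set.Ioi (0 : ℝ), ∫ r in (0 : ℝ)..t, k w r • y r =
      ∫ r in (0 : ℝ)..t, (∫ w in Set.Ioi (0 : ℝ), k w r) • y r := by
  have hF : Integrable (Function.uncurry fun w r => k w r • y r)
      ((volume.restrict (Set.Ioi 0)).prod (volume.restrict (Set.Ioc 0 t))) := by
    have hyi : IntegrableOn y (Set.Ioc 0 t) :=
      (intervalIntegrable_iff_integrableOn_Ioc_of_le ht).1 (hy.intervalIntegrable 0 t)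
    refine (hg.mul_prod hyi.norm).mono' ?_ ?_
    · exact (hk.smul (hy.comp continuous_snd)).aestronglyMeasurable
    · have h1 : ∀ᵐ p ∂((volume.restrict (Set.Ioi (0 : ℝ))).prod (volume.restrict (Set.Ioc 0 t))),
          p.1 ∈ Set.Ioi (0 : ℝ) :=
        Measure.quasiMeasurePreserving_fst.ae (self_mem_ae_restrict measurableSet_Ioi)
      filter_upwards [h1] with p hp
      simp only [Function.uncurry, norm_smul, Real.norm_eq_abs]
      exact mul_le_mul_of_nonneg_right (hkg p.1 hp p.2) (norm_nonneg _)
  simp only [intervalIntegral.integral_of_le ht]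
  refine ⟨hF.integral_prod_left, ?_⟩
  rw [integral_integral_swap hF]
  simp_rw [integral_smul_const]

/-- The Laplace transform of the spherical averages. The term `-Z(t)` of the amplitude is absorbed
in
the increments `Z(t) - Z(t - r)`, up to the boundary term `λ (λ² + t²)⁻¹ Z(t)`. -/
theorem integral_exp_amplitude {Z : ℝ → Spinor} (hZ : Continuous Z) {t : ℝ} (ht : 0 ≤ t) {l : ℝ}
    (hl : 0 < l) :
    IntegrableOn (fun w => Real.exp (-l * w) • amplitude m β Z t w) (Set.Ioi 0) ∧
    ∫ w in Set.Ioi (0 : ℝ), Real.exp (-l * w) • amplitude m β Z t w =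
      -(poisson l t • Z t) - (∫ r in (0 : ℝ)..t, poissonDeriv l r • (Z t - Z (t - r)))
        + (Complex.I * m) • Matrix.toEuclideanCLM (n := Fin 4) (𝕜 := ℂ) β
          (∫ r in (0 : ℝ)..t, poisson l r • Z (t - r)) := by
  have hy : Continuous fun r => Z (t - r) := by fun_prop
  have hS := integral_Ioi_intervalIntegral (k := fun w r => Real.exp (-l * w) * (w * Real.sin
    (w * r)))
    (by unfold Function.uncurry; fun_prop) (integrableOn_mul_exp_neg hl) (fun w hw r => by
      have hw' : 0 < w := hw
      rw [abs_mul, abs_mul, abs_of_pos hw', abs_of_pos (Real.exp_pos _)]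
      exact mul_le_mul_of_nonneg_left (mul_le_of_le_one_right hw'.le (Real.abs_sin_le_one _))
        (Real.exp_pos _).le |>.trans_eq (mul_comm _ _)) hy ht
  have hC := integral_Ioi_intervalIntegral (k := fun w r => Real.exp (-l * w) * Real.cos (w * r))
    (by unfold Function.uncurry; fun_prop) (integrableOn_exp_neg hl 0) (fun w hw r => by
      rw [abs_mul, abs_of_pos (Real.exp_pos _)]
      exact mul_le_of_le_one_right (Real.exp_pos _).le (Real.abs_cos_le_one _)) hy ht
  simp only [integral_exp_neg_mul_sin hl, integral_exp_neg_mul_cos hl] at hS hC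
  have hZi : IntegrableOn (fun w => Real.exp (-l * w) • Z t) (Set.Ioi 0) :=
    (integrableOn_exp_neg hl 0).smul_const _
  have hZe : ∫ w in Set.Ioi (0 : ℝ), Real.exp (-l * w) • Z t = l⁻¹ • Z t := by
    rw [integral_smul_const]
    have := integral_exp_neg_mul_cos hl 0
    simp only [mul_zero, Real.cos_zero, mul_one] at this
    rw [this]
    congr 1
    field_simp
    simp
  set b := Matrix.toEuclideanCLM (n := Fin 4) (𝕜 := ℂ) β with hb
  have e : ∀ w, Real.exp (-l * w) • amplitude m β Z t w =
      ((∫ r in (0 : ℝ)..t, (Real.exp (-l * w) * (w * Real.sin (w * r))) • Z (t - r))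
        - Real.exp (-l * w) • Z t)
      + (Complex.I * m) • b (∫ r in (0 : ℝ)..t, (Real.exp (-l * w) * Real.cos (w * r)) • Z
        (t - r)) :=
    fun w => by
    simp only [mul_smul, intervalIntegral.integral_smul, amplitude, smul_add, smul_sub, sinConv,
      cosConv]
    congr 1
    simp only [← Complex.coe_smul, map_smul, hb]
    simp only [smul_smul]
    congr 1
    ring
  have hCb : IntegrableOn (fun w => (Complex.I * m : ℂ) •
      b (∫ r in (0 : ℝ)..t, (Real.exp (-l * w) * Real.cos (w * r)) • Z (t - r))) (Set.Ioi 0) :=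
    (b.integrable_comp hC.1).smul (Complex.I * m : ℂ)
  have hSZ := hS.1.sub hZi
  simp_rw [e]
  refine ⟨hSZ.add hCb, ?_⟩
  have e1 := integral_add hSZ hCb
  simp only [Pi.sub_apply] at e1
  have e2 := integral_sub hS.1 hZi
  rw [e1, e2, integral_smul, b.integral_comp_comm hC.1, hC.2, hS.2, hZe]
  congr 1
  have e3 : (∫ r in (0 : ℝ)..t, poissonDeriv l r • (Z t - Z (t - r))) =
      (l⁻¹ - poisson l t) • Z t - ∫ r in (0 : ℝ)..t, poissonDeriv l r • Z (t - r) := by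
    simp_rw [smul_sub]
    rw [intervalIntegral.integral_sub, intervalIntegral.integral_smul_const,
      integral_poissonDeriv hl]
    · exact ((continuous_poissonDeriv hl).smul continuous_const).intervalIntegrable 0 t
    · exact ((continuous_poissonDeriv hl).smul hy).intervalIntegrable 0 t
  rw [e3, sub_smul]
  simp only [poissonDeriv]
  abel

/-! ### Abel means of the modes -/

theorem aestronglyMeasurable_exp_smul {g : Space → Spinor} (hg : AEStronglyMeasurable g) (l : ℝ) :
    AEStronglyMeasurable (fun ξ => Real.exp (-l * omega m ξ) • g ξ) :=
  ((measurable_omega m).const_mul _).exp.aestronglyMeasurable.smul hg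

theorem norm_exp_smul_le (hm : 0 < m) {l : ℝ} (hl : 0 < l) (ξ : Space) (v : Spinor) :
    ‖Real.exp (-l * omega m ξ) • v‖ ≤ ‖v‖ := by
  rw [norm_smul, Real.norm_of_nonneg (Real.exp_pos _).le]
  exact mul_le_of_le_one_left (norm_nonneg _) (exp_neg_mul_omega_le_one hm hl ξ)

theorem integrable_exp_smul (hm : 0 < m) {g : Space → Spinor} (hg : Integrable g) {l : ℝ}
    (hl : 0 < l) : Integrable fun ξ => Real.exp (-l * omega m ξ) • g ξ :=
  hg.mono (aestronglyMeasurable_exp_smul hg.1 l) (Eventually.of_forall fun ξ =>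
    norm_exp_smul_le hm hl ξ (g ξ))

theorem norm_integral_exp_smul_le (hm : 0 < m) {g : Space → Spinor} (hg : Integrable g) {l : ℝ}
    (hl : 0 < l) : ‖∫ ξ, Real.exp (-l * omega m ξ) • g ξ‖ ≤ ∫ ξ, ‖g ξ‖ :=
  (norm_integral_le_integral_norm _).trans (integral_mono
    (integrable_exp_smul hm hg hl).norm hg.norm
    fun ξ => norm_exp_smul_le hm hl ξ (g ξ))

theorem tendsto_exp_neg_mul_nhds_zero (w : ℝ) :
    Tendsto (fun l : ℝ => Real.exp (-l * w)) (𝓝[>] 0) (𝓝 1) := by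
  have h : Tendsto (fun l : ℝ => Real.exp (-l * w)) (𝓝 0) (𝓝 (Real.exp (-0 * w))) :=
    (by fun_prop : Continuous fun l : ℝ => Real.exp (-l * w)).tendsto 0
  simp only [neg_zero, zero_mul, Real.exp_zero] at h
  exact h.mono_left nhdsWithin_le_nhds

theorem tendsto_integral_exp_smul (hm : 0 < m) {g : Space → Spinor} (hg : Integrable g) :
    Tendsto (fun l : ℝ => ∫ ξ, Real.exp (-l * omega m ξ) • g ξ) (𝓝[>] 0) (𝓝 (∫ ξ, g ξ)) := by
  refine tendsto_integral_filter_of_dominated_convergence (fun ξ => ‖g ξ‖)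
    (Eventually.of_forall fun l => aestronglyMeasurable_exp_smul hg.1 l) ?_ hg.norm
    (Eventually.of_forall fun ξ => ?_)
  · filter_upwards [self_mem_nhdsWithin] with l hl
    exact Eventually.of_forall fun ξ => norm_exp_smul_le hm hl ξ (g ξ)
  · simpa using (tendsto_exp_neg_mul_nhds_zero (omega m ξ)).smul_const (g ξ)

/-- The contribution to the weighted Abel mean of the initial value, and of the interval `0 < w < m`
which is added to the spectrum `w > m` in order to have Laplace transforms on the half-line. -/
noncomputable def tameMean (m : ℝ) (α : Fin 3 → Matrix (Fin 4) (Fin 4) ℂ)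
    (β : Matrix (Fin 4) (Fin 4) ℂ) (v : Space → Spinor) (Z : ℝ → Spinor) (l t : ℝ) : Spinor :=
  (∫ ξ, Real.exp (-l * omega m ξ) • weight m ξ • freeProp m α β t ξ (v ξ))
    - shellConst • ∫ w in (0 : ℝ)..m, Real.exp (-l * w) • amplitude m β Z t w

theorem integrable_weight_freeProp (hm : 0 < m) (hαβ : IsDiracMatrices α β) {v : Space → Spinor}
    (hv : MemLp v 2) (hWv : Integrable fun ξ => weight m ξ • v ξ) (t : ℝ) :
    Integrable fun ξ => weight m ξ • freeProp m α β t ξ (v ξ) := by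
  refine (hWv.norm.const_mul 2).mono' ((measurable_weight m).aestronglyMeasurable.smul
    (aestronglyMeasurable_freeProp hm t hv.1)) (Eventually.of_forall fun ξ => ?_)
  rw [norm_smul, norm_smul]
  linarith [mul_le_mul_of_nonneg_left (norm_freeProp_le hm hαβ t ξ (v ξ)) (norm_nonneg
    (weight m ξ))]

/-- The weighted Abel means of the modes: all terms but the last one have a limit as `λ → 0+` for
every continuous `Z`, and the last one probes the left difference quotients of `Z` at `t`. -/
theorem weightedMean_eq (hm : 0 < m) (hαβ : IsDiracMatrices α β) {v : Space → Spinor}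
    (hv : MemLp v 2) {Z : ℝ → Spinor} (hZ : Continuous Z) {t : ℝ} (ht : 0 ≤ t)
    (hmode : MemLp (mode m α β v Z t) 2) {l : ℝ} (hl : 0 < l) :
    ∫ ξ, Real.exp (-l * omega m ξ) • weight m ξ • mode m α β v Z t ξ =
      tameMean m α β v Z l t + shellConst • (-(poisson l t • Z t)
        + (Complex.I * m) • Matrix.toEuclideanCLM (n := Fin 4) (𝕜 := ℂ) β
          (∫ r in (0 : ℝ)..t, poisson l r • Z (t - r))
        - ∫ r in (0 : ℝ)..t, poissonDeriv l r • (Z t - Z (t - r))) := by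
  have h1 := integral_weight_exp_mode hm hαβ hv hZ hmode hl
  obtain ⟨h2, h3⟩ := integral_exp_amplitude (m := m) (β := β) hZ ht hl
  have h4 : ∫ w in Set.Ioi m, Real.exp (-l * w) • amplitude m β Z t w =
      (∫ w in Set.Ioi (0 : ℝ), Real.exp (-l * w) • amplitude m β Z t w)
        - ∫ w in (0 : ℝ)..m, Real.exp (-l * w) • amplitude m β Z t w := by
    rw [intervalIntegral.integral_of_le hm.le, eq_sub_iff_add_eq', ← Set.Ioc_union_Ioi_eq_Ioi hm.le]
    exact (setIntegral_union Set.Ioc_disjoint_Ioi_same measurableSet_Ioi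
      (h2.mono_set Set.Ioc_subset_Ioi_self) (h2.mono_set (Set.Ioi_subset_Ioi hm.le))).symm
  have e : ∀ (ξ : Space) (y : Spinor), Real.exp (-l * omega m ξ) • weight m ξ • y =
      (weight m ξ * Real.exp (-l * omega m ξ)) • y := fun ξ y => by
    rw [smul_smul, mul_comm]
  simp_rw [tameMean, e]
  rw [h1, h4, h3]
  module

theorem continuous_integral_weight_freeProp (hm : 0 < m) (hαβ : IsDiracMatrices α β)
    {v : Space → Spinor} (hv : MemLp v 2) (hWv : Integrable fun ξ => weight m ξ • v ξ) :
    Continuous fun t => ∫ ξ, weight m ξ • freeProp m α β t ξ (v ξ) := by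
  refine continuous_of_dominated (bound := fun ξ => 2 * ‖weight m ξ • v ξ‖)
    (fun t => (integrable_weight_freeProp hm hαβ hv hWv t).1)
      (fun t => Eventually.of_forall fun ξ => ?_)
    (hWv.norm.const_mul 2) (Eventually.of_forall fun ξ => ?_)
  · rw [norm_smul, norm_smul]
    linarith [mul_le_mul_of_nonneg_left (norm_freeProp_le hm hαβ t ξ (v ξ))
      (norm_nonneg (weight m ξ))]
  · exact (continuous_iff_continuousAt.2 fun t =>
      (hasDerivAt_freeProp hm hαβ t ξ (v ξ)).continuousAt).const_smul (weight m ξ)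

theorem continuous_tameMean_zero (hm : 0 < m) (hαβ : IsDiracMatrices α β)
    {v : Space → Spinor} (hv : MemLp v 2) (hWv : Integrable fun ξ => weight m ξ • v ξ)
    {Z : ℝ → Spinor} (hZ : Continuous Z) : Continuous fun t => tameMean m α β v Z 0 t := by
  have h := continuous_integral_weight_freeProp hm hαβ hv hWv
  have h2 := intervalIntegral.continuous_parametric_intervalIntegral_of_continuous' (μ := volume)
    (f := fun t w => amplitude m β Z t w) (continuous_amplitude hZ) 0 m
  simp only [tameMean, neg_zero, zero_mul, Real.exp_zero, one_smul]
  exact h.sub (h2.const_smul shellConst)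

theorem tendsto_tameMean (hm : 0 < m) (hαβ : IsDiracMatrices α β)
    {v : Space → Spinor} (hv : MemLp v 2) (hWv : Integrable fun ξ => weight m ξ • v ξ)
    {Z : ℝ → Spinor} (hZ : Continuous Z) (t : ℝ) :
    Tendsto (fun l => tameMean m α β v Z l t) (𝓝[>] 0) (𝓝 (tameMean m α β v Z 0 t)) := by
  have h1 := tendsto_integral_exp_smul hm (integrable_weight_freeProp hm hαβ hv hWv t)
  have hc : Continuous (Function.uncurry fun l w : ℝ => Real.exp
    (-l * w) • amplitude m β Z t w) := by
    have hA : Continuous fun w => amplitude m β Z t w :=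
      (continuous_amplitude hZ).comp' (Continuous.prodMk_right t)
    have h3 : Continuous fun p : ℝ × ℝ => amplitude m β Z t p.2 := hA.comp' continuous_snd
    exact (by fun_prop : Continuous fun p : ℝ × ℝ => Real.exp (-p.1 * p.2)).smul h3
  have h2 := (intervalIntegral.continuous_parametric_intervalIntegral_of_continuous' (μ := volume)
    hc 0 m).tendsto 0
  simp only [tameMean]
  refine Tendsto.sub ?_ ((h2.mono_left nhdsWithin_le_nhds).const_smul shellConst)
  simpa only [neg_zero, zero_mul, Real.exp_zero, one_smul] using h1

theorem exists_norm_tameMean_le (hm : 0 < m) (hαβ : IsDiracMatrices α β)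
    {v : Space → Spinor} (hv : MemLp v 2) (hWv : Integrable fun ξ => weight m ξ • v ξ)
    {Z : ℝ → Spinor} (hZ : Continuous Z) (τ : ℝ) :
    ∃ K, ∀ l > 0, ∀ t ∈ Set.Icc 0 τ, ‖tameMean m α β v Z l t‖ ≤ K := by
  have h2 : Continuous fun t => ∫ w in (0 : ℝ)..m, ‖amplitude m β Z t w‖ :=
    intervalIntegral.continuous_parametric_intervalIntegral_of_continuous' (μ := volume)
      (f := fun t w => ‖amplitude m β Z t w‖) (continuous_amplitude hZ).norm 0 m
  obtain ⟨K, hK⟩ := isCompact_Icc.exists_bound_of_continuousOn (s := Set.Icc 0 τ) h2.continuousOn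
  refine ⟨(∫ ξ, 2 * ‖weight m ξ • v ξ‖) + shellConst * K, fun l hl t ht => ?_⟩
  refine (norm_sub_le _ _).trans (add_le_add ?_ ?_)
  · refine (norm_integral_exp_smul_le hm (integrable_weight_freeProp hm hαβ hv hWv t) hl).trans ?_
    refine integral_mono (integrable_weight_freeProp hm hαβ hv hWv t).norm (hWv.norm.const_mul 2)
      fun ξ => ?_
    simp only
    rw [norm_smul, norm_smul]
    linarith [mul_le_mul_of_nonneg_left (norm_freeProp_le hm hαβ t ξ (v ξ))
      (norm_nonneg (weight m ξ))]
  · rw [norm_smul, Real.norm_of_nonneg shellConst_pos.le]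
    refine mul_le_mul_of_nonneg_left ?_ shellConst_pos.le
    have hA : Continuous fun w => amplitude m β Z t w :=
      (continuous_amplitude hZ).comp' (Continuous.prodMk_right t)
    refine (intervalIntegral.norm_integral_le_integral_norm hm.le).trans
      (le_trans ?_ ((le_abs_self _).trans (hK t ht)))
    refine intervalIntegral.integral_mono_on hm.le
      (Continuous.intervalIntegrable (by fun_prop) 0 m)
        (hA.norm.intervalIntegrable 0 m) fun w hw => ?_
    rw [norm_smul, Real.norm_of_nonneg (Real.exp_pos _).le]
    exact mul_le_of_le_one_left (norm_nonneg _) (Real.exp_le_one_iff.2 (by nlinarith [hw.1]))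

theorem tendsto_poisson {t : ℝ} (ht : 0 < t) : Tendsto (fun l => poisson l t) (𝓝[>] 0) (𝓝 0) := by
  have hc : ContinuousAt (fun l => poisson l t) 0 := by
    unfold poisson
    exact ContinuousAt.div (by fun_prop) (by fun_prop) (by positivity)
  have h := hc.tendsto
  simp only [poisson, zero_div] at h
  exact h.mono_left nhdsWithin_le_nhds

theorem tendsto_integral_poisson {y : ℝ → Spinor} (hy : Continuous y) {t : ℝ} (ht : 0 < t) :
    Tendsto (fun l => ∫ r in (0 : ℝ)..t, poisson l r • y r) (𝓝[>] 0) (𝓝 ((Real.pi / 2) • y 0)) := by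
  obtain ⟨K, hK⟩ := isCompact_Icc.exists_bound_of_continuousOn (s := Set.Icc 0 t) hy.continuousOn
  have h := tendsto_integral_kernel (integrable_inv_one_add_sq.integrableOn) ht
    hy.aestronglyMeasurable (fun r hr => hK r (Set.Ioc_subset_Icc_self hr))
    ((hy.tendsto 0).mono_left nhdsWithin_le_nhds)
  rw [integral_Ioi_inv_one_add_sq, Real.arctan_zero, sub_zero] at h
  refine h.congr' ?_
  filter_upwards [self_mem_nhdsWithin] with l hl
  have hl' : 0 < l := hl
  congr 1
  funext r
  congr 1
  rw [poisson]
  field_simp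

theorem poissonDeriv_mul {l : ℝ} (hl : 0 < l) (r : ℝ) :
    poissonDeriv l r * r = l⁻¹ * (2 * (r / l) ^ 2 / (1 + (r / l) ^ 2) ^ 2) := by
  rw [poissonDeriv]
  field_simp

/-- The kernels `r · 2λr (λ² + r²)⁻²` form an approximate identity of mass `π/2` on the half-line.
-/
theorem tendsto_integral_poissonDeriv {E : Type*} [NormedAddCommGroup E] [NormedSpace ℝ E]
    [CompleteSpace E] {k : ℝ → E} {k₀ : E} {K t : ℝ} (ht : 0 < t)
    (hk : AEStronglyMeasurable k (volume.restrict (Set.Ioc 0 t)))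
    (hkK : ∀ r ∈ Set.Ioc 0 t, ‖k r‖ ≤ K) (hk₀ : Tendsto k (𝓝[>] 0) (𝓝 k₀)) :
    Tendsto (fun l => ∫ r in (0 : ℝ)..t, (poissonDeriv l r * r) • k r) (𝓝[>] 0)
      (𝓝 ((Real.pi / 2) • k₀)) := by
  have h := tendsto_integral_kernel integrableOn_kernel_sq ht hk hkK hk₀
  rw [integral_kernel_sq] at h
  refine h.congr' ?_
  filter_upwards [self_mem_nhdsWithin] with l hl
  simp_rw [poissonDeriv_mul hl]

/-- The limit of the terms of the weighted Abel mean that do not involve increments of `Z`. -/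
noncomputable def tameLimit (m : ℝ) (α : Fin 3 → Matrix (Fin 4) (Fin 4) ℂ)
    (β : Matrix (Fin 4) (Fin 4) ℂ) (v : Space → Spinor) (Z : ℝ → Spinor) (t : ℝ) : Spinor :=
  tameMean m α β v Z 0 t + shellConst •
    ((Complex.I * m) • Matrix.toEuclideanCLM (n := Fin 4) (𝕜 := ℂ) β ((Real.pi / 2) • Z t))

theorem continuous_tameLimit (hm : 0 < m) (hαβ : IsDiracMatrices α β)
    {v : Space → Spinor} (hv : MemLp v 2) (hWv : Integrable fun ξ => weight m ξ • v ξ)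
    {Z : ℝ → Spinor} (hZ : Continuous Z) : Continuous (tameLimit m α β v Z) := by
  have h : Continuous fun t =>
      Matrix.toEuclideanCLM (n := Fin 4) (𝕜 := ℂ) β ((Real.pi / 2) • Z t) :=
    (Matrix.toEuclideanCLM (n := Fin 4) (𝕜 := ℂ) β).continuous.comp (hZ.const_smul (Real.pi / 2))
  exact (continuous_tameMean_zero hm hαβ hv hWv hZ).add
    ((h.const_smul (Complex.I * m : ℂ)).const_smul shellConst)

theorem tendsto_tameLimit (hm : 0 < m) (hαβ : IsDiracMatrices α β)
    {v : Space → Spinor} (hv : MemLp v 2) (hWv : Integrable fun ξ => weight m ξ • v ξ)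
    {Z : ℝ → Spinor} (hZ : Continuous Z) {t : ℝ} (ht : 0 < t) :
    Tendsto (fun l => tameMean m α β v Z l t + shellConst • (-(poisson l t • Z t)
        + (Complex.I * m) • Matrix.toEuclideanCLM (n := Fin 4) (𝕜 := ℂ) β
          (∫ r in (0 : ℝ)..t, poisson l r • Z (t - r)))) (𝓝[>] 0)
      (𝓝 (tameLimit m α β v Z t)) := by
  have h1 := tendsto_tameMean hm hαβ hv hWv hZ t
  have h2 := (tendsto_poisson ht).smul_const (Z t)
  have h3 := tendsto_integral_poisson (y := fun r => Z (t - r)) (by fun_prop) ht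
  have h4 := (((Matrix.toEuclideanCLM (n := Fin 4) (𝕜 := ℂ) β).continuous.tendsto _).comp
    h3).const_smul (Complex.I * m : ℂ)
  have h5 := h1.add ((h2.neg.add h4).const_smul shellConst)
  rw [sub_zero, zero_smul, neg_zero, zero_add] at h5
  exact h5

/-! ### One-sided slopes of the singular coefficient -/

theorem tendsto_integral_rpow_omega_smul (hm : 0 < m) {g : Space → Spinor} (hg : Integrable g) :
    (∀ ε : ℝ, 0 < ε → Integrable fun ξ => omega m ξ ^ (-2 * ε) • g ξ) ∧
    Tendsto (fun ε : ℝ => ∫ ξ, omega m ξ ^ (-2 * ε) • g ξ) (𝓝[>] 0) (𝓝 (∫ ξ, g ξ)) := by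
  have hM : ∀ ε : ℝ, AEStronglyMeasurable fun ξ => omega m ξ ^ (-2 * ε) • g ξ := fun ε =>
    ((measurable_omega m).pow_const _).aestronglyMeasurable.smul hg.1
  have hb : ∀ ε : ℝ, 0 < ε → ∀ ξ, ‖omega m ξ ^ (-2 * ε) • g ξ‖ ≤ m ^ (-2 * ε) * ‖g ξ‖ :=
    fun ε hε ξ => by
    rw [norm_smul, Real.norm_of_nonneg (Real.rpow_nonneg (omega_pos hm ξ).le _)]
    exact mul_le_mul_of_nonneg_right (Real.rpow_le_rpow_of_nonpos hm (le_omega ξ) (by linarith))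
      (norm_nonneg _)
  have hc : ∀ x : ℝ, 0 < x → Tendsto (fun ε : ℝ => x ^ (-2 * ε)) (𝓝[>] 0) (𝓝 1) := fun x hx => by
    have h1 : Continuous fun ε : ℝ => x ^ (-2 * ε) :=
      (Real.continuous_const_rpow hx.ne').comp (continuous_const.mul continuous_id)
    have h2 := h1.tendsto 0
    simp only [mul_zero, Real.rpow_zero] at h2
    exact h2.mono_left nhdsWithin_le_nhds
  refine ⟨fun ε hε => (hg.norm.const_mul _).mono' (hM ε) (Eventually.of_forall (hb ε hε)), ?_⟩
  refine tendsto_integral_filter_of_dominated_convergence (fun ξ => 2 * ‖g ξ‖)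
    (Eventually.of_forall hM) ?_ (hg.norm.const_mul 2) (Eventually.of_forall fun ξ => ?_)
  · filter_upwards [self_mem_nhdsWithin, (hc m hm).eventually_le_const one_lt_two] with ε hε h2
    exact Eventually.of_forall fun ξ => (hb ε hε ξ).trans
      (mul_le_mul_of_nonneg_right h2 (norm_nonneg _))
  · simpa using (hc _ (omega_pos hm ξ)).smul_const (g ξ)

/-- Insertion of the weight in the regularized value adds `∫ (W - 1) g`, since `W - 1 ∈ L²`. -/
theorem tendsto_integral_rpow_omega_weight (hm : 0 < m) {g : Space → Spinor} (hg : MemLp g 2)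
    (hi : ∀ ε : ℝ, 0 < ε → Integrable fun ξ => omega m ξ ^ (-2 * ε) • g ξ) {w : Spinor}
    (hw : Tendsto (fun ε : ℝ => ∫ ξ, omega m ξ ^ (-2 * ε) • g ξ) (𝓝[>] 0) (𝓝 w)) :
    (∀ ε : ℝ, 0 < ε → Integrable fun ξ => omega m ξ ^ (-2 * ε) • weight m ξ • g ξ) ∧
    Tendsto (fun ε : ℝ => ∫ ξ, omega m ξ ^ (-2 * ε) • weight m ξ • g ξ) (𝓝[>] 0)
      (𝓝 (w + ∫ ξ, (weight m ξ - 1) • g ξ)) := by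
  obtain ⟨h1, h2⟩ := tendsto_integral_rpow_omega_smul hm
    (integrable_memLp_smul (memLp_weight_sub_one hm) hg)
  have e : ∀ (ε : ℝ) (ξ : Space), omega m ξ ^ (-2 * ε) • weight m ξ • g ξ =
      omega m ξ ^ (-2 * ε) • g ξ + omega m ξ ^ (-2 * ε) • (weight m ξ - 1) • g ξ := fun ε ξ => by
    module
  simp_rw [e]
  refine ⟨fun ε hε => (hi ε hε).add (h1 ε hε), (hw.add h2).congr' ?_⟩
  filter_upwards [self_mem_nhdsWithin] with ε hε
  exact (integral_add (hi ε hε) (h1 ε hε)).symm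

/-- If the regularized value of the modes exists at time `t`, then a lower bound `A` for the left
slopes of a component of `Z` near `t` bounds that value. -/
theorem apply_le_of_slope (hm : 0 < m) (hαβ : IsDiracMatrices α β)
    {v : Space → Spinor} (hv : MemLp v 2) (hWv : Integrable fun ξ => weight m ξ • v ξ)
    {Z : ℝ → Spinor} (hZ : Continuous Z) {t : ℝ} (ht : 0 < t)
    (hmode : MemLp (mode m α β v Z t) 2)
    (hi : ∀ ε : ℝ, 0 < ε → Integrable fun ξ =>
      omega m ξ ^ (-2 * ε) • weight m ξ • mode m α β v Z t ξ) {V : Spinor}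
    (hV : Tendsto (fun ε : ℝ => ∫ ξ, omega m ξ ^ (-2 * ε) • weight m ξ • mode m α β v Z t ξ)
      (𝓝[>] 0) (𝓝 V)) (L : Spinor →L[ℝ] ℝ) {A d : ℝ} (hd : 0 < d)
    (hA : ∀ r ∈ Set.Ioc 0 d, A * r ≤ L (Z t - Z (t - r))) :
    L V ≤ L (tameLimit m α β v Z t) - shellConst * (Real.pi / 2 * A) := by
  -- the truncated difference quotient is bounded and equals `A` near `0`
  set k : ℝ → ℝ := fun r => min (L (Z t - Z (t - r)) / r) A with hk
  have hy : Continuous fun r => Z t - Z (t - r) := by fun_prop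
  have hLy : Continuous fun r => L (Z t - Z (t - r)) := L.continuous.comp hy
  have hkm : Measurable k := (hLy.measurable.div measurable_id).min measurable_const
  obtain ⟨K, hK⟩ := isCompact_Icc.exists_bound_of_continuousOn (s := Set.Icc 0 t) hLy.continuousOn
  have hK0 : 0 ≤ K := (norm_nonneg _).trans (hK 0 ⟨le_rfl, ht.le⟩)
  have hkA : ∀ r ∈ Set.Ioc 0 d, k r = A := fun r hr =>
    min_eq_right ((le_div_iff₀ hr.1).2 (hA r hr))
  have hkb : ∀ r ∈ Set.Ioc 0 t, ‖k r‖ ≤ K / d + |A| := by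
    intro r hr
    rcases le_or_gt r d with h | h
    · rw [hkA r ⟨hr.1, h⟩, Real.norm_eq_abs]
      have : 0 ≤ K / d := by positivity
      linarith
    · have h1 : ‖L (Z t - Z (t - r)) / r‖ ≤ K / d := by
        rw [norm_div, Real.norm_of_nonneg hr.1.le]
        exact div_le_div₀ hK0 (hK r ⟨hr.1.le, hr.2⟩) hd h.le
      calc ‖k r‖ ≤ max ‖L (Z t - Z (t - r)) / r‖ ‖A‖ := abs_min_le_max_abs_abs
        _ ≤ _ := max_le (h1.trans (by linarith [abs_nonneg A])) (by
            rw [Real.norm_eq_abs]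
            have : 0 ≤ K / d := by positivity
            linarith)
  have hk0 : Tendsto k (𝓝[>] 0) (𝓝 A) := by
    refine tendsto_const_nhds.congr' ?_
    filter_upwards [Ioc_mem_nhdsGT hd] with r hr using (hkA r hr).symm
  have h1 := tendsto_integral_poissonDeriv ht hkm.aestronglyMeasurable hkb hk0
  have h2 := (L.continuous.tendsto _).comp (tendsto_tameLimit hm hαβ hv hWv hZ ht)
  have h3 := h2.sub (h1.const_mul shellConst)
  simp only [smul_eq_mul] at h3
  refine le_of_forall_pos_le_add fun e he => ?_
  have h4 := (h3.eventually_le_const (lt_add_of_pos_right _ he))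
  rw [Filter.Eventually, mem_nhdsGT_iff_exists_Ioc_subset] at h4
  obtain ⟨δ, hδ, h5⟩ := h4
  refine le_of_tendsto_integral_rpow_omega hm
    (h := fun ξ => L (weight m ξ • mode m α β v Z t ξ)) ?_ hδ (fun l hl => ?_) ?_
  · intro ε hε
    have := L.integrable_comp (hi ε hε)
    simpa only [map_smul, smul_eq_mul] using this
  · have hl0 : 0 < l := hl.1
    have h6 := h5 hl
    simp only [Set.mem_ofPred_eq, Function.comp_apply] at h6
    refine le_trans ?_ h6
    have hint : Integrable fun ξ => Real.exp
      (-l * omega m ξ) • weight m ξ • mode m α β v Z t ξ := by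
      refine (integrable_memLp_smul (memLp_weight_mul_exp hm hl0) hmode).congr
        (Eventually.of_forall fun ξ => ?_)
      simp only [smul_smul, mul_comm]
    have h7 := L.integral_comp_comm hint
    rw [weightedMean_eq hm hαβ hv hZ ht.le hmode hl0] at h7
    simp only [map_smul, smul_eq_mul] at h7 ⊢
    rw [h7, smul_sub, ← add_sub_assoc, map_sub, map_smul, smul_eq_mul]
    refine sub_le_sub_left (mul_le_mul_of_nonneg_left ?_ shellConst_pos.le) _
    have hyi : IntervalIntegrable (fun r => poissonDeriv l r • (Z t - Z (t - r))) volume 0 t :=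
      ((continuous_poissonDeriv hl0).smul hy).intervalIntegrable 0 t
    rw [← L.intervalIntegral_comp_comm hyi]
    rw [intervalIntegral.integral_of_le ht.le, intervalIntegral.integral_of_le ht.le]
    have hpr : Continuous fun r => poissonDeriv l r * r :=
      (continuous_poissonDeriv hl0).mul continuous_id
    refine setIntegral_mono_on ?_ ?_ measurableSet_Ioc fun r hr => ?_
    · refine Integrable.mono' ((hpr.norm.integrableOn_Ioc (a := 0) (b := t)).mul_const
      (K / d + |A|))
        (hpr.measurable.mul hkm).aestronglyMeasurable ?_
      filter_upwards [self_mem_ae_restrict measurableSet_Ioc] with r hr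
      rw [norm_mul]
      exact mul_le_mul_of_nonneg_left (hkb r hr) (norm_nonneg _)
    · exact (L.continuous.comp ((continuous_poissonDeriv hl0).smul hy)).integrableOn_Ioc
    · have hp : 0 ≤ poissonDeriv l r := by
        have := hr.1
        unfold poissonDeriv
        positivity
      rw [map_smul, smul_eq_mul, mul_assoc]
      refine mul_le_mul_of_nonneg_left ?_ hp
      calc r * k r ≤ r * (L (Z t - Z (t - r)) / r) :=
            mul_le_mul_of_nonneg_left (min_le_left _ _) hr.1.le
        _ = _ := mul_div_cancel₀ _ hr.1.ne'
  · have h8 := (L.continuous.tendsto _).comp hV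
    refine h8.congr' ?_
    filter_upwards [self_mem_nhdsWithin] with ε hε
    rw [Function.comp_apply, ← L.integral_comp_comm (hi ε hε)]
    simp only [map_smul, smul_eq_mul]

/-- A continuous function with the initial value `0` is the integral of `G` if `G` bounds its left
slopes, component by component. One-sided bounds suffice, since they apply to `L` and to `-L`. -/
theorem eq_integral_of_slope {Z G : ℝ → Spinor} (hZ : Continuous Z) (hG : Continuous G)
    (hZ0 : Z 0 = 0) {τ : ℝ} (h : ∀ t ∈ Set.Ioc 0 τ, ∀ (L : Spinor →L[ℝ] ℝ) (A d : ℝ), 0 < d →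
      (∀ r ∈ Set.Ioc 0 d, A * r ≤ L (Z t - Z (t - r))) → A ≤ L (G t)) {t : ℝ}
    (ht : t ∈ Set.Icc 0 τ) : Z t = ∫ s in (0 : ℝ)..t, G s := by
  have key : ∀ L : Spinor →L[ℝ] ℝ, L (Z t) ≤ ∫ s in (0 : ℝ)..t, L (G s) := by
    intro L
    by_contra! hlt
    have hLG : Continuous fun s => L (G s) := L.continuous.comp hG
    have hii : ∀ a b, IntervalIntegrable (fun s => L (G s)) volume a b :=
      fun a b => hLG.intervalIntegrable a b
    have ht0 : 0 < t := by
      rcases ht.1.eq_or_lt with h0 | h0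
      · rw [← h0, hZ0] at hlt; simp at hlt
      · exact h0
    set φ : ℝ → ℝ := fun s => L (Z s) - ∫ x in (0 : ℝ)..s, L (G x) with hφ
    have hφt : 0 < φ t := sub_pos.2 hlt
    set A : ℝ := φ t / (2 * t) with hAdef
    have hA : 0 < A := by positivity
    have hAt : A * t = φ t / 2 := by rw [hAdef]; field_simp
    have hφc : Continuous fun s => φ s - A * s :=
      ((L.continuous.comp hZ).sub (intervalIntegral.continuous_primitive hii 0)).sub
        (continuous_const.mul continuous_id)
    -- at a maximum of `φ(s) - A s` the left slopes of `φ` are at least `A`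
    obtain ⟨p, hp, hmax⟩ := isCompact_Icc.exists_isMaxOn (s := Set.Icc 0 t) ⟨t, ht0.le, le_rfl⟩
      hφc.continuousOn
    have hp0 : 0 < p := by
      rcases hp.1.eq_or_lt with h0 | h0
      · have := hmax (show t ∈ Set.Icc 0 t from ⟨ht0.le, le_rfl⟩)
        simp only [Set.mem_ofPred_eq, ← h0, hφ, hZ0, map_zero,
          intervalIntegral.integral_same] at this
        simp only [hφ] at hAt hφt
        linarith
      · exact h0
    obtain ⟨d, hd, hdG⟩ := Metric.continuousAt_iff.1 (hLG.continuousAt (x := p)) (A / 2)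
      (half_pos hA)
    have := h p ⟨hp0, hp.2.trans ht.2⟩ L (A / 2 + L (G p)) (min (d / 2) p) (by positivity) ?_
    · linarith
    · intro r hr
      have hrp : r ≤ p := hr.2.trans (min_le_right _ _)
      have hrd : r < d := (hr.2.trans (min_le_left _ _)).trans_lt (by linarith)
      have h1 := hmax (show p - r ∈ Set.Icc 0 t from ⟨by linarith, by linarith [hr.1, hp.2]⟩)
      simp only [Set.mem_ofPred_eq, hφ] at h1
      have h2 := intervalIntegral.integral_add_adjacent_intervals (hii 0 (p - r)) (hii (p - r) p)
      have h3 : (L (G p) - A / 2) * r ≤ ∫ x in (p - r)..p, L (G x) := by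
        have h4 := intervalIntegral.integral_mono_on (a := p - r) (b := p) (by linarith [hr.1])
          (f := fun _ => L (G p) - A / 2) (by simp) (hii (p - r) p) (fun x hx => by
            have h5 := hdG (x := x) (by
              rw [Real.dist_eq, abs_lt]
              constructor <;> linarith [hx.1, hx.2, hr.1])
            rw [Real.dist_eq, abs_lt] at h5
            linarith)
        rw [intervalIntegral.integral_const, sub_sub_cancel, smul_eq_mul, mul_comm] at h4
        exact h4
      rw [map_sub]
      nlinarith
  have hGi : IntervalIntegrable G volume 0 t := hG.intervalIntegrable 0 t
  refine (SeparatingDual.eq_iff_forall_dual_eq (R := ℝ)).2 fun L => ?_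
  rw [← L.intervalIntegral_comp_comm hGi]
  refine le_antisymm (key L) ?_
  have h1 := key (-L)
  simp only [_root_.neg_apply, intervalIntegral.integral_neg] at h1
  linarith

/-! ### Abel means when the singular coefficient is differentiable -/

theorem hasDerivAt_arctan_div {l : ℝ} (hl : 0 < l) (r : ℝ) :
    HasDerivAt (fun r => Real.arctan (r / l)) (poisson l r) r := by
  refine (((hasDerivAt_id r).div_const l).arctan).congr_deriv ?_
  rw [poisson]
  simp only [id]
  field_simp

theorem integral_poisson_le {l : ℝ} (hl : 0 < l) (t : ℝ) :
    ∫ r in (0 : ℝ)..t, poisson l r ≤ Real.pi / 2 := by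
  rw [intervalIntegral.integral_eq_sub_of_hasDerivAt (fun r _ => hasDerivAt_arctan_div hl r)
    ((continuous_poisson hl).intervalIntegrable 0 t), zero_div, Real.arctan_zero, sub_zero]
  exact (Real.arctan_lt_pi_div_two _).le

theorem integral_poissonDeriv_mul_le {l : ℝ} (hl : 0 < l) {t : ℝ} (ht : 0 ≤ t) :
    ∫ r in (0 : ℝ)..t, poissonDeriv l r * r ≤ Real.pi / 2 := by
  have hd : ∀ r, HasDerivAt (fun r => Real.arctan (r / l) - r * poisson l r)
      (poissonDeriv l r * r) r := fun r => by
    refine ((hasDerivAt_arctan_div hl r).sub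
      ((hasDerivAt_id r).mul (hasDerivAt_poisson hl r))).congr_deriv ?_
    simp only [id]
    ring
  rw [intervalIntegral.integral_eq_sub_of_hasDerivAt (fun r _ => hd r)
    (((continuous_poissonDeriv hl).mul continuous_id).intervalIntegrable 0 t), zero_div,
    Real.arctan_zero, zero_mul, sub_zero, sub_zero]
  have h1 := Real.arctan_lt_pi_div_two (t / l)
  have h2 : 0 ≤ t * poisson l t := by unfold poisson; positivity
  linarith

theorem poisson_nonneg {l : ℝ} (hl : 0 < l) (r : ℝ) : 0 ≤ poisson l r := by
  unfold poisson; positivity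

theorem poissonDeriv_nonneg {l r : ℝ} (hl : 0 < l) (hr : 0 ≤ r) : 0 ≤ poissonDeriv l r := by
  unfold poissonDeriv; positivity

theorem norm_sub_le_of_eq_integral {Z G : ℝ → Spinor} (hG : Continuous G) {τ : ℝ}
    (hZG : ∀ t ∈ Set.Icc 0 τ, Z t = ∫ s in (0 : ℝ)..t, G s) {K : ℝ}
    (hK : ∀ s ∈ Set.Icc 0 τ, ‖G s‖ ≤ K) {t : ℝ} (ht : t ∈ Set.Icc 0 τ) {r : ℝ}
    (hr : r ∈ Set.Icc 0 t) : ‖Z t - Z (t - r)‖ ≤ K * r := by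
  rw [hZG t ht, hZG (t - r) ⟨by linarith [hr.2], by linarith [hr.1, ht.2]⟩,
    intervalIntegral.integral_interval_sub_left (hG.intervalIntegrable _ _)
    (hG.intervalIntegrable _ _)]
  have h := intervalIntegral.norm_integral_le_of_norm_le_const (a := t - r) (b := t) (f := G)
    (C := K)
    (fun s hs => by
      rw [Set.uIoc_of_le (by linarith [hr.1])] at hs
      exact hK s ⟨by linarith [hs.1, hr.2], hs.2.trans ht.2⟩)
  rwa [sub_sub_cancel, abs_of_nonneg hr.1] at h

theorem tendsto_weightedMean (hm : 0 < m) (hαβ : IsDiracMatrices α β)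
    {v : Space → Spinor} (hv : MemLp v 2) (hWv : Integrable fun ξ => weight m ξ • v ξ)
    {Z G : ℝ → Spinor} (hZ : Continuous Z) (hG : Continuous G) {τ : ℝ}
    (hZG : ∀ t ∈ Set.Icc 0 τ, Z t = ∫ s in (0 : ℝ)..t, G s) {t : ℝ} (ht : t ∈ Set.Ioc 0 τ)
    (hmode : MemLp (mode m α β v Z t) 2) :
    Tendsto (fun l => ∫ ξ, Real.exp (-l * omega m ξ) • weight m ξ • mode m α β v Z t ξ) (𝓝[>] 0)
      (𝓝 (tameLimit m α β v Z t - shellConst • (Real.pi / 2) • G t)) := by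
  obtain ⟨K, hK⟩ := isCompact_Icc.exists_bound_of_continuousOn (s := Set.Icc 0 τ) hG.continuousOn
  have ht' : t ∈ Set.Icc 0 τ := Set.Ioc_subset_Icc_self ht
  set k : ℝ → Spinor := fun r => r⁻¹ • (Z t - Z (t - r)) with hk
  have hy : Continuous fun r => Z t - Z (t - r) := by fun_prop
  have hkm : AEStronglyMeasurable k (volume.restrict (Set.Ioc 0 t)) :=
    (measurable_inv.aestronglyMeasurable.smul hy.aestronglyMeasurable)
  have hkb : ∀ r ∈ Set.Ioc 0 t, ‖k r‖ ≤ K := fun r hr => by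
    have h1 := norm_sub_le_of_eq_integral hG hZG hK ht' (Set.Ioc_subset_Icc_self hr)
    rw [hk, norm_smul, norm_inv, Real.norm_of_nonneg hr.1.le, inv_mul_le_iff₀ hr.1, mul_comm r]
    exact h1
  have hk0 : Tendsto k (𝓝[>] 0) (𝓝 (G t)) := by
    have h1 : HasDerivAt (fun t => ∫ s in (0 : ℝ)..t, G s) (G t) t :=
      intervalIntegral.integral_hasDerivAt_right (hG.intervalIntegrable 0 t)
        (hG.stronglyMeasurableAtFilter _ _) hG.continuousAt
    have h2 := hasDerivAt_iff_tendsto_slope_zero.1 h1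
    have h3 : Tendsto (fun r : ℝ => -r) (𝓝[>] 0) (𝓝[≠] 0) := by
      refine tendsto_nhdsWithin_iff.2 ⟨?_, ?_⟩
      · have := (continuous_neg (G := ℝ)).tendsto 0
        rw [neg_zero] at this
        exact this.mono_left nhdsWithin_le_nhds
      · filter_upwards [self_mem_nhdsWithin] with r hr
        exact neg_ne_zero.2 (ne_of_gt hr)
    refine (h2.comp h3).congr' ?_
    filter_upwards [Ioc_mem_nhdsGT ht.1] with r hr
    simp only [Function.comp_apply, hk]
    rw [hZG t ht', hZG (t - r) ⟨by linarith [hr.2], by linarith [hr.1, ht.2]⟩, inv_neg,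
      ← sub_eq_add_neg, neg_smul, ← smul_neg, neg_sub]
  have h1 := tendsto_integral_poissonDeriv ht.1 hkm hkb hk0
  have h2 := (tendsto_tameLimit hm hαβ hv hWv hZ ht.1).sub (h1.const_smul shellConst)
  refine h2.congr' ?_
  filter_upwards [self_mem_nhdsWithin] with l hl
  rw [weightedMean_eq hm hαβ hv hZ ht.1.le hmode hl, smul_sub _ _ (∫ r in (0 : ℝ)..t, _),
    ← add_sub_assoc]
  congr 2
  rw [intervalIntegral.integral_of_le ht.1.le, intervalIntegral.integral_of_le ht.1.le]
  refine setIntegral_congr_fun measurableSet_Ioc fun r hr => ?_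
  simp only [hk, smul_smul]
  rw [mul_assoc, mul_inv_cancel₀ hr.1.ne', mul_one]

theorem exists_norm_weightedMean_le (hm : 0 < m) (hαβ : IsDiracMatrices α β)
    {v : Space → Spinor} (hv : MemLp v 2) (hWv : Integrable fun ξ => weight m ξ • v ξ)
    {Z G : ℝ → Spinor} (hZ : Continuous Z) (hG : Continuous G) {τ : ℝ}
    (hZG : ∀ t ∈ Set.Icc 0 τ, Z t = ∫ s in (0 : ℝ)..t, G s)
    (hmode : ∀ t ∈ Set.Icc 0 τ, MemLp (mode m α β v Z t) 2) :
    ∃ K, ∀ l > 0, ∀ t ∈ Set.Icc 0 τ,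
      ‖∫ ξ, Real.exp (-l * omega m ξ) • weight m ξ • mode m α β v Z t ξ‖ ≤ K := by
  obtain ⟨K, hK⟩ := isCompact_Icc.exists_bound_of_continuousOn (s := Set.Icc 0 τ) hG.continuousOn
  obtain ⟨KZ, hKZ⟩ := isCompact_Icc.exists_bound_of_continuousOn (s := Set.Icc 0 τ) hZ.continuousOn
  obtain ⟨K1, hK1⟩ := exists_norm_tameMean_le hm hαβ hv hWv hZ τ
  set b := Matrix.toEuclideanCLM (n := Fin 4) (𝕜 := ℂ) β with hb
  refine ⟨K1 + shellConst * (K / 2 + m * (‖b‖ * (KZ * (Real.pi / 2))) + K * (Real.pi / 2)),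
    fun l hl t ht => ?_⟩
  have h0 : (0 : ℝ) ∈ Set.Icc 0 τ := ⟨le_rfl, ht.1.trans ht.2⟩
  have hK0 : 0 ≤ K := (norm_nonneg _).trans (hK 0 h0)
  have hKZ0 : 0 ≤ KZ := (norm_nonneg _).trans (hKZ 0 h0)
  have hinc : ∀ r ∈ Set.Icc 0 t, ‖Z t - Z (t - r)‖ ≤ K * r := fun r hr =>
    norm_sub_le_of_eq_integral hG hZG hK ht hr
  rw [weightedMean_eq hm hαβ hv hZ ht.1 (hmode t ht) hl]
  refine (norm_add_le _ _).trans (add_le_add (hK1 l hl t ht) ?_)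
  rw [norm_smul, Real.norm_of_nonneg shellConst_pos.le]
  refine mul_le_mul_of_nonneg_left ?_ shellConst_pos.le
  refine (norm_sub_le _ _).trans (add_le_add ((norm_add_le _ _).trans (add_le_add ?_ ?_)) ?_)
  · have h1 := hinc t ⟨ht.1, le_rfl⟩
    have hZ0 : Z 0 = 0 := by rw [hZG 0 h0, intervalIntegral.integral_same]
    rw [sub_self, hZ0, sub_zero] at h1
    rw [norm_neg, norm_smul, Real.norm_of_nonneg (poisson_nonneg hl t)]
    calc poisson l t * ‖Z t‖ ≤ poisson l t * (K * t) :=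
          mul_le_mul_of_nonneg_left h1 (poisson_nonneg hl t)
      _ ≤ K / 2 := by
          rw [poisson, div_mul_eq_mul_div, div_le_iff₀ (by positivity)]
          nlinarith [mul_nonneg hK0 (sq_nonneg (l - t))]
  · rw [norm_smul, norm_mul, Complex.norm_I, one_mul, Complex.norm_real, Real.norm_of_nonneg hm.le]
    refine mul_le_mul_of_nonneg_left ((b.le_opNorm _).trans
      (mul_le_mul_of_nonneg_left ?_ (norm_nonneg _))) hm.le
    have hyc : Continuous fun r => Z (t - r) := by fun_prop
    calc ‖∫ r in (0 : ℝ)..t, poisson l r • Z (t - r)‖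
        ≤ ∫ r in (0 : ℝ)..t, KZ * poisson l r := by
          refine intervalIntegral.norm_integral_le_of_norm_le ht.1 (Eventually.of_forall fun r hr =>
            ?_)
            (((continuous_poisson hl).const_mul KZ).intervalIntegrable 0 t)
          rw [norm_smul, Real.norm_of_nonneg (poisson_nonneg hl r), mul_comm]
          exact mul_le_mul_of_nonneg_right
            (hKZ _ ⟨by linarith [hr.2], by linarith [hr.1, ht.2]⟩) (poisson_nonneg hl r)
      _ ≤ KZ * (Real.pi / 2) := by
          rw [intervalIntegral.integral_const_mul]
          exact mul_le_mul_of_nonneg_left (integral_poisson_le hl t) hKZ0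
  · have hpr : Continuous fun r => poissonDeriv l r * r :=
      (continuous_poissonDeriv hl).mul continuous_id
    calc ‖∫ r in (0 : ℝ)..t, poissonDeriv l r • (Z t - Z (t - r))‖
        ≤ ∫ r in (0 : ℝ)..t, K * (poissonDeriv l r * r) := by
          refine intervalIntegral.norm_integral_le_of_norm_le ht.1 (Eventually.of_forall fun r hr =>
            ?_)
            ((hpr.const_mul K).intervalIntegrable 0 t)
          have hp := poissonDeriv_nonneg hl hr.1.le
          rw [norm_smul, Real.norm_of_nonneg hp]
          exact (mul_le_mul_of_nonneg_left (hinc r (Set.Ioc_subset_Icc_self hr)) hp).trans_eq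
            (by ring)
      _ ≤ K * (Real.pi / 2) := by
          rw [intervalIntegral.integral_const_mul]
          exact mul_le_mul_of_nonneg_left (integral_poissonDeriv_mul_le hl ht.1) hK0

/-- Removal of the weight from the Abel means. -/
theorem integral_exp_mode_eq (hm : 0 < m) {g : Space → Spinor} (hg : MemLp g 2) {l : ℝ}
    (hl : 0 < l) :
    ∫ ξ, Real.exp (-l * omega m ξ) • g ξ =
      (∫ ξ, Real.exp (-l * omega m ξ) • weight m ξ • g ξ)
        - ∫ ξ, Real.exp (-l * omega m ξ) • (weight m ξ - 1) • g ξ := by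
  have h1 : Integrable fun ξ => Real.exp (-l * omega m ξ) • weight m ξ • g ξ := by
    refine (integrable_memLp_smul (memLp_weight_mul_exp hm hl) hg).congr
      (Eventually.of_forall fun ξ => ?_)
    simp only [smul_smul, mul_comm]
  have h2 := integrable_exp_smul hm (integrable_memLp_smul (memLp_weight_sub_one hm) hg) hl
  rw [← integral_sub h1 h2]
  congr 1
  funext ξ
  module

theorem tendsto_integral_exp_mode (hm : 0 < m) (hαβ : IsDiracMatrices α β)
    {v : Space → Spinor} (hv : MemLp v 2) (hWv : Integrable fun ξ => weight m ξ • v ξ)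
    {Z G : ℝ → Spinor} (hZ : Continuous Z) (hG : Continuous G) {τ : ℝ}
    (hZG : ∀ t ∈ Set.Icc 0 τ, Z t = ∫ s in (0 : ℝ)..t, G s) {t : ℝ} (ht : t ∈ Set.Ioc 0 τ)
    (hmode : MemLp (mode m α β v Z t) 2) :
    Tendsto (fun l => ∫ ξ, Real.exp (-l * omega m ξ) • mode m α β v Z t ξ) (𝓝[>] 0)
      (𝓝 (tameLimit m α β v Z t - shellConst • (Real.pi / 2) • G t
        - ∫ ξ, (weight m ξ - 1) • mode m α β v Z t ξ)) := by
  refine ((tendsto_weightedMean hm hαβ hv hWv hZ hG hZG ht hmode).sub (tendsto_integral_exp_smul hm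
    (integrable_memLp_smul (memLp_weight_sub_one hm) hmode))).congr' ?_
  filter_upwards [self_mem_nhdsWithin] with l hl
  exact (integral_exp_mode_eq hm hmode hl).symm

theorem exists_norm_integral_exp_mode_le (hm : 0 < m) (hαβ : IsDiracMatrices α β)
    {v : Space → Spinor} (hv : MemLp v 2) (hWv : Integrable fun ξ => weight m ξ • v ξ)
    {Z G : ℝ → Spinor} (hZ : Continuous Z) (hG : Continuous G) {τ : ℝ}
    (hZG : ∀ t ∈ Set.Icc 0 τ, Z t = ∫ s in (0 : ℝ)..t, G s)
    (hmode : ∀ t ∈ Set.Icc 0 τ, MemLp (mode m α β v Z t) 2) {K₀ : ℝ}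
    (hK₀ : ∀ t ∈ Set.Icc 0 τ, ∫ ξ, ‖(weight m ξ - 1) • mode m α β v Z t ξ‖ ≤ K₀) :
    ∃ K, ∀ l > 0, ∀ t ∈ Set.Icc 0 τ,
      ‖∫ ξ, Real.exp (-l * omega m ξ) • mode m α β v Z t ξ‖ ≤ K := by
  obtain ⟨K, hK⟩ := exists_norm_weightedMean_le hm hαβ hv hWv hZ hG hZG hmode
  refine ⟨K + K₀, fun l hl t ht => ?_⟩
  rw [integral_exp_mode_eq hm (hmode t ht) hl]
  exact (norm_sub_le _ _).trans (add_le_add (hK l hl t ht) ((norm_integral_exp_smul_le hm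
    (integrable_memLp_smul (memLp_weight_sub_one hm) (hmode t ht)) hl).trans (hK₀ t ht)))

/-! ### The energy of the modes -/

theorem continuous_primitive_source (hm : 0 < m) {Z : ℝ → Spinor} (hZ : Continuous Z) :
    Continuous fun p : ℝ × Space => ∫ s in (0 : ℝ)..p.1, source m α β Z s p.2 := by
  have h0 : Continuous fun q : (ℝ × Space) × ℝ => (q.2, q.1.2) := by fun_prop
  have h := (continuous_source (α := α) (β := β) hm hZ).comp' h0
  exact intervalIntegral.continuous_parametric_intervalIntegral_of_continuous (a₀ := 0)
    (f := fun (p : ℝ × Space) (s : ℝ) => source m α β Z s p.2) h continuous_fst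

theorem norm_source_le (hm : 0 < m) (hαβ : IsDiracMatrices α β) {Z : ℝ → Spinor} (s : ℝ)
    (ξ : Space) : ‖source m α β Z s ξ‖ ≤ 2 * (1 / m) * ‖Z s‖ := by
  have hω := omega_pos hm ξ
  refine (norm_freeProp_le hm hαβ _ _ _).trans ?_
  rw [norm_smul, Complex.norm_I, one_mul, norm_diracSymbol hm hαβ, norm_smul, Complex.norm_real,
    Real.norm_of_nonneg (by positivity), mul_assoc]
  refine mul_le_mul_of_nonneg_left ?_ zero_le_two
  rw [← mul_assoc]
  refine mul_le_mul_of_nonneg_right ?_ (norm_nonneg _)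
  have : omega m ξ * (1 / omega m ξ ^ 2) = 1 / omega m ξ := by field_simp
  rw [this]
  exact one_div_le_one_div_of_le hm (le_omega ξ)

theorem exists_norm_mode_le (hm : 0 < m) (hαβ : IsDiracMatrices α β) (v : Space → Spinor)
    {Z : ℝ → Spinor} (hZ : Continuous Z) (τ : ℝ) : ∃ K, ∀ t ∈ Set.Icc 0 τ, ∀ ξ,
      ‖mode m α β v Z t ξ‖ ≤ 2 * ‖v ξ‖ + K := by
  obtain ⟨KZ, hKZ⟩ := isCompact_Icc.exists_bound_of_continuousOn (s := Set.Icc 0 τ) hZ.continuousOn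
  refine ⟨2 * (2 * (1 / m) * KZ * τ) + 1 / m ^ 2 * KZ, fun t ht ξ => ?_⟩
  have hKZ0 : 0 ≤ KZ := (norm_nonneg _).trans (hKZ t ht)
  have h1 : ‖∫ s in (0 : ℝ)..t, source m α β Z s ξ‖ ≤ 2 * (1 / m) * KZ * τ := by
    have := intervalIntegral.norm_integral_le_of_norm_le_const (a := 0) (b := t)
      (f := fun s => source m α β Z s ξ) (C := 2 * (1 / m) * KZ) (fun s hs => by
        rw [Set.uIoc_of_le ht.1] at hs
        exact (norm_source_le hm hαβ s ξ).trans (mul_le_mul_of_nonneg_left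
          (hKZ s ⟨hs.1.le, hs.2.trans ht.2⟩) (by positivity)))
    rw [sub_zero, abs_of_nonneg ht.1] at this
    exact this.trans (mul_le_mul_of_nonneg_left ht.2 (by positivity))
  have h2 : ‖((1 / omega m ξ ^ 2 : ℝ) : ℂ) • Z t‖ ≤ 1 / m ^ 2 * KZ := by
    rw [norm_smul, Complex.norm_real, Real.norm_of_nonneg (by positivity)]
    have h3 := hKZ t ht
    have h4 := le_omega (m := m) ξ
    gcongr
  refine (norm_sub_le _ _).trans ?_
  have h5 := norm_freeProp_le hm hαβ t ξ (v ξ + ∫ s in (0 : ℝ)..t, source m α β Z s ξ)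
  have h6 := norm_add_le (v ξ) (∫ s in (0 : ℝ)..t, source m α β Z s ξ)
  linarith

theorem continuous_mode (hm : 0 < m) (v : Space → Spinor)
    {Z : ℝ → Spinor} (hZ : Continuous Z) (ξ : Space) : Continuous fun t => mode m α β v Z t ξ := by
  have h0 := (continuous_primitive_source (α := α) (β := β) hm hZ).comp' (Continuous.prodMk_left ξ)
  have h1 := (continuous_const (y := v ξ)).add h0
  have h2 := (continuous_freeProp (α := α) (β := β) hm).comp' (Continuous.prodMk_left ξ)
  exact (isBoundedBilinearMap_apply.continuous.comp (h2.prodMk h1)).sub (hZ.const_smul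
    ((1 / omega m ξ ^ 2 : ℝ) : ℂ))

theorem aestronglyMeasurable_mode (hm : 0 < m) {v : Space → Spinor}
    (hv : AEStronglyMeasurable v) {Z : ℝ → Spinor} (hZ : Continuous Z) (μ : Measure ℝ) [SFinite μ] :
    AEStronglyMeasurable (fun p : ℝ × Space => mode m α β v Z p.1 p.2) (μ.prod volume) := by
  have h1 := (continuous_primitive_source (α := α) (β := β) hm hZ)
  have h2 := (continuous_freeProp (α := α) (β := β) hm)
  have h3 : Continuous fun p : ℝ × Space => ((1 / omega m p.2 ^ 2 : ℝ) : ℂ) • Z p.1 := by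
    have h0 : Continuous fun ξ : Space => 1 / omega m ξ ^ 2 :=
      continuous_const.div ((continuous_omega m).pow 2) fun ξ => (pow_pos (omega_pos hm ξ) 2).ne'
    exact (Complex.continuous_ofReal.comp (h0.comp continuous_snd)).smul (hZ.comp continuous_fst)
  exact (aestronglyMeasurable_clm_apply h2.aestronglyMeasurable
    (hv.comp_snd.add h1.aestronglyMeasurable)).sub h3.aestronglyMeasurable

/-- The modes solve `∂ₜ û = -i D û - ω⁻² Z'`. -/
theorem hasDerivAt_mode (hm : 0 < m) (hαβ : IsDiracMatrices α β) (v : Space → Spinor)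
    {Z : ℝ → Spinor} (hZ : Continuous Z) {t : ℝ} {G : Spinor} (hG : HasDerivAt Z G t) (ξ : Space) :
    HasDerivAt (fun t => mode m α β v Z t ξ)
      (-Complex.I • diracSymbol m α β ξ (mode m α β v Z t ξ) - ((1 / omega m ξ ^ 2 : ℝ) : ℂ) • G)
      t := by
  have hs := (continuous_source (α := α) (β := β) hm hZ).comp' (Continuous.prodMk_left ξ)
  have h1 : HasDerivAt (fun t => v ξ + ∫ s in (0 : ℝ)..t, source m α β Z s ξ)
      (source m α β Z t ξ) t :=
    (intervalIntegral.integral_hasDerivAt_right (hs.intervalIntegrable 0 t)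
      (hs.stronglyMeasurableAtFilter _ _) hs.continuousAt).const_add (v ξ)
  have h2 := (hasDerivAt_freeProp_apply hm hαβ t ξ h1).sub
    (hG.const_smul ((1 / omega m ξ ^ 2 : ℝ) : ℂ))
  refine h2.congr_deriv ?_
  rw [source, freeProp_freeProp_neg hm hαβ, sub_self, freeProp_zero]
  rw [mode, map_sub]
  change _ + Complex.I • diracSymbol m α β ξ _ - _ = _
  module

/-- The energy identity at a fixed frequency. The term `-i D û` does not contribute, because `D` is
Hermitian. -/
theorem omega_sq_mul_norm_mode_sq (hm : 0 < m) (hαβ : IsDiracMatrices α β) (v : Space → Spinor)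
    {Z G : ℝ → Spinor} (hZ : Continuous Z) (hG : Continuous G) {τ : ℝ} (hZ0 : Z 0 = 0)
    (hZG : ∀ t ∈ Set.Ioo 0 τ, HasDerivAt Z (G t) t) {t : ℝ} (ht : t ∈ Set.Icc 0 τ) (ξ : Space) :
    omega m ξ ^ 2 * ‖mode m α β v Z t ξ‖ ^ 2 = omega m ξ ^ 2 * ‖v ξ‖ ^ 2
      - 2 * ∫ s in (0 : ℝ)..t, (inner ℂ (mode m α β v Z s ξ) (G s)).re := by
  have hω : omega m ξ ≠ 0 := (omega_pos hm ξ).ne'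
  have hc := continuous_mode (α := α) (β := β) hm v hZ ξ
  have hn : ∀ y : Spinor, ‖y‖ ^ 2 = (inner ℂ y y).re := fun y => by
    rw [← inner_self_eq_norm_sq (𝕜 := ℂ)]; rfl
  have hd : ∀ s ∈ Set.Ioo 0 t, HasDerivAt (fun s => omega m ξ ^ 2 * ‖mode m α β v Z s ξ‖ ^ 2)
      (-2 * (inner ℂ (mode m α β v Z s ξ) (G s)).re) s := fun s hs => by
    have h1 := hasDerivAt_mode hm hαβ v hZ (hZG s ⟨hs.1, hs.2.trans_le ht.2⟩) ξ
    have h2 := (Complex.reCLM.hasFDerivAt.comp_hasDerivAt s (h1.inner ℂ h1)).const_mul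
      (omega m ξ ^ 2)
    simp_rw [hn]
    refine h2.congr_deriv ?_
    simp only [Complex.reCLM_apply, inner_sub_right, inner_sub_left, inner_smul_left,
      inner_smul_right, inner_diracSymbol hαβ, map_neg, Complex.conj_I, Complex.conj_ofReal]
    have h3 : (inner ℂ (G s) (mode m α β v Z s ξ)).re = (inner ℂ (mode m α β v Z s ξ)
      (G s)).re := by
      rw [← inner_conj_symm, Complex.conj_re]
    simp only [Complex.add_re, Complex.sub_re, Complex.re_ofReal_mul, h3, neg_neg, neg_mul,
      Complex.neg_re]
    field_simp
    ring
  have hi : Continuous fun s => -2 * (inner ℂ (mode m α β v Z s ξ) (G s)).re :=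
    continuous_const.mul (Complex.continuous_re.comp (hc.inner hG))
  have hmc : Continuous fun s => omega m ξ ^ 2 * ‖mode m α β v Z s ξ‖ ^ 2 :=
    continuous_const.mul (hc.norm.pow 2)
  have h := intervalIntegral.integral_eq_sub_of_hasDerivAt_of_le ht.1 hmc.continuousOn hd
    (hi.intervalIntegrable 0 t)
  have h0 : mode m α β v Z 0 ξ = v ξ := by
    rw [mode, intervalIntegral.integral_same, hZ0, smul_zero, sub_zero, add_zero, freeProp_zero]
    rfl
  rw [intervalIntegral.integral_const_mul, h0] at h
  linarith

theorem integrable_exp_neg_omega (hm : 0 < m) {l : ℝ} (hl : 0 < l) :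
    Integrable fun ξ => Real.exp (-l * omega m ξ) := by
  have h := (memLp_two_iff_integrable_sq (memLp_exp_neg_omega hm (half_pos hl)).1).1
    (memLp_exp_neg_omega hm (half_pos hl))
  refine h.congr (Eventually.of_forall fun ξ => ?_)
  simp only
  rw [← Real.exp_nat_mul]
  congr 1
  push_cast
  ring

/-- The energy identity for the Abel means. -/
theorem integral_exp_energy (hm : 0 < m) (hαβ : IsDiracMatrices α β) {v : Space → Spinor}
    (hv : Integrable v) (hωv : Integrable fun ξ => omega m ξ ^ 2 * ‖v ξ‖ ^ 2)
    {Z G : ℝ → Spinor} (hZ : Continuous Z) (hG : Continuous G) {τ : ℝ} (hZ0 : Z 0 = 0)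
    (hZG : ∀ t ∈ Set.Ioo 0 τ, HasDerivAt Z (G t) t) {t : ℝ} (ht : t ∈ Set.Icc 0 τ) {l : ℝ}
    (hl : 0 < l) :
    Integrable (fun ξ => Real.exp (-l * omega m ξ) * (omega m ξ ^ 2 * ‖mode m α β v Z t ξ‖ ^ 2)) ∧
    IntervalIntegrable (fun s => (inner ℂ (∫ ξ, Real.exp (-l * omega m ξ) • mode m α β v Z s ξ)
      (G s)).re) volume 0 t ∧
    ∫ ξ, Real.exp (-l * omega m ξ) * (omega m ξ ^ 2 * ‖mode m α β v Z t ξ‖ ^ 2) =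
      (∫ ξ, Real.exp (-l * omega m ξ) * (omega m ξ ^ 2 * ‖v ξ‖ ^ 2)) -
        2 * ∫ s in (0 : ℝ)..t, (inner ℂ (∫ ξ, Real.exp (-l * omega m ξ) • mode m α β v Z s ξ)
          (G s)).re := by
  obtain ⟨K, hK⟩ := exists_norm_mode_le hm hαβ v hZ τ
  obtain ⟨KG, hKG⟩ := isCompact_Icc.exists_bound_of_continuousOn (s := Set.Icc 0 τ) hG.continuousOn
  have hKG0 : 0 ≤ KG := (norm_nonneg _).trans (hKG t ht)
  have hexp : Measurable fun ξ => Real.exp (-l * omega m ξ) :=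
    ((measurable_omega m).const_mul _).exp
  have hb : Integrable fun ξ => Real.exp (-l * omega m ξ) * (2 * ‖v ξ‖ + K) := by
    simp_rw [mul_add]
    refine Integrable.add ?_ ((integrable_exp_neg_omega hm hl).mul_const K)
    refine (hv.norm.const_mul 2).mono' (hexp.aestronglyMeasurable.mul (hv.1.norm.const_mul 2))
      (Eventually.of_forall fun ξ => ?_)
    rw [Real.norm_of_nonneg (by positivity)]
    exact mul_le_of_le_one_left (by positivity) (exp_neg_mul_omega_le_one hm hl ξ)
  have hmodeI : ∀ s ∈ Set.Icc 0 τ, Integrable fun ξ => Real.exp (-l * omega m ξ) •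
      mode m α β v Z s ξ := fun s hs => by
    have hms : AEStronglyMeasurable (mode m α β v Z s) := by
      have h1 : Continuous fun ξ => ((1 / omega m ξ ^ 2 : ℝ) : ℂ) • Z s :=
        (Complex.continuous_ofReal.comp (continuous_const.div ((continuous_omega m).pow 2)
          fun ξ => (pow_pos (omega_pos hm ξ) 2).ne')).smul continuous_const
      exact (aestronglyMeasurable_freeProp hm s (hv.1.add
        (continuous_integral_source hm hZ s).aestronglyMeasurable)).sub h1.aestronglyMeasurable
    refine hb.mono' (hexp.aestronglyMeasurable.smul hms) (Eventually.of_forall fun ξ => ?_)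
    rw [norm_smul, Real.norm_of_nonneg (Real.exp_pos _).le]
    exact mul_le_mul_of_nonneg_left (hK s hs ξ) (Real.exp_pos _).le
  have hF : Integrable (Function.uncurry fun (s : ℝ) (ξ : Space) =>
      Real.exp (-l * omega m ξ) * (inner ℂ (mode m α β v Z s ξ) (G s)).re)
      ((volume.restrict (Set.Ioc 0 t)).prod volume) := by
    have hone : IntegrableOn (fun _ : ℝ => KG) (Set.Ioc 0 t) := by simp
    refine (hone.mul_prod hb).mono' ?_ ?_
    · refine (hexp.comp measurable_snd).aestronglyMeasurable.mul
        (Complex.continuous_re.comp_aestronglyMeasurable ?_)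
      exact (aestronglyMeasurable_mode hm hv.1 hZ _).inner
        (hG.comp continuous_fst).aestronglyMeasurable
    · have h1 : ∀ᵐ p ∂((volume.restrict (Set.Ioc 0 t)).prod (volume : Measure Space)),
          p.1 ∈ Set.Ioc 0 t :=
        Measure.quasiMeasurePreserving_fst.ae (self_mem_ae_restrict measurableSet_Ioc)
      filter_upwards [h1] with p hp
      have hp' : p.1 ∈ Set.Icc 0 τ := ⟨hp.1.le, hp.2.trans ht.2⟩
      simp only [Function.uncurry, norm_mul, Real.norm_of_nonneg (Real.exp_pos _).le]
      have h2 : ‖(inner ℂ (mode m α β v Z p.1 p.2) (G p.1)).re‖ ≤ (2 * ‖v p.2‖ + K) * KG :=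
        (Complex.abs_re_le_norm _).trans ((norm_inner_le_norm _ _).trans
          (mul_le_mul (hK _ hp' _) (hKG _ hp') (norm_nonneg _)
            ((norm_nonneg _).trans (hK _ hp' _))))
      calc _ ≤ Real.exp (-l * omega m p.2) * ((2 * ‖v p.2‖ + K) * KG) :=
            mul_le_mul_of_nonneg_left h2 (Real.exp_pos _).le
        _ = _ := by ring
  have hin : ∀ s ∈ Set.Ioc 0 t,
      ∫ ξ, Real.exp (-l * omega m ξ) * (inner ℂ (mode m α β v Z s ξ) (G s)).re =
      (inner ℂ (∫ ξ, Real.exp (-l * omega m ξ) • mode m α β v Z s ξ) (G s)).re := fun s hs => by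
    have hs' : s ∈ Set.Icc 0 τ := ⟨hs.1.le, hs.2.trans ht.2⟩
    have h1 : ∀ y : Spinor, (inner ℂ y (G s)).re = (inner ℂ (G s) y).re :=
      fun y => by rw [← inner_conj_symm, Complex.conj_re]
    simp_rw [h1]
    have h2 := ((Complex.reCLM.comp ((innerSL ℂ (G s)).restrictScalars ℝ))).integral_comp_comm
      (hmodeI s hs')
    simp only [ContinuousLinearMap.comp_apply, ContinuousLinearMap.coe_restrictScalars',
      innerSL_apply_apply, Complex.reCLM_apply] at h2
    rw [← h2]
    congr 1
    funext ξ
    rw [← Complex.coe_smul, inner_smul_right, Complex.re_ofReal_mul]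
  have hvE : Integrable fun ξ => Real.exp (-l * omega m ξ) * (omega m ξ ^ 2 * ‖v ξ‖ ^ 2) := by
    refine hωv.mono (hexp.aestronglyMeasurable.mul hωv.1) (Eventually.of_forall fun ξ => ?_)
    rw [norm_mul, Real.norm_of_nonneg (Real.exp_pos _).le]
    exact mul_le_of_le_one_left (norm_nonneg _) (exp_neg_mul_omega_le_one hm hl ξ)
  have e : ∀ ξ, Real.exp (-l * omega m ξ) * (omega m ξ ^ 2 * ‖mode m α β v Z t ξ‖ ^ 2) =
      Real.exp (-l * omega m ξ) * (omega m ξ ^ 2 * ‖v ξ‖ ^ 2) - 2 * ∫ s in Set.Ioc 0 t,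
        Real.exp (-l * omega m ξ) * (inner ℂ (mode m α β v Z s ξ) (G s)).re := fun ξ => by
    rw [omega_sq_mul_norm_mode_sq hm hαβ v hZ hG hZ0 hZG ht ξ, integral_const_mul,
      intervalIntegral.integral_of_le ht.1]
    ring
  have hFr := hF.integral_prod_right.const_mul 2
  have hFl := hF.integral_prod_left
  simp only [Function.uncurry] at hFr hFl
  simp_rw [e]
  refine ⟨hvE.sub hFr, ?_, ?_⟩
  · rw [intervalIntegrable_iff_integrableOn_Ioc_of_le ht.1]
    exact hFl.congr (by filter_upwards
      [self_mem_ae_restrict measurableSet_Ioc] with s hs using hin s hs)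
  · rw [integral_sub hvE hFr, integral_const_mul, intervalIntegral.integral_of_le ht.1,
      ← setIntegral_congr_fun measurableSet_Ioc hin, integral_integral_swap hF]

/-- Monotone convergence for Abel means of a nonnegative function. -/
theorem integrable_of_tendsto_exp (hm : 0 < m) {h : Space → ℝ} (hh : AEStronglyMeasurable h)
    (h0 : ∀ ξ, 0 ≤ h ξ) (hi : ∀ l > 0, Integrable fun ξ => Real.exp (-l * omega m ξ) * h ξ) {J : ℝ}
    (hJ : Tendsto (fun l => ∫ ξ, Real.exp (-l * omega m ξ) * h ξ) (𝓝[>] 0) (𝓝 J)) :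
    Integrable h ∧ ∫ ξ, h ξ = J := by
  have hseq : Tendsto (fun n : ℕ => 1 / ((n : ℝ) + 1)) atTop (𝓝[>] 0) :=
    tendsto_nhdsWithin_iff.2 ⟨tendsto_one_div_add_atTop_nhds_zero_nat,
      Eventually.of_forall fun n => by simp only [Set.mem_Ioi]; positivity⟩
  have hnn : ∀ (l : ℝ) ξ, 0 ≤ Real.exp (-l * omega m ξ) * h ξ := fun l ξ =>
    mul_nonneg (Real.exp_pos _).le (h0 ξ)
  have h1 : Tendsto (fun n : ℕ => ∫⁻ ξ, ENNReal.ofReal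
      (Real.exp (-(1 / ((n : ℝ) + 1)) * omega m ξ) * h ξ)) atTop
      (𝓝 (∫⁻ ξ, ENNReal.ofReal (h ξ))) := by
    refine lintegral_tendsto_of_tendsto_of_monotone (fun n => ?_) (Eventually.of_forall fun ξ => ?_)
      (Eventually.of_forall fun ξ => ?_)
    · exact (hi _ (by positivity)).1.aemeasurable.ennreal_ofReal
    · intro a b hab
      refine ENNReal.ofReal_le_ofReal (mul_le_mul_of_nonneg_right (Real.exp_le_exp.2 ?_) (h0 ξ))
      refine mul_le_mul_of_nonneg_right (neg_le_neg ?_) (omega_pos hm ξ).le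
      exact one_div_le_one_div_of_le (by positivity) (by gcongr)
    · refine (ENNReal.continuous_ofReal.tendsto _).comp ?_
      simpa using (((tendsto_exp_neg_mul_nhds_zero (omega m ξ)).comp hseq).mul_const (h ξ))
  have h2 : ∀ n : ℕ, ∫⁻ ξ, ENNReal.ofReal (Real.exp (-(1 / ((n : ℝ) + 1)) * omega m ξ) * h ξ) =
      ENNReal.ofReal (∫ ξ, Real.exp (-(1 / ((n : ℝ) + 1)) * omega m ξ) * h ξ) := fun n =>
    (ofReal_integral_eq_lintegral_ofReal (hi _ (by positivity))
      (Eventually.of_forall fun ξ => hnn _ ξ)).symm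
  simp_rw [h2] at h1
  have h3 : ∫⁻ ξ, ENNReal.ofReal (h ξ) = ENNReal.ofReal J :=
    tendsto_nhds_unique h1 ((ENNReal.continuous_ofReal.tendsto _).comp (hJ.comp hseq))
  have hint : Integrable h := by
    refine ⟨hh, ?_⟩
    rw [hasFiniteIntegral_iff_ofReal (Eventually.of_forall h0), h3]
    exact ENNReal.ofReal_lt_top
  refine ⟨hint, ?_⟩
  have hJ0 : 0 ≤ J := ge_of_tendsto hJ (Eventually.of_forall fun l => integral_nonneg (hnn l))
  rw [← ofReal_integral_eq_lintegral_ofReal hint (Eventually.of_forall h0)] at h3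
  exact (ENNReal.ofReal_eq_ofReal_iff (integral_nonneg h0) hJ0).1 h3

/-- The energy identity, under boundedness and convergence of the Abel means of the modes. -/
theorem integral_energy (hm : 0 < m) (hαβ : IsDiracMatrices α β) {v : Space → Spinor}
    (hv : Integrable v) (hωv : Integrable fun ξ => omega m ξ ^ 2 * ‖v ξ‖ ^ 2)
    {Z G Φ : ℝ → Spinor} (hZ : Continuous Z) (hG : Continuous G) {τ : ℝ} (hZ0 : Z 0 = 0)
    (hZG : ∀ t ∈ Set.Ioo 0 τ, HasDerivAt Z (G t) t) {K : ℝ}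
    (hK : ∀ l > 0, ∀ t ∈ Set.Icc 0 τ,
      ‖∫ ξ, Real.exp (-l * omega m ξ) • mode m α β v Z t ξ‖ ≤ K)
    (hΦ : ∀ t ∈ Set.Ioc 0 τ, Tendsto (fun l => ∫ ξ, Real.exp (-l * omega m ξ) • mode m α β v Z t ξ)
      (𝓝[>] 0) (𝓝 (Φ t))) {t : ℝ} (ht : t ∈ Set.Icc 0 τ) :
    Integrable (fun ξ => omega m ξ ^ 2 * ‖mode m α β v Z t ξ‖ ^ 2) ∧
    ∫ ξ, omega m ξ ^ 2 * ‖mode m α β v Z t ξ‖ ^ 2 =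
      (∫ ξ, omega m ξ ^ 2 * ‖v ξ‖ ^ 2) - 2 * ∫ s in (0 : ℝ)..t, (inner ℂ (Φ s) (G s)).re := by
  obtain ⟨KG, hKG⟩ := isCompact_Icc.exists_bound_of_continuousOn (s := Set.Icc 0 τ) hG.continuousOn
  have hE := fun l (hl : 0 < l) => integral_exp_energy hm hαβ hv hωv hZ hG hZ0 hZG ht hl
  have hK0 : 0 ≤ K := (norm_nonneg _).trans (hK 1 one_pos t ht)
  have hms : AEStronglyMeasurable fun ξ => omega m ξ ^ 2 * ‖mode m α β v Z t ξ‖ ^ 2 := by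
    have h1 := (hE 1 one_pos).1.1
    have h2 : Measurable fun ξ => Real.exp (1 * omega m ξ) := ((measurable_omega m).const_mul _).exp
    refine (h2.aestronglyMeasurable.mul h1).congr (Eventually.of_forall fun ξ => ?_)
    simp only [Pi.mul_apply]
    rw [← mul_assoc, ← Real.exp_add, neg_mul, add_neg_cancel, Real.exp_zero, one_mul]
  refine integrable_of_tendsto_exp hm hms (fun ξ => by positivity) (fun l hl => (hE l hl).1) ?_
  have h1 : Tendsto (fun l => ∫ ξ, Real.exp (-l * omega m ξ) * (omega m ξ ^ 2 * ‖v ξ‖ ^ 2))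
      (𝓝[>] 0) (𝓝 (∫ ξ, omega m ξ ^ 2 * ‖v ξ‖ ^ 2)) := by
    refine tendsto_integral_filter_of_dominated_convergence (fun ξ => ‖omega m ξ ^ 2 * ‖v ξ‖ ^ 2‖)
      (Eventually.of_forall fun l => ?_) ?_ hωv.norm (Eventually.of_forall fun ξ => ?_)
    · exact ((measurable_omega m).const_mul _).exp.aestronglyMeasurable.mul hωv.1
    · filter_upwards [self_mem_nhdsWithin] with l hl
      refine Eventually.of_forall fun ξ => ?_
      rw [norm_mul, Real.norm_of_nonneg (Real.exp_pos _).le]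
      exact mul_le_of_le_one_left (norm_nonneg _) (exp_neg_mul_omega_le_one hm hl ξ)
    · simpa using (tendsto_exp_neg_mul_nhds_zero (omega m ξ)).mul_const (omega m ξ ^ 2 * ‖v ξ‖ ^ 2)
  have h2 : Tendsto (fun l => ∫ s in (0 : ℝ)..t,
      (inner ℂ (∫ ξ, Real.exp (-l * omega m ξ) • mode m α β v Z s ξ) (G s)).re) (𝓝[>] 0)
      (𝓝 (∫ s in (0 : ℝ)..t, (inner ℂ (Φ s) (G s)).re)) := by
    refine intervalIntegral.tendsto_integral_filter_of_dominated_convergence (fun _ => K * KG) ?_ ?_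
      (by simp) (Eventually.of_forall fun s hs => ?_)
    · filter_upwards [self_mem_nhdsWithin] with l hl
      exact (intervalIntegrable_iff.1 (hE l hl).2.1).1
    · filter_upwards [self_mem_nhdsWithin] with l hl
      refine Eventually.of_forall fun s hs => ?_
      rw [Set.uIoc_of_le ht.1] at hs
      have hs' : s ∈ Set.Icc 0 τ := ⟨hs.1.le, hs.2.trans ht.2⟩
      exact (Complex.abs_re_le_norm _).trans ((norm_inner_le_norm _ _).trans
        (mul_le_mul (hK l hl s hs') (hKG s hs') (norm_nonneg _) hK0))
    · rw [Set.uIoc_of_le ht.1] at hs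
      exact (Complex.continuous_re.tendsto _).comp
        ((hΦ s ⟨hs.1, hs.2.trans ht.2⟩).inner tendsto_const_nhds)
  refine (h1.sub (h2.const_mul 2)).congr' ?_
  filter_upwards [self_mem_nhdsWithin] with l hl
  exact (hE l hl).2.2.symm

/-! ### Potentials -/

/-- The derivative of the potential is `2 Re ⟨F(ζ), ·⟩`, by the definition of `∂_{ζ̄}`. -/
theorem IsPotential.fderiv_apply {a b : ℝ} {U : Spinor → ℝ} {F : Fin 4 → ℂ → ℂ}
    (hU : IsPotential a b U F) (ζ w : Spinor) :
    fderiv ℝ U ζ w = 2 * (inner ℂ (nonlinearity F ζ) w).re := by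
  have hw : w = ∑ j, ((w j).re • EuclideanSpace.single j (1 : ℂ)
      + (w j).im • EuclideanSpace.single j Complex.I) := by
    ext i
    simp only [PiLp.add_apply, PiLp.smul_apply, WithLp.ofLp_sum, Finset.sum_apply,
      PiLp.single_apply]
    rw [Finset.sum_eq_single i (fun j _ hj => by simp [hj.symm]) (by simp)]
    simp
  conv_lhs => rw [hw]
  simp only [map_sum, map_add, map_smul, smul_eq_mul]
  rw [PiLp.inner_apply, Complex.re_sum, Finset.mul_sum]
  refine Finset.sum_congr rfl fun j _ => ?_
  simp only [nonlinearity, hU.grad j ζ, dbar, RCLike.inner_apply]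
  simp
  ring

theorem IsPotential.continuous_nonlinearity {a b : ℝ} {U : Spinor → ℝ} {F : Fin 4 → ℂ → ℂ}
    (hU : IsPotential a b U F) : Continuous (nonlinearity F) := by
  have h1 : Continuous (fderiv ℝ U) := hU.contDiff.continuous_fderiv (by norm_num)
  have h2 : ∀ w, Continuous fun ζ => fderiv ℝ U ζ w := fun w => h1.clm_apply continuous_const
  refine (PiLp.continuous_toLp 2 _).comp (continuous_pi fun j => ?_)
  simp only [hU.grad j]
  unfold dbar
  exact continuous_const.mul ((Complex.continuous_ofReal.comp (h2 _)).add
    (continuous_const.mul (Complex.continuous_ofReal.comp (h2 _))))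

theorem IsPotential.sub_eq_integral {a b : ℝ} {U : Spinor → ℝ} {F : Fin 4 → ℂ → ℂ}
    (hU : IsPotential a b U F) {z G : ℝ → Spinor} (hz : Continuous z) (hG : Continuous G) {t : ℝ}
    (ht : 0 ≤ t) (hzG : ∀ s ∈ Set.Ioo 0 t, HasDerivAt z (G s) s) :
    U (z t) - U (z 0) = 2 * ∫ s in (0 : ℝ)..t, (inner ℂ (nonlinearity F (z s)) (G s)).re := by
  have hd : ∀ s ∈ Set.Ioo 0 t, HasDerivAt (fun s => U (z s))
      (2 * (inner ℂ (nonlinearity F (z s)) (G s)).re) s := fun s hs => by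
    rw [← hU.fderiv_apply]
    exact ((hU.contDiff.differentiable (by norm_num)) (z s)).hasFDerivAt.comp_hasDerivAt s
      (hzG s hs)
  have hc : Continuous fun s => 2 * (inner ℂ (nonlinearity F (z s)) (G s)).re :=
    continuous_const.mul (Complex.continuous_re.comp
      ((hU.continuous_nonlinearity.comp hz).inner hG))
  rw [← intervalIntegral.integral_const_mul]
  exact (intervalIntegral.integral_eq_sub_of_hasDerivAt_of_le ht
    (hU.contDiff.continuous.comp hz).continuousOn hd (hc.intervalIntegrable 0 t)).symm

/-! ### The modes of a solution -/

theorem greenHat_add (hm : 0 < m) (a b : Spinor) :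
    greenHat hm (a + b) = greenHat hm a + greenHat hm b := by
  refine Lp.ext ?_
  filter_upwards [coeFn_greenHat hm (a + b), coeFn_greenHat hm a, coeFn_greenHat hm b,
    Lp.coeFn_add (greenHat hm a) (greenHat hm b)] with ξ h1 h2 h3 h4
  rw [h1, h4, Pi.add_apply, h2, h3, smul_add]

theorem greenHat_smul (hm : 0 < m) (c : ℂ) (a : Spinor) :
    greenHat hm (c • a) = c • greenHat hm a := by
  refine Lp.ext ?_
  filter_upwards [coeFn_greenHat hm (c • a), coeFn_greenHat hm a,
    Lp.coeFn_smul c (greenHat hm a)] with ξ h1 h2 h3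
  rw [h1, h3, Pi.smul_apply, h2, smul_comm]

theorem continuous_greenHat (hm : 0 < m) : Continuous (greenHat hm) :=
  LinearMap.continuous_of_finiteDimensional
    (⟨⟨greenHat hm, greenHat_add hm⟩, greenHat_smul hm⟩ : Spinor →ₗ[ℂ] L2)

theorem continuous_fourier_L2 : Continuous fun u : L2 => (𝓕 u : L2) :=
  (Lp.fourierTransformₗᵢ Space Spinor).continuous

/-- The increment `ζ(t) - ζ₀` of the singular coefficient, continued by constants outside `[0, τ]`.
-/
noncomputable def increment (τ : ℝ) (ζ : ℝ → Spinor) (t : ℝ) : Spinor :=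
  ζ (max 0 (min t τ)) - ζ 0

theorem clamp_mem {τ : ℝ} (hτ : 0 ≤ τ) (t : ℝ) : max 0 (min t τ) ∈ Set.Icc 0 τ :=
  ⟨le_max_left _ _, max_le hτ (min_le_right _ _)⟩

theorem clamp_eq {τ t : ℝ} (ht : t ∈ Set.Icc 0 τ) : max 0 (min t τ) = t := by
  rw [min_eq_left ht.2, max_eq_right ht.1]

theorem continuous_comp_clamp {E : Type*} [TopologicalSpace E] {g : ℝ → E} {τ : ℝ} (hτ : 0 ≤ τ)
    (hg : ContinuousOn g (Set.Icc 0 τ)) : Continuous fun t => g (max 0 (min t τ)) :=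
  hg.comp_continuous (by fun_prop) (clamp_mem hτ)

variable {F : Fin 4 → ℂ → ℂ} {τ : ℝ} {f : L2} {ζ₀ : Spinor} {ψ u : ℝ → L2} {ζ : ℝ → Spinor}

theorem IsSolution.fourier_eq (hm : 0 < m) (h : IsSolution m α β F τ f ζ₀ ψ u ζ) {t : ℝ}
    (ht : t ∈ Set.Icc 0 τ) : (𝓕 (ψ t) : L2) = 𝓕 (u t) + greenHat hm (ζ t) := by
  rcases ht.1.eq_or_lt with h0 | h0
  · rw [← h0, h.initial_regular, h.initial_zeta]
    exact fourier_of_decomposes hm h.initial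
  · exact fourier_of_decomposes hm (h.domain t ⟨h0, ht.2⟩).decomp

theorem IsSolution.continuousOn_fourier (hm : 0 < m) (h : IsSolution m α β F τ f ζ₀ ψ u ζ) :
    ContinuousOn (fun t => (𝓕 (u t) : L2)) (Set.Icc 0 τ) := by
  have h1 : ContinuousOn (fun t => (𝓕 (ψ t) : L2) - greenHat hm (ζ t)) (Set.Icc 0 τ) :=
    (continuous_fourier_L2.comp_continuousOn h.continuousOn_psi).sub
      ((continuous_greenHat hm).comp_continuousOn h.continuousOn_zeta)
  refine h1.congr fun t ht => ?_
  simp only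
  rw [h.fourier_eq hm ht, add_sub_cancel_right]

/-- The Fourier transform of the regular part of a solution is given by the modes. -/
theorem IsSolution.fourier_ae_eq_mode (hm : 0 < m) (hαβ : IsDiracMatrices α β) (hτ : 0 < τ)
    (h : IsSolution m α β F τ f ζ₀ ψ u ζ) {t : ℝ} (ht : t ∈ Set.Icc 0 τ) :
    ∀ᵐ ξ, (𝓕 (u t) : L2) ξ = mode m α β ((𝓕 f : L2) : Space → Spinor) (increment τ ζ) t ξ := by
  have hZ : Continuous (increment τ ζ) :=
    (continuous_comp_clamp hτ.le h.continuousOn_zeta).sub continuous_const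
  have hZe : ∀ s ∈ Set.Icc 0 τ, increment τ ζ s = ζ s - ζ 0 := fun s hs => by
    rw [increment, clamp_eq hs]
  -- subtracting `ω⁻² ζ(0)` replaces `ζ` by its increment, so that the source vanishes initially
  set Y : ℝ → L2 := fun s => 𝓕 (ψ s) - greenHat hm (ζ 0) with hY
  have hYe : ∀ s ∈ Set.Icc 0 τ, Y s = 𝓕 (u s) + greenHat hm (increment τ ζ s) := fun s hs => by
    have e := greenHat_add hm (ζ s - ζ 0) (ζ 0)
    rw [sub_add_cancel] at e
    simp only [hY]
    rw [h.fourier_eq hm hs, hZe s hs, e]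
    abel
  have hYd : ∀ s ∈ Set.Ioo 0 τ, ∀ χ : 𝓢(Space, ℂ), HasDerivAt (fun s => ∫ ξ, χ ξ • Y s ξ)
      (-Complex.I • ∫ ξ, χ ξ • diracSymbol m α β ξ ((𝓕 (u s) : L2) ξ)) s := fun s hs χ => by
    have h1 := hasDerivAt_fourier (α := α) (β := β) hm
      (h.domain s ⟨hs.1, hs.2.le⟩).decomp (h.equation s hs) χ
    have h2 := h1.sub_const (∫ ξ, χ ξ • greenHat hm (ζ 0) ξ)
    refine h2.congr_of_eventuallyEq (Eventually.of_forall fun r => ?_)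
    simp only
    rw [← integral_sub (integrable_schwartz_smul χ (Lp.memLp _))
      (integrable_schwartz_smul χ (Lp.memLp _))]
    refine integral_congr_ae ?_
    filter_upwards [Lp.coeFn_sub (𝓕 (ψ r) : L2) (greenHat hm (ζ 0))] with ξ hξ
    simp only [hY]
    rw [hξ, Pi.sub_apply, smul_sub]
  have hD := duhamel hm hαβ (Y := Y) (u := fun s => (𝓕 (u s) : L2))
    ((continuous_fourier_L2.comp_continuousOn h.continuousOn_psi).sub continuousOn_const) hZ hYd
    (fun s hs => hYe s (Set.Ioo_subset_Icc_self hs)) ht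
  have h0 : Y 0 = 𝓕 f := by
    have h00 : (0 : ℝ) ∈ Set.Icc 0 τ := ⟨le_rfl, hτ.le⟩
    have e : greenHat hm 0 = 0 := by simpa using greenHat_smul hm 0 0
    rw [hYe 0 h00, hZe 0 h00, sub_self, e, add_zero, h.initial_regular]
  have hut : (𝓕 (u t) : L2) = Y t - greenHat hm (increment τ ζ t) := by
    rw [hYe t ht, add_sub_cancel_right]
  rw [h0] at hD
  rw [hut]
  filter_upwards [hD, coeFn_greenHat hm (increment τ ζ t),
    Lp.coeFn_sub (Y t) (greenHat hm (increment τ ζ t))] with ξ h1 h2 h3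
  rw [h3, Pi.sub_apply, h1, h2, mode]

/-! ### Regularity of the singular coefficient and conservation of energy -/

theorem integrable_weight_smul (hm : 0 < m) {v : Space → Spinor} (hv : MemLp v 2)
    (hvi : Integrable v) : Integrable fun ξ => weight m ξ • v ξ := by
  refine ((integrable_memLp_smul (memLp_weight_sub_one hm) hv).add hvi).congr
    (Eventually.of_forall fun ξ => ?_)
  simp only [Pi.add_apply]
  module

theorem integrable_omega_sq_mul_norm_sq {f : L2}
    (hf : TemperedDistribution.MemSobolev 2 2 (f : Distr)) :
    Integrable fun ξ => omega m ξ ^ 2 * ‖(𝓕 f : L2) ξ‖ ^ 2 := by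
  have h1 := memLp_of_memSobolev hf
  have h2 := h1.norm.integrable_sq.const_mul ((2 * Real.pi) ^ 2 + m ^ 2)
  refine h2.mono' (((measurable_omega m).pow_const 2).aestronglyMeasurable.mul
    ((Lp.aestronglyMeasurable _).norm.pow 2)) (Eventually.of_forall fun ξ => ?_)
  rw [Real.norm_of_nonneg (by positivity), norm_smul, Real.norm_of_nonneg (by positivity),
    mul_pow (_ ^ (2 / 2 : ℝ)), ← mul_assoc]
  refine mul_le_mul_of_nonneg_right ?_ (sq_nonneg _)
  rw [div_self two_ne_zero, Real.rpow_one, omega_sq]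
  have h3 : 0 ≤ ‖ξ‖ ^ 2 := sq_nonneg _
  have h4 : 1 + ‖ξ‖ ^ 2 ≤ (1 + ‖ξ‖ ^ 2) ^ 2 := by nlinarith
  calc (2 * Real.pi * ‖ξ‖) ^ 2 + m ^ 2 ≤ ((2 * Real.pi) ^ 2 + m ^ 2) * (1 + ‖ξ‖ ^ 2) := by
        nlinarith [mul_nonneg (sq_nonneg m) h3, sq_nonneg (2 * Real.pi)]
    _ ≤ _ := mul_le_mul_of_nonneg_left h4 (by positivity)

/-- The functional `v ↦ ∫ (W - 1) v` is continuous on `L²`. -/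
theorem continuous_integral_weight_sub_one (hm : 0 < m) :
    Continuous fun v : L2 => ∫ ξ, (weight m ξ - 1) • v ξ := by
  obtain ⟨M, hM0, hM⟩ := exists_integral_norm_smul_le (memLp_weight_sub_one hm)
  refine (LipschitzWith.of_dist_le_mul (K := ⟨M, hM0⟩) fun v w => ?_).continuous
  rw [dist_eq_norm, dist_eq_norm, ← integral_sub
    (integrable_memLp_smul (memLp_weight_sub_one hm) (Lp.memLp v))
    (integrable_memLp_smul (memLp_weight_sub_one hm) (Lp.memLp w))]
  refine (norm_integral_le_integral_norm _).trans (le_trans (le_of_eq ?_) (hM (v - w)))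
  refine integral_congr_ae ?_
  filter_upwards [Lp.coeFn_sub v w] with ξ hξ
  rw [hξ, Pi.sub_apply, smul_sub]

/-- The rate of change of the singular coefficient, read off from the boundary condition
`K ψ_reg(0) = F(ζ)`: the value which makes the limit of the weighted Abel means of the modes equal
to `F(ζ) + ∫ (W - 1) ψ̂_reg`. -/
noncomputable def rate (m : ℝ) (α : Fin 3 → Matrix (Fin 4) (Fin 4) ℂ)
    (β : Matrix (Fin 4) (Fin 4) ℂ) (F : Fin 4 → ℂ → ℂ) (τ : ℝ) (f : L2) (u : ℝ → L2)
    (ζ : ℝ → Spinor) (t : ℝ) : Spinor :=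
  (shellConst * (Real.pi / 2))⁻¹ •
    (tameLimit m α β ((𝓕 f : L2) : Space → Spinor) (increment τ ζ) t
      - (nonlinearity F (ζ t) + ∫ ξ, (weight m ξ - 1) • (𝓕 (u t) : L2) ξ))

theorem rate_smul (t : ℝ) : shellConst • (Real.pi / 2) • rate m α β F τ f u ζ t =
    tameLimit m α β ((𝓕 f : L2) : Space → Spinor) (increment τ ζ) t
      - (nonlinearity F (ζ t) + ∫ ξ, (weight m ξ - 1) • (𝓕 (u t) : L2) ξ) := by
  have h : shellConst * (Real.pi / 2) ≠ 0 := (mul_pos shellConst_pos (by positivity)).ne'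
  rw [rate, smul_smul, smul_smul, mul_inv_cancel₀ h, one_smul]

/-- The singular coefficient of a solution is continuously differentiable, up to the initial time.
-/
theorem IsSolution.increment_eq_integral (hm : 0 < m) (hαβ : IsDiracMatrices α β) (hτ : 0 < τ)
    {a b : ℝ} {U : Spinor → ℝ} (hU : IsPotential a b U F)
    (hf : TemperedDistribution.MemSobolev 2 2 (f : Distr))
    (h : IsSolution m α β F τ f ζ₀ ψ u ζ) :
    Continuous (fun t => rate m α β F τ f u ζ (max 0 (min t τ))) ∧
    ∀ t ∈ Set.Icc 0 τ, increment τ ζ t =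
      ∫ s in (0 : ℝ)..t, rate m α β F τ f u ζ (max 0 (min s τ)) := by
  have hZ : Continuous (increment τ ζ) :=
    (continuous_comp_clamp hτ.le h.continuousOn_zeta).sub continuous_const
  have hv := Lp.memLp (𝓕 f : L2)
  have hvi : Integrable ((𝓕 f : L2) : Space → Spinor) := by
    simpa using integrable_of_memSobolev (s := 2) (r := 0) (by norm_num) hf
  have hWv := integrable_weight_smul hm hv hvi
  have hG : Continuous fun t => rate m α β F τ f u ζ (max 0 (min t τ)) := by
    refine continuous_comp_clamp hτ.le (g := rate m α β F τ f u ζ) ?_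
    refine ContinuousOn.const_smul ?_ (shellConst * (Real.pi / 2))⁻¹
    exact (continuous_tameLimit hm hαβ hv hWv hZ).continuousOn.sub
      ((hU.continuous_nonlinearity.comp_continuousOn h.continuousOn_zeta).add
        ((continuous_integral_weight_sub_one hm).comp_continuousOn (h.continuousOn_fourier hm)))
  refine ⟨hG, fun t ht => ?_⟩
  refine eq_integral_of_slope hZ hG ?_ (fun s hs L A d hd hA => ?_) ht
  · rw [increment, clamp_eq ⟨le_rfl, hτ.le⟩, sub_self]
  · have hs' : s ∈ Set.Icc 0 τ := Set.Ioc_subset_Icc_self hs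
    have hdom := h.domain s hs
    have hae := h.fourier_ae_eq_mode hm hαβ hτ hs'
    have hmode : MemLp (mode m α β ((𝓕 f : L2) : Space → Spinor) (increment τ ζ) s) 2 :=
      (Lp.memLp (𝓕 (u s) : L2)).ae_eq hae
    obtain ⟨hi, hV⟩ := tendsto_integral_rpow_omega_weight hm (Lp.memLp (𝓕 (u s) : L2))
      (fun ε hε => integrable_smoothing hm hdom.regular hε)
      (tendsto_of_hasRegularizedValue hm hdom.regular hdom.value)
    have hi' : ∀ ε : ℝ, 0 < ε → Integrable fun ξ => omega m ξ ^ (-2 * ε) • weight m ξ •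
        mode m α β ((𝓕 f : L2) : Space → Spinor) (increment τ ζ) s ξ := fun ε hε =>
      (hi ε hε).congr (by filter_upwards [hae] with ξ hξ; rw [hξ])
    have hV' := hV.congr' (Eventually.of_forall fun ε : ℝ => integral_congr_ae
      (g := fun ξ => omega m ξ ^ (-2 * ε) • weight m ξ •
        mode m α β ((𝓕 f : L2) : Space → Spinor) (increment τ ζ) s ξ)
      (by filter_upwards [hae] with ξ hξ; rw [hξ]))
    have h1 := apply_le_of_slope hm hαβ hv hWv hZ hs.1 hmode hi' hV' L hd hA
    rw [clamp_eq hs']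
    have h2 := congrArg L (rate_smul (m := m) (α := α) (β := β) (F := F) (τ := τ) (f := f) (u := u)
      (ζ := ζ) s)
    rw [map_smul, map_smul, map_sub, smul_eq_mul, smul_eq_mul] at h2
    have h3 : shellConst * (Real.pi / 2) * A ≤
        shellConst * (Real.pi / 2) * L (rate m α β F τ f u ζ s) := by linarith
    exact le_of_mul_le_mul_left h3 (mul_pos shellConst_pos (by positivity))

/-- Conservation of energy: the energy at time `t` is that of the initial state. -/
theorem IsSolution.hasEnergy (hm : 0 < m) (hαβ : IsDiracMatrices α β) (hτ : 0 < τ)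
    {a b : ℝ} {U : Spinor → ℝ} (hU : IsPotential a b U F)
    (hf : TemperedDistribution.MemSobolev 2 2 (f : Distr))
    (h : IsSolution m α β F τ f ζ₀ ψ u ζ) {t : ℝ} (ht : t ∈ Set.Icc 0 τ) :
    HasEnergy m α β U (u t) (ζ t) ((∫ ξ, omega m ξ ^ 2 * ‖(𝓕 f : L2) ξ‖ ^ 2) + U ζ₀) := by
  set v : Space → Spinor := ((𝓕 f : L2) : Space → Spinor) with hvdef
  set Z := increment τ ζ with hZdef
  obtain ⟨hG, hZG⟩ := h.increment_eq_integral hm hαβ hτ hU hf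
  set G : ℝ → Spinor := fun t => rate m α β F τ f u ζ (max 0 (min t τ)) with hGdef
  have hZ : Continuous Z :=
    (continuous_comp_clamp hτ.le h.continuousOn_zeta).sub continuous_const
  have h00 : (0 : ℝ) ∈ Set.Icc 0 τ := ⟨le_rfl, hτ.le⟩
  have hZ0 : Z 0 = 0 := by rw [hZdef, hZG 0 h00, intervalIntegral.integral_same]
  have hZe : ∀ s ∈ Set.Icc 0 τ, ζ₀ + Z s = ζ s := fun s hs => by
    rw [hZdef, increment, clamp_eq hs, h.initial_zeta, add_sub_cancel]
  have hZd : ∀ s ∈ Set.Ioo 0 τ, HasDerivAt Z (G s) s := fun s hs => by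
    have h1 : HasDerivAt (fun s => ∫ r in (0 : ℝ)..s, G r) (G s) s :=
      intervalIntegral.integral_hasDerivAt_right (hG.intervalIntegrable 0 s)
        (hG.stronglyMeasurableAtFilter _ _) hG.continuousAt
    refine h1.congr_of_eventuallyEq ?_
    filter_upwards [Icc_mem_nhds hs.1 hs.2] with r hr using hZG r hr
  have hv : MemLp v 2 := Lp.memLp (𝓕 f : L2)
  have hvi : Integrable v := by
    simpa using integrable_of_memSobolev (s := 2) (r := 0) (by norm_num) hf
  have hWv := integrable_weight_smul hm hv hvi
  have hae := fun s (hs : s ∈ Set.Icc 0 τ) => h.fourier_ae_eq_mode hm hαβ hτ hs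
  have hmode : ∀ s ∈ Set.Icc 0 τ, MemLp (mode m α β v Z s) 2 := fun s hs =>
    (Lp.memLp (𝓕 (u s) : L2)).ae_eq (hae s hs)
  obtain ⟨M, hM0, hM⟩ := exists_integral_norm_smul_le (memLp_weight_sub_one hm)
  obtain ⟨Ku, hKu⟩ := isCompact_Icc.exists_bound_of_continuousOn (h.continuousOn_fourier hm)
  obtain ⟨K, hK⟩ := exists_norm_integral_exp_mode_le hm hαβ hv hWv hZ hG hZG hmode (K₀ := M * Ku)
    (fun s hs => by
      have e : ∫ ξ, ‖(weight m ξ - 1) • mode m α β v Z s ξ‖ =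
          ∫ ξ, ‖(weight m ξ - 1) • (𝓕 (u s) : L2) ξ‖ := integral_congr_ae (by
        filter_upwards [hae s hs] with ξ hξ
        rw [hξ])
      rw [e]
      exact (hM _).trans (mul_le_mul_of_nonneg_left (hKu s hs) hM0))
  have hΦ : ∀ s ∈ Set.Ioc 0 τ, Tendsto (fun l => ∫ ξ, Real.exp (-l * omega m ξ) •
      mode m α β v Z s ξ) (𝓝[>] 0) (𝓝 (nonlinearity F (ζ₀ + Z s))) := fun s hs => by
    have hs' : s ∈ Set.Icc 0 τ := Set.Ioc_subset_Icc_self hs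
    have h1 := tendsto_integral_exp_mode hm hαβ hv hWv hZ hG hZG hs (hmode s hs')
    have e : ∫ ξ, (weight m ξ - 1) • mode m α β v Z s ξ =
        ∫ ξ, (weight m ξ - 1) • (𝓕 (u s) : L2) ξ := integral_congr_ae (by
      filter_upwards [hae s hs'] with ξ hξ
      rw [hξ])
    have e2 : G s = rate m α β F τ f u ζ s := by rw [hGdef]; simp only [clamp_eq hs']
    rw [e, e2, rate_smul, sub_sub_cancel, add_sub_cancel_right, ← hZe s hs'] at h1
    exact h1
  obtain ⟨hE1, hE2⟩ := integral_energy hm hαβ hvi (integrable_omega_sq_mul_norm_sq hf) hZ hG hZ0 hZd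
    hK hΦ ht
  have hpot := hU.sub_eq_integral (z := fun s => ζ₀ + Z s) (continuous_const.add hZ) hG ht.1
    (fun s hs => (hZd s ⟨hs.1, hs.2.trans_le ht.2⟩).const_add ζ₀)
  simp only [hZ0, add_zero] at hpot
  rw [hZe t ht] at hpot
  have hD : ∀ ξ, ‖diracSymbol m α β ξ ((𝓕 (u t) : L2) ξ)‖ ^ 2 =
      omega m ξ ^ 2 * ‖(𝓕 (u t) : L2) ξ‖ ^ 2 := fun ξ => by
    rw [norm_diracSymbol hm hαβ, mul_pow]
  have hDe : (fun ξ => omega m ξ ^ 2 * ‖mode m α β v Z t ξ‖ ^ 2) =ᵐ[volume]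
      fun ξ => ‖diracSymbol m α β ξ ((𝓕 (u t) : L2) ξ)‖ ^ 2 := by
    filter_upwards [hae t ht] with ξ hξ
    rw [hD, hξ]
  refine hasEnergy_of_memLp ?_ ?_
  · rw [← memLp_norm_iff (aestronglyMeasurable_diracSymbol (Lp.aestronglyMeasurable _)),
      memLp_two_iff_integrable_sq
        (aestronglyMeasurable_diracSymbol (Lp.aestronglyMeasurable _)).norm]
    exact hE1.congr hDe
  · rw [← integral_congr_ae hDe, hE2]
    linarith

end DiracPoint

theorem lemma5p3
    (m : ℝ) (hm : 0 < m)
    (α : Fin 3 → Matrix (Fin 4) (Fin 4) ℂ) (β : Matrix (Fin 4) (Fin 4) ℂ)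
    (hαβ : DiracPoint.IsDiracMatrices α β)
    (a b : ℝ) (hb : 0 < b)
    (U : DiracPoint.Spinor → ℝ) (F : Fin 4 → ℂ → ℂ)
    (hU : DiracPoint.IsPotential a b U F)
    (f : DiracPoint.L2)
    (hf : TemperedDistribution.MemSobolev 2 2 (f : DiracPoint.Distr))
    (ζ₀ : DiracPoint.Spinor)
    (E₀ : ℝ) (hE₀ : DiracPoint.HasEnergy m α β U f ζ₀ E₀)
    (U' : DiracPoint.Spinor → ℝ) (F' : Fin 4 → ℂ → ℂ)
    (hU' : DiracPoint.IsPotential a b U' F')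
    (hUU' : ∀ ζ : DiracPoint.Spinor, ‖ζ‖ ≤ Real.sqrt ((E₀ + a) / b) → U' ζ = U ζ)
    (hLip : ∃ C : ℝ, ∀ (j : Fin 4) (z w : ℂ), ‖F' j z - F' j w‖ ≤ C * ‖z - w‖)
    (τ : ℝ) (hτ : 0 < τ)
    (ψ ψreg : ℝ → DiracPoint.L2) (ζ : ℝ → DiracPoint.Spinor)
    (hψ : DiracPoint.IsSolution m α β F' τ f ζ₀ ψ ψreg ζ) :
    ∃ h : ℝ, ∀ t ∈ Set.Icc 0 τ, DiracPoint.HasEnergy m α β U' (ψreg t) (ζ t) h := by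
  exact ⟨_, fun t ht => hψ.hasEnergy hm hαβ hτ hU' hf ht⟩
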